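/- Let $\alpha\ge\beta\ge-\tfrac12$, $\alpha>-\tfrac12$, $\rho=\alpha+\beta+1$, and let \[ \varphi_\lambda(t)=F\Bigl(\tfrac{\rho+i\lambda}{2},\tfrac{\rho-i\lambda}{2};\alpha+1;-(\sinh t)^2\Bigr),\qquad \psi_\lambda(t)=\frac{\varphi_\lambda(t)}{\varphi_0(t)},\qquad \Delta(t)=2^{2\rho}(\sinh t)^{2\alpha+1}(\cosh t)^{2\beta+1}, \] where $F$ is the Gauss hypergeometric function ($\varphi_\lambda$ is the Jacobi function). For $t>0$ let $0<\lambda_1(t)<\lambda_2(t)<\cdots$ be the positive zeros of $\lambda\mapsto\varphi_\lambda(t)$ and $0<\lambda_1^*(t)<\lambda_2^*(t)<\cdots$ the positive zeros of $\lambda\mapsto\psi_\lambda'(t)$ (derivative in $t$), and let $t_k$, $t_k^*$ be the inverse functions of $\lambda_k$, $\lambda_k^*$ on $(0,\infty)$. For $\gamma>0$ let $\mathcal L^+_\gamma$ be the class of functions $g(t)=\int_{[0,\gamma]}\varphi_\lambda(t)\,d\nu(\lambda)$, $t\in\mathbb R$, with a finite nonnegative Borel measure $\nu$ and $g(0)>0$.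 Let $N_{[0,L]}(g)$ be the number of zeros of $g$ on $[0,L]$ counted with multiplicity, and, for $n\ge1$, $L(g,n)=\inf\{L>0: N_{[0,L]}(g)\ge n\}\in[0,\infty]$. An even continuous function $g$ is called positive definite if $\sum_{i,j=1}^N c_i\overline{c_j}\,T^{x_i}g(x_j)\ge0$ for all $N$, $c_i\in\mathbb C$, $x_i\ge0$, where $T^t$ is the generalized translation of the Jacobi transform, i.e. $T^tg(x)$ is the mean of $g(\operatorname{arcosh}|\cosh t\cosh x+re^{i\chi}\sinh t\sinh x|)$ with respect to the probability measure on $[0,1]\times[0,\pi]$ with density proportional to $(1-r^2)^{\alpha-\beta-1}r^{2\beta+1}(\sin\chi)^{2\beta}$ in $(r,\chi)$ (with $r=1$ if $\alpha=\beta$, and with $\chi\in\{0,\pi\}$, each of probability $\tfrac12$, if $\beta=-\tfrac12$). **Theorem.** For every $m\ge1$ the numbers $t_m(\gamma)$ and $t_m^*(\gamma)$ are well defined, and with \[ \theta_{n,\gamma}=\begin{cases}t_m(\gamma),&n=2m-1,\\ t_m^*(\gamma),&n=2m,\end{cases} \] one has $\inf_{g\in\mathcal L^+_\gamma}L(g,n)\le\theta_{n,\gamma}$.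 Moreover, there is a positive definite function $G_n\in\mathcal L^+_\gamma$ with $L(G_n,n)=\theta_{n,\gamma}$ whose only zero on $[0,\theta_{n,\gamma}]$ is $\theta_{n,\gamma}$, of multiplicity $n$. Explicitly, with $\tau=\theta_{n,\gamma}$, one can take \[ G_{2m-1}(t)=\sum_{i=1}^m B_i\,\varphi_{\lambda_i}(t),\qquad B_i=-\frac{A_i}{\Delta(\tau)\,\varphi_{\lambda_i}'(\tau)}>0,\qquad A_i=\frac{\prod_{j=1}^m\lambda_j^2}{\prod_{j\ne i}(\lambda_j^2-\lambda_i^2)},\qquad \lambda_i=\lambda_i(\tau), \] \[ G_{2m}(t)=\varphi_0(t)+\sum_{i=1}^m B_i^*\,\varphi_{\lambda_i^*}(t),\qquad B_i^*=-\frac{A_i^*}{\lambda_i^{*2}\,\psi_{\lambda_i^*}(\tau)}>0,\qquad A_i^*=\frac{\prod_{j=1}^m\lambda_j^{*2}}{\prod_{j\ne i}(\lambda_j^{*2}-\lambda_i^{*2})},\qquad \lambda_i^*=\lambda_i^*(\tau), \] where products over $j\neq i$ run over $1\le j\le m$. -/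

import Mathlib

open scoped ENNReal

noncomputable section

namespace JacobiZeros

/-- The Gauss hypergeometric function `F(a, b; c; z)` for real `z < 1/2`: the power series at `0`,
continued analytically by `F(a, b; c; z) = (1 - z)^(-a) F(a, c - b; c; z / (z - 1))`;
for `z < 1/2` the argument `z / (z - 1)` lies in the open unit disk, where the series converges. -/
def gaussF (a b c : ℂ) (z : ℝ) : ℂ :=
  (((1 - z : ℝ) : ℂ) ^ (-a)) * ordinaryHypergeometric a (c - b) c ((z / (z - 1) : ℝ) : ℂ)

/-- The Jacobi function
`φ_l(t) = F((ρ + i l)/2, (ρ - i l)/2; α + 1; -(sinh t)^2)`, `ρ = α + β + 1`.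
It is real for real `l` and `t`. -/
def jacobiPhi (α β l t : ℝ) : ℝ :=
  (gaussF ((((α + β + 1 : ℝ) : ℂ) + Complex.I * l) / 2)
    ((((α + β + 1 : ℝ) : ℂ) - Complex.I * l) / 2) ((α + 1 : ℝ) : ℂ) (-(Real.sinh t) ^ 2)).re

/-- `ψ_l(t) = φ_l(t) / φ_0(t)`. -/
def jacobiPsi (α β l t : ℝ) : ℝ := jacobiPhi α β l t / jacobiPhi α β 0 t

/-- `ψ_l'(t)`, the derivative being taken in `t`. -/
def jacobiPsiDeriv (α β l t : ℝ) : ℝ := deriv (jacobiPsi α β l) t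

/-- The weight `Δ(t) = 2^(2ρ) (sinh t)^(2α+1) (cosh t)^(2β+1)`. -/
def weight (α β t : ℝ) : ℝ :=
  (2 : ℝ) ^ (2 * (α + β + 1)) * Real.sinh t ^ (2 * α + 1) * Real.cosh t ^ (2 * β + 1)

/-! ### Positive zeros -/

/-- `x` is the `k`-th positive zero of `f` (counted from `k = 1`, in increasing order, without
multiplicity). -/
def IsNthPosZero (f : ℝ → ℝ) (k : ℕ) (x : ℝ) : Prop :=
  0 < x ∧ f x = 0 ∧ {y : ℝ | 0 < y ∧ y ≤ x ∧ f y = 0}.encard = k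

/-- The `k`-th positive zero of `f`. (The set below has at most one element.) -/
def nthPosZero (f : ℝ → ℝ) (k : ℕ) : ℝ := sInf {x | IsNthPosZero f k x}

/-- `λ_k(t)`: the `k`-th positive zero of `l ↦ φ_l(t)`. -/
def lam (α β : ℝ) (k : ℕ) (t : ℝ) : ℝ := nthPosZero (fun l => jacobiPhi α β l t) k

/-- `λ_k^*(t)`: the `k`-th positive zero of `l ↦ ψ_l'(t)`. -/
def lamStar (α β : ℝ) (k : ℕ) (t : ℝ) : ℝ := nthPosZero (fun l => jacobiPsiDeriv α β l t) k

/-- `t = t_k(l)`, i.e. `t > 0` and `l` is the `k`-th positive zero `λ_k(t)`. -/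
def IsT (α β : ℝ) (k : ℕ) (l t : ℝ) : Prop :=
  0 < t ∧ IsNthPosZero (fun μ => jacobiPhi α β μ t) k l

/-- `t = t_k^*(l)`, i.e. `t > 0` and `l` is the `k`-th positive zero `λ_k^*(t)`. -/
def IsTStar (α β : ℝ) (k : ℕ) (l t : ℝ) : Prop :=
  0 < t ∧ IsNthPosZero (fun μ => jacobiPsiDeriv α β μ t) k l

/-! ### The class of functions, number of zeros, shortest interval -/

/-- The class `𝓛⁺_γ` of functions `g(t) = ∫_{[0,γ]} φ_l(t) dν(l)`, `g(0) > 0`,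
with a finite nonnegative measure `ν`. -/
def classL (α β γ : ℝ) : Set (ℝ → ℝ) :=
  {g | (∃ ν : MeasureTheory.Measure ℝ, MeasureTheory.IsFiniteMeasure ν ∧
      ∀ t : ℝ, g t = ∫ l in Set.Icc 0 γ, jacobiPhi α β l t ∂ν) ∧ 0 < g 0}

/-- `N_I(g)`: the number of zeros of the (analytic) function `g` in `I`, with multiplicity. -/
def numZeros (g : ℝ → ℝ) (I : Set ℝ) : ℕ∞ :=
  ⨆ (s : Finset ℝ) (_ : (s : Set ℝ) ⊆ I), ∑ t ∈ s, analyticOrderAt g t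

/-- `L(g, n) = inf {L > 0 : N_{[0,L]}(g) ≥ n}`, with value `∞` if there is no such `L`. -/
def shortestLength (g : ℝ → ℝ) (n : ℕ) : ℝ≥0∞ :=
  ⨅ (L : ℝ) (_ : 0 < L ∧ (n : ℕ∞) ≤ numZeros g (Set.Icc 0 L)), ENNReal.ofReal L

/-! ### Generalized translation and positive definiteness -/

/-- Mean of `h` over `[0,1]` with respect to the probability density
`2 Γ(α+1) / (Γ(β+1) Γ(α-β)) (1 - r^2)^(α-β-1) r^(2β+1)`;
for `α = β` this is the unit mass at `1`. -/
def radialMean (α β : ℝ) (h : ℝ → ℝ) : ℝ :=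
  if α = β then h 1
  else 2 * Real.Gamma (α + 1) / (Real.Gamma (β + 1) * Real.Gamma (α - β)) *
    ∫ r in (0 : ℝ)..1, h r * ((1 - r ^ 2) ^ (α - β - 1) * r ^ (2 * β + 1))

/-- Mean of `h` over `[0,π]` with respect to the probability density
`Γ(β+1) / (Γ(1/2) Γ(β+1/2)) (sin χ)^(2β)`;
for `β = -1/2` these are masses `1/2` at `0` and at `π`. -/
def angularMean (β : ℝ) (h : ℝ → ℝ) : ℝ :=
  if β = -1 / 2 then (h 0 + h Real.pi) / 2
  else Real.Gamma (β + 1) / (Real.Gamma (1 / 2) * Real.Gamma (β + 1 / 2)) *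
    ∫ χ in (0 : ℝ)..Real.pi, h χ * Real.sin χ ^ (2 * β)

/-- The generalized translation `T^t g(x)` of the Jacobi transform:
the mean of `g (arcosh |cosh t cosh x + r e^{iχ} sinh t sinh x|)` over `r` and `χ`. -/
def translation (α β : ℝ) (t : ℝ) (g : ℝ → ℝ) (x : ℝ) : ℝ :=
  radialMean α β fun r => angularMean β fun χ =>
    g (Real.arcosh ‖((Real.cosh t * Real.cosh x : ℝ) : ℂ) +
      (r : ℂ) * Complex.exp (Complex.I * χ) * ((Real.sinh t * Real.sinh x : ℝ) : ℂ)‖)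

open scoped ComplexOrder in
/-- Positive definiteness with respect to the Jacobi transform. (In `ℂ`, `0 ≤ z` means that `z` is
a nonnegative real number.) -/
def IsPosDef (α β : ℝ) (g : ℝ → ℝ) : Prop :=
  Continuous g ∧ (∀ t, g (-t) = g t) ∧
    ∀ (N : ℕ) (c : Fin N → ℂ) (x : Fin N → ℝ), (∀ i, 0 ≤ x i) →
      0 ≤ ∑ i, ∑ j, c i * (starRingEnd ℂ) (c j) * ((translation α β (x i) g (x j) : ℝ) : ℂ)

/-! ### The extremal functions -/

/-- The coefficients in
`1 / ∏_{i=1}^m (1 - s^2 / z_i^2) = ∑_{i=1}^m A_i / (z_i^2 - s^2)`. -/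
def pfCoeff (z : ℕ → ℝ) (m i : ℕ) : ℝ :=
  (∏ j ∈ Finset.Icc 1 m, z j ^ 2) / ∏ j ∈ (Finset.Icc 1 m).erase i, (z j ^ 2 - z i ^ 2)

/-- `B_i(τ) = - A_i / (Δ(τ) φ_{λ_i(τ)}'(τ))`. -/
def coeffB (α β : ℝ) (m : ℕ) (τ : ℝ) (i : ℕ) : ℝ :=
  -pfCoeff (fun j => lam α β j τ) m i /
    (weight α β τ * deriv (jacobiPhi α β (lam α β i τ)) τ)

/-- `B_i^*(τ) = - A_i^* / (λ_i^*(τ)^2 ψ_{λ_i^*(τ)}(τ))`. -/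
def coeffBStar (α β : ℝ) (m : ℕ) (τ : ℝ) (i : ℕ) : ℝ :=
  -pfCoeff (fun j => lamStar α β j τ) m i /
    (lamStar α β i τ ^ 2 * jacobiPsi α β (lamStar α β i τ) τ)

/-- `∑_{i=1}^m B_i(τ) φ_{λ_i(τ)}(t)`. -/
def extremalOdd (α β : ℝ) (m : ℕ) (τ t : ℝ) : ℝ :=
  ∑ i ∈ Finset.Icc 1 m, coeffB α β m τ i * jacobiPhi α β (lam α β i τ) t

/-- `φ_0(t) + ∑_{i=1}^m B_i^*(τ) φ_{λ_i^*(τ)}(t)`. -/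
def extremalEven (α β : ℝ) (m : ℕ) (τ t : ℝ) : ℝ :=
  jacobiPhi α β 0 t +
    ∑ i ∈ Finset.Icc 1 m, coeffBStar α β m τ i * jacobiPhi α β (lamStar α β i τ) t

/-- `G ∈ 𝓛⁺_γ` is positive definite, satisfies `L(G, n) = θ`, and on `[0, θ]` it vanishes only at
`θ`, where it has a zero of multiplicity `n`. -/
def IsExtremal (α β γ : ℝ) (n : ℕ) (θ : ℝ) (G : ℝ → ℝ) : Prop :=
  G ∈ classL α β γ ∧ IsPosDef α β G ∧ shortestLength G n = ENNReal.ofReal θ ∧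
    (∀ t ∈ Set.Icc 0 θ, G t = 0 ↔ t = θ) ∧ analyticOrderAt G θ = n

end JacobiZeros

end

/-!
The quotients `ψ_l = φ_l / φ_0` satisfy `(w ψ')' + l² w ψ = 0` with `w = Δ φ_0²` and `ψ_l(0) = 1`,
so their Prüfer angle is continuous and increases strictly, and without bound, both in `l` and in
`t`. The zeros of `φ_l(t)` are the points where the angle is an odd multiple of `π / 2`, the zeros
of `ψ_l'(t)` those where it is a multiple of `π`; hence `t_m` and `t_m^*` are well defined.

The extremal functions are `φ_0` times a combination `f = ∑ c_i ψ_{μ_i}`. At `τ` all `ψ_{μ_i}`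
satisfy the same boundary condition, and the partial fraction coefficients make as many of the
iterates `D^k f`, `D f = -(w f')' / w`, as possible vanish there to second order; this fixes the
order of the zero of `f`. By Rolle's theorem applied twice, `D` never decreases the number of
zeros in `(0, τ)`, and increases it by one at each step where there is a double zero at `τ`.
Normalised, `D^k f` tends to the component with the largest `μ_i`, whose zeros the Prüfer angle
counts: there are too few of them for `f` to vanish anywhere in `(0, τ)`.

Positive definiteness reduces to the product formula `T^t φ_l(x) = φ_l(t) φ_l(x)`: integration by
parts in the parameters `(r, χ)` shows that the left side solves the Jacobi equation in `x`, and
both sides have the same value and slope at `x = 0`.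
-/

open Filter Topology MeasureTheory

namespace JacobiZeros

/-! ### The hypergeometric equation -/

section Hypergeometric

variable {a b c : ℂ}

theorem natCast_ne_neg_of_re_pos {z : ℂ} (hz : 0 < z.re) (n : ℕ) : (n : ℂ) ≠ -z := by
  intro h
  have hre : (n : ℝ) = -z.re := by simpa using congrArg Complex.re h
  linarith [n.cast_nonneg (α := ℝ)]

theorem hasFPowerSeriesOnBall_ofScalars {f : ℂ → ℂ} {u : ℕ → ℂ} {r : ℝ} (hr : 0 < r)
    (hf : ∀ z ∈ Metric.ball (0 : ℂ) r, HasSum (fun n => u n * z ^ n) (f z)) :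
    HasFPowerSeriesOnBall f (FormalMultilinearSeries.ofScalars ℂ u) 0 (ENNReal.ofReal r) where
  r_le := by
    refine ENNReal.le_of_forall_nnreal_lt fun s hs => ?_
    refine FormalMultilinearSeries.le_radius_of_tendsto _ (l := 0) ?_
    have hs_ball : ((s : ℝ) : ℂ) ∈ Metric.ball (0 : ℂ) r := by
      rw [mem_ball_zero_iff, Complex.norm_real, Real.norm_of_nonneg s.coe_nonneg]
      exact (ENNReal.lt_ofReal_iff_toReal_lt ENNReal.coe_ne_top).1 hs
    simpa using (hf _ hs_ball).summable.tendsto_atTop_zero.norm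
  r_pos := ENNReal.ofReal_pos.2 hr
  hasSum {z} hz := by
    rw [Metric.eball_ofReal] at hz
    simpa [mul_comm] using hf z hz

theorem hasSum_deriv_of_hasSum_pow {f : ℂ → ℂ} {u : ℕ → ℂ} {r : ℝ}
    (hf : ∀ z ∈ Metric.ball (0 : ℂ) r, HasSum (fun n => u n * z ^ n) (f z))
    {z : ℂ} (hz : z ∈ Metric.ball (0 : ℂ) r) :
    HasSum (fun n : ℕ => ((n + 1) * u (n + 1)) * z ^ n) (deriv f z) := by
  have hr : 0 < r := dist_nonneg.trans_lt hz
  have hsum := (hasFPowerSeriesOnBall_ofScalars hr hf).fderiv.hasSum (y := z)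
    (by rwa [Metric.eball_ofReal])
  rw [zero_add] at hsum
  refine (hsum.mapL (ContinuousLinearMap.apply ℂ ℂ (1 : ℂ))).congr_fun fun n => ?_
  simp [mul_comm]

theorem hasSum_pow_mul_of_hasSum_shift {v : ℕ → ℂ} {z s : ℂ} (hv : v 0 = 0)
    (h : HasSum (fun n => v (n + 1) * z ^ n) s) : HasSum (fun n => v n * z ^ n) (z * s) := by
  rw [← hasSum_nat_add_iff' 1, Finset.sum_range_one, hv, zero_mul, sub_zero]
  exact (h.mul_left z).congr_fun fun n => by ring

theorem one_le_radius_ordinaryHypergeometricSeries (a b c : ℂ) :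
    1 ≤ (ordinaryHypergeometricSeries ℂ a b c).radius := by
  by_cases habc : ∀ n : ℕ, (n : ℂ) ≠ -a ∧ (n : ℂ) ≠ -b ∧ (n : ℂ) ≠ -c
  · exact (ordinaryHypergeometricSeries_radius_eq_one ℂ a b c habc).ge
  simp only [← not_or, not_forall, not_not, eq_neg_iff_add_eq_zero] at habc
  obtain ⟨n, hn⟩ := habc
  simp only [add_comm (n : ℂ), ← eq_neg_iff_add_eq_zero] at hn
  rcases hn with rfl | rfl | rfl
  · exact (ordinaryHypergeometric_radius_top_of_neg_nat₁ ℂ b c).ge.trans' le_top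
  · exact (ordinaryHypergeometric_radius_top_of_neg_nat₂ ℂ a c).ge.trans' le_top
  · exact (ordinaryHypergeometric_radius_top_of_neg_nat₃ ℂ a b).ge.trans' le_top

theorem hasSum_ordinaryHypergeometric (a b c : ℂ) {z : ℂ} (hz : z ∈ Metric.ball (0 : ℂ) 1) :
    HasSum (fun n => ordinaryHypergeometricCoefficient a b c n * z ^ n) (₂F₁ a b c z) := by
  have hball := (ordinaryHypergeometricSeries ℂ a b c).hasFPowerSeriesOnBall
    (one_pos.trans_le (one_le_radius_ordinaryHypergeometricSeries a b c))
  have hmem : z ∈ Metric.eball (0 : ℂ) (ordinaryHypergeometricSeries ℂ a b c).radius := by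
    refine Metric.eball_subset_eball (one_le_radius_ordinaryHypergeometricSeries a b c) ?_
    rwa [← ENNReal.ofReal_one, Metric.eball_ofReal]
  have hsum := hball.hasSum hmem
  rw [zero_add] at hsum
  exact hsum.congr_fun fun n => (ordinaryHypergeometricSeries_apply_eq a b c z n).symm

theorem differentiableOn_ordinaryHypergeometric (a b c : ℂ) :
    DifferentiableOn ℂ (₂F₁ a b c : ℂ → ℂ) (Metric.ball 0 1) := by
  have hball := hasFPowerSeriesOnBall_ofScalars one_pos fun z hz =>
    hasSum_ordinaryHypergeometric a b c hz
  simpa only [Metric.eball_ofReal] using hball.differentiableOn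

theorem ordinaryHypergeometricCoefficient_succ (hc : ∀ n : ℕ, (n : ℂ) ≠ -c) (n : ℕ) :
    (n + 1) * (n + c) * ordinaryHypergeometricCoefficient a b c (n + 1) =
      (n + a) * (n + b) * ordinaryHypergeometricCoefficient a b c n := by
  have hcn : c + n ≠ 0 := fun h => hc n (eq_neg_of_add_eq_zero_right h)
  have hpoch : (ascPochhammer ℂ n).eval c ≠ 0 := by
    rw [Ne, ascPochhammer_eval_eq_zero_iff]
    rintro ⟨k, -, hk⟩
    exact hc k hk
  have hn : (n : ℂ) + 1 ≠ 0 := Nat.cast_add_one_ne_zero n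
  simp only [ordinaryHypergeometricCoefficient, ascPochhammer_succ_eval, Nat.factorial_succ,
    Nat.cast_mul, Nat.cast_succ]
  field_simp
  ring

theorem ordinaryHypergeometric_ode (hc : ∀ n : ℕ, (n : ℂ) ≠ -c) {z : ℂ}
    (hz : z ∈ Metric.ball (0 : ℂ) 1) :
    z * (1 - z) * deriv (deriv (₂F₁ a b c)) z + (c - (a + b + 1) * z) * deriv (₂F₁ a b c) z -
      a * b * ₂F₁ a b c z = 0 := by
  set u := ordinaryHypergeometricCoefficient a b c
  have hF : ∀ z ∈ Metric.ball (0 : ℂ) 1, HasSum (fun n => u n * z ^ n) (₂F₁ a b c z) :=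
    fun z hz => hasSum_ordinaryHypergeometric a b c hz
  have hF' : ∀ z ∈ Metric.ball (0 : ℂ) 1,
      HasSum (fun n : ℕ => ((n + 1) * u (n + 1)) * z ^ n) (deriv (₂F₁ a b c) z) :=
    fun z hz => hasSum_deriv_of_hasSum_pow hF hz
  have hF'' := hasSum_deriv_of_hasSum_pow hF' hz
  have hzF' : HasSum (fun n : ℕ => (n * u n) * z ^ n) (z * deriv (₂F₁ a b c) z) :=
    hasSum_pow_mul_of_hasSum_shift (by simp) (by simpa using hF' z hz)
  have hzF'' : HasSum (fun n : ℕ => (n * ((n + 1) * u (n + 1))) * z ^ n)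
      (z * deriv (deriv (₂F₁ a b c)) z) :=
    hasSum_pow_mul_of_hasSum_shift (by simp) (by simpa using hF'')
  have hzzF'' : HasSum (fun n : ℕ => (n * (n - 1) * u n) * z ^ n)
      (z * (z * deriv (deriv (₂F₁ a b c)) z)) :=
    hasSum_pow_mul_of_hasSum_shift (by simp) (hzF''.congr_fun fun n => by push_cast; ring)
  have hsum := (((hzF''.sub hzzF'').add ((hF' z hz).mul_left c)).sub
    (hzF'.mul_left (a + b + 1))).sub ((hF z hz).mul_left (a * b))
  have hterm := hsum.unique (hasSum_zero.congr_fun fun n => by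
    linear_combination z ^ n * ordinaryHypergeometricCoefficient_succ (a := a) (b := b) hc n)
  linear_combination hterm

theorem ordinaryHypergeometricCoefficient_ofReal (a b c : ℝ) (n : ℕ) :
    ordinaryHypergeometricCoefficient (a : ℂ) b c n =
      (ordinaryHypergeometricCoefficient a b c n : ℝ) := by
  have heval (x : ℝ) :
      (ascPochhammer ℂ n).eval (x : ℂ) = (((ascPochhammer ℝ n).eval x : ℝ) : ℂ) := by
    rw [← ascPochhammer_map (algebraMap ℝ ℂ), Polynomial.eval_map_algebraMap,
      ← Complex.coe_algebraMap, Polynomial.aeval_algebraMap_apply, Polynomial.coe_aeval_eq_eval]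
  simp only [ordinaryHypergeometricCoefficient, heval]
  push_cast
  rfl

theorem ordinaryHypergeometric_ofReal_re_pos {a b c x : ℝ} (ha : 0 < a) (hb : 0 < b) (hc : 0 < c)
    (hx0 : 0 ≤ x) (hx1 : x < 1) : 0 < (₂F₁ (a : ℂ) b c (x : ℂ)).re := by
  have hx : (x : ℂ) ∈ Metric.ball (0 : ℂ) 1 := by simpa [abs_of_nonneg hx0] using hx1
  have hsum := Complex.hasSum_re (hasSum_ordinaryHypergeometric (a : ℂ) b c hx)
  simp only [ordinaryHypergeometricCoefficient_ofReal, ← Complex.ofReal_pow,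
    ← Complex.ofReal_mul, Complex.ofReal_re] at hsum
  refine lt_of_lt_of_le ?_ (le_hasSum hsum 0 fun n _ => ?_)
  · simp
  · have ha_poch := ascPochhammer_pos n a ha
    have hb_poch := ascPochhammer_pos n b hb
    have hc_poch := ascPochhammer_pos n c hc
    positivity

end Hypergeometric

/-! ### The Jacobi function in the variable `y = cosh² t` -/

section Pfaff

variable {a b c ζ : ℂ}

/-- The Pfaff form `ζ ^ (-a) F(a, b; c; 1 - 1 / ζ)` of the hypergeometric function, holomorphic for
`Re ζ > 1/2`. In terms of it, `gaussF a b c z = pfaffF a (c - b) c (1 - z)`. -/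
noncomputable def pfaffF (a b c ζ : ℂ) : ℂ := ζ ^ (-a) * ₂F₁ a b c (1 - ζ⁻¹)

theorem ne_zero_of_half_lt_re (h : 1 / 2 < ζ.re) : ζ ≠ 0 := by
  rintro rfl
  norm_num at h

theorem one_sub_inv_mem_ball (h : 1 / 2 < ζ.re) : 1 - ζ⁻¹ ∈ Metric.ball (0 : ℂ) 1 := by
  have h0 := ne_zero_of_half_lt_re h
  have hquot : 1 - ζ⁻¹ = (ζ - 1) / ζ := by field_simp
  rw [mem_ball_zero_iff, hquot, norm_div, div_lt_one (norm_pos_iff.2 h0)]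
  refine lt_of_pow_lt_pow_left₀ 2 (norm_nonneg _) ?_
  rw [← Complex.normSq_eq_norm_sq, ← Complex.normSq_eq_norm_sq, Complex.normSq_apply,
    Complex.normSq_apply, Complex.sub_re, Complex.sub_im, Complex.one_re, Complex.one_im]
  linarith

theorem hasDerivAt_comp_one_sub_inv {f : ℂ → ℂ} (hf : DifferentiableOn ℂ f (Metric.ball 0 1))
    (h : 1 / 2 < ζ.re) :
    HasDerivAt (fun ζ => f (1 - ζ⁻¹)) (deriv f (1 - ζ⁻¹) * ζ⁻¹ ^ 2) ζ := by
  have hinner : HasDerivAt (fun ζ : ℂ => 1 - ζ⁻¹) (ζ⁻¹ ^ 2) ζ := by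
    simpa using (hasDerivAt_inv (ne_zero_of_half_lt_re h)).const_sub 1
  have houter := (hf.differentiableAt (Metric.isOpen_ball.mem_nhds (one_sub_inv_mem_ball h)))
  exact houter.hasDerivAt.comp ζ hinner

theorem hasDerivAt_cpow_neg (h : 1 / 2 < ζ.re) :
    HasDerivAt (fun ζ : ℂ => ζ ^ (-a)) (ζ ^ (-a) * (-a * ζ⁻¹)) ζ := by
  have h0 := ne_zero_of_half_lt_re h
  have hslit : ζ ∈ Complex.slitPlane := Or.inl (by linarith)
  refine ((hasDerivAt_id ζ).cpow_const hslit (c := -a)).congr_deriv ?_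
  rw [id, Complex.cpow_sub _ _ h0, Complex.cpow_one]
  field_simp

theorem hasDerivAt_pfaffF (h : 1 / 2 < ζ.re) :
    HasDerivAt (pfaffF a b c)
      (ζ ^ (-a) * (-a * ζ⁻¹ * ₂F₁ a b c (1 - ζ⁻¹) + ζ⁻¹ ^ 2 * deriv (₂F₁ a b c) (1 - ζ⁻¹))) ζ :=
  ((hasDerivAt_cpow_neg h).mul (hasDerivAt_comp_one_sub_inv
    (differentiableOn_ordinaryHypergeometric a b c) h)).congr_deriv (by ring)

theorem hasDerivAt_deriv_pfaffF (h : 1 / 2 < ζ.re) :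
    HasDerivAt (deriv (pfaffF a b c))
      (ζ ^ (-a) * (a * (a + 1) * ζ⁻¹ ^ 2 * ₂F₁ a b c (1 - ζ⁻¹)
      - (2 * a + 2) * ζ⁻¹ ^ 3 * deriv (₂F₁ a b c) (1 - ζ⁻¹)
      + ζ⁻¹ ^ 4 * deriv (deriv (₂F₁ a b c)) (1 - ζ⁻¹))) ζ := by
  have h0 := ne_zero_of_half_lt_re h
  have hopen : IsOpen {ζ : ℂ | 1 / 2 < ζ.re} := isOpen_lt continuous_const Complex.continuous_re
  have hderiv : deriv (pfaffF a b c) =ᶠ[𝓝 ζ] fun ζ => ζ ^ (-a) *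
      (-a * ζ⁻¹ * ₂F₁ a b c (1 - ζ⁻¹) + ζ⁻¹ ^ 2 * deriv (₂F₁ a b c) (1 - ζ⁻¹)) := by
    filter_upwards [hopen.mem_nhds h] with x hx
    exact (hasDerivAt_pfaffF hx).deriv
  have hF := differentiableOn_ordinaryHypergeometric a b c
  have hinv := hasDerivAt_inv h0
  refine HasDerivAt.congr_of_eventuallyEq (((hasDerivAt_cpow_neg h).mul
    (((hinv.const_mul (-a)).mul (hasDerivAt_comp_one_sub_inv hF h)).add
    ((hinv.pow 2).mul (hasDerivAt_comp_one_sub_inv (hF.deriv Metric.isOpen_ball) h)))).congr_deriv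
    ?_) hderiv
  simp only [Pi.mul_apply, Pi.add_apply, Pi.pow_apply, Nat.cast_ofNat, Nat.add_one_sub_one, pow_one]
  field_simp
  ring

theorem pfaffF_ode (hc : ∀ n : ℕ, (n : ℂ) ≠ -c) (h : 1 / 2 < ζ.re) :
    ζ * (ζ - 1) * deriv (deriv (pfaffF a b c)) ζ +
      ((a + (c - b) + 1) * ζ - (a - b + 1)) * deriv (pfaffF a b c) ζ +
      a * (c - b) * pfaffF a b c ζ = 0 := by
  have h0 := ne_zero_of_half_lt_re h
  have hode := ordinaryHypergeometric_ode (a := a) (b := b) hc (one_sub_inv_mem_ball h)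
  rw [(hasDerivAt_deriv_pfaffF h).deriv, (hasDerivAt_pfaffF h).deriv, pfaffF]
  generalize deriv (deriv (₂F₁ a b c)) (1 - ζ⁻¹) = F'' at *
  generalize deriv (₂F₁ a b c) (1 - ζ⁻¹) = F' at *
  generalize ₂F₁ a b c (1 - ζ⁻¹) = F at *
  generalize ζ ^ (-a) = p
  field_simp at hode ⊢
  linear_combination p * hode

theorem analyticAt_pfaffF (h : 1 / 2 < ζ.re) : AnalyticAt ℂ (pfaffF a b c) ζ := by
  have hopen : IsOpen {ζ : ℂ | 1 / 2 < ζ.re} := isOpen_lt continuous_const Complex.continuous_re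
  refine DifferentiableOn.analyticAt (s := {ζ : ℂ | 1 / 2 < ζ.re}) (fun x hx => ?_)
    (hopen.mem_nhds h)
  exact (hasDerivAt_pfaffF hx).differentiableAt.differentiableWithinAt

end Pfaff

/-- The upper parameter `(ρ + i l) / 2` of the hypergeometric function defining the Jacobi function.
The Pfaff form has as its second parameter the same expression with `α - β + 1` in place of `ρ`. -/
noncomputable def upperParam (ρ l : ℝ) : ℂ := (ρ + Complex.I * l) / 2

/-- The Jacobi function as a function of `y = cosh² t`, see `jacobiPhi_eq_radialPhi`. -/
noncomputable def radialPhi (α β l y : ℝ) : ℝ :=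
  (pfaffF (upperParam (α + β + 1) l) (upperParam (α - β + 1) l) (α + 1 : ℝ) y).re

theorem jacobiPhi_eq_radialPhi (α β l t : ℝ) :
    jacobiPhi α β l t = radialPhi α β l (Real.cosh t ^ 2) := by
  have hbase : (1 : ℝ) - -(Real.sinh t) ^ 2 = Real.cosh t ^ 2 := by rw [Real.cosh_sq]; ring
  have harg : -(Real.sinh t) ^ 2 / (-(Real.sinh t) ^ 2 - 1) = 1 - (Real.cosh t ^ 2)⁻¹ := by
    have hsinh : Real.sinh t ^ 2 = Real.cosh t ^ 2 - 1 := by rw [Real.cosh_sq]; ring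
    have hcosh : Real.cosh t ^ 2 ≠ 0 := by positivity
    rw [hsinh, neg_sub, sub_right_comm, sub_self, zero_sub, div_neg, ← neg_div, neg_sub,
      sub_div, div_self hcosh, one_div]
  have hparam : ((α + 1 : ℝ) : ℂ) - (((α + β + 1 : ℝ) : ℂ) - Complex.I * l) / 2 =
      upperParam (α - β + 1) l := by
    rw [upperParam]; push_cast; ring
  rw [jacobiPhi, radialPhi, gaussF, pfaffF, hbase, harg, hparam, upperParam, Complex.ofReal_sub,
    Complex.ofReal_one, Complex.ofReal_inv]
  rfl

section Parameters

variable {α β : ℝ}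

theorem analyticAt_radialPhi (α β l : ℝ) {y : ℝ} (hy : 1 / 2 < y) :
    AnalyticAt ℝ (radialPhi α β l) y :=
  (analyticAt_pfaffF (by simpa using hy)).re_ofReal

theorem deriv_radialPhi (α β l : ℝ) {y : ℝ} (hy : 1 / 2 < y) : deriv (radialPhi α β l) y =
    (deriv (pfaffF (upperParam (α + β + 1) l) (upperParam (α - β + 1) l) (α + 1 : ℝ)) y).re :=
  (hasDerivAt_pfaffF (by simpa using hy)).differentiableAt.hasDerivAt.real_of_complex.deriv

theorem deriv_deriv_radialPhi (α β l : ℝ) {y : ℝ} (hy : 1 / 2 < y) :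
    deriv (deriv (radialPhi α β l)) y = (deriv (deriv
      (pfaffF (upperParam (α + β + 1) l) (upperParam (α - β + 1) l) (α + 1 : ℝ))) y).re := by
  have hderiv : deriv (radialPhi α β l) =ᶠ[𝓝 y] fun y => (deriv
      (pfaffF (upperParam (α + β + 1) l) (upperParam (α - β + 1) l) (α + 1 : ℝ)) y).re := by
    filter_upwards [lt_mem_nhds hy] with x hx
    exact deriv_radialPhi α β l hx
  rw [hderiv.deriv_eq]
  exact (hasDerivAt_deriv_pfaffF
    (by simpa using hy)).differentiableAt.hasDerivAt.real_of_complex.deriv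

theorem radialPhi_ode (β : ℝ) (hα : -1 < α) (l : ℝ) {y : ℝ} (hy : 1 / 2 < y) :
    y * (y - 1) * deriv (deriv (radialPhi α β l)) y +
      ((α + β + 2) * y - (β + 1)) * deriv (radialPhi α β l) y +
      (l ^ 2 + (α + β + 1) ^ 2) / 4 * radialPhi α β l y = 0 := by
  set a := upperParam (α + β + 1) l with ha
  set b := upperParam (α - β + 1) l with hb
  set c : ℂ := ((α + 1 : ℝ) : ℂ) with hc
  have hc_ne : ∀ n : ℕ, (n : ℂ) ≠ -c :=
    natCast_ne_neg_of_re_pos (by rw [hc, Complex.ofReal_re]; linarith)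
  have hode := congrArg Complex.re (pfaffF_ode (a := a) (b := b) (ζ := y) hc_ne (by simpa using hy))
  have hcoeff₂ : (y : ℂ) * (y - 1) = ((y * (y - 1) : ℝ) : ℂ) := by push_cast; ring
  have hcoeff₁ : (a + (c - b) + 1) * (y : ℂ) - (a - b + 1) =
      (((α + β + 2) * y - (β + 1) : ℝ) : ℂ) := by
    simp only [ha, hb, hc, upperParam]; push_cast; ring
  have hcoeff₀ : a * (c - b) = (((l ^ 2 + (α + β + 1) ^ 2) / 4 : ℝ) : ℂ) := by
    simp only [ha, hb, hc, upperParam]; push_cast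
    linear_combination -(l : ℂ) ^ 2 / 4 * Complex.I_sq
  rw [hcoeff₂, hcoeff₁, hcoeff₀, Complex.add_re, Complex.add_re, Complex.re_ofReal_mul,
    Complex.re_ofReal_mul, Complex.re_ofReal_mul, Complex.zero_re] at hode
  rwa [deriv_deriv_radialPhi α β l hy, deriv_radialPhi α β l hy, radialPhi]

theorem radialPhi_one (α β l : ℝ) : radialPhi α β l 1 = 1 := by
  simp [radialPhi, pfaffF]

theorem radialPhi_zero_pos (hρ : 0 < α + β + 1) (hβα : β < α + 1) {y : ℝ} (hy : 1 ≤ y) :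
    0 < radialPhi α β 0 y := by
  have hy0 : 0 < y := one_pos.trans_le hy
  have hparam (ρ : ℝ) : upperParam ρ 0 = ((ρ / 2 : ℝ) : ℂ) := by simp [upperParam]
  have harg : (1 : ℂ) - (y : ℂ)⁻¹ = ((1 - y⁻¹ : ℝ) : ℂ) := by push_cast; rfl
  have hF : 0 < (₂F₁ (((α + β + 1) / 2 : ℝ) : ℂ) ((α - β + 1) / 2 : ℝ) (α + 1 : ℝ)
      ((1 - y⁻¹ : ℝ) : ℂ)).re :=
    ordinaryHypergeometric_ofReal_re_pos (by linarith) (by linarith) (by linarith)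
      (sub_nonneg.2 (inv_le_one_of_one_le₀ hy)) (sub_lt_self 1 (inv_pos.2 hy0))
  rw [radialPhi, pfaffF, hparam, hparam, harg, ← Complex.ofReal_neg,
    ← Complex.ofReal_cpow hy0.le, Complex.re_ofReal_mul]
  exact mul_pos (Real.rpow_pos_of_pos hy0 _) hF

end Parameters

/-! ### Energy estimates for second order equations -/

theorem antitoneOn_of_hasDerivAt_nonpos {f f' : ℝ → ℝ} {a b : ℝ}
    (hc : ContinuousOn f (Set.Icc a b)) (hd : ∀ t ∈ Set.Ioo a b, HasDerivAt f (f' t) t)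
    (hle : ∀ t ∈ Set.Ioo a b, f' t ≤ 0) : AntitoneOn f (Set.Icc a b) := by
  refine antitoneOn_of_deriv_nonpos (convex_Icc a b) hc ?_ ?_ <;> rw [interior_Icc]
  · exact fun t ht => (hd t ht).differentiableAt.differentiableWithinAt
  · intro t ht
    rw [(hd t ht).deriv]
    exact hle t ht

theorem hasDerivAt_energy_mul_exp {u u' : ℝ → ℝ} {κ c k u'' t : ℝ} (hu : HasDerivAt u (u' t) t)
    (hu' : HasDerivAt u' u'' t) :
    HasDerivAt (fun t => (u' t ^ 2 + κ * u t ^ 2 + c) * Real.exp (k * t))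
      ((2 * u' t * u'' + κ * (2 * u t * u' t) + k * (u' t ^ 2 + κ * u t ^ 2 + c)) *
        Real.exp (k * t)) t := by
  refine ((((hu'.pow 2).add ((hu.pow 2).const_mul κ)).add_const c).mul
    ((hasDerivAt_id t).const_mul k).exp).congr_deriv ?_
  simp only [Pi.add_apply, Pi.pow_apply, id, Nat.cast_ofNat, Nat.add_one_sub_one, pow_one, mul_one]
  ring

theorem energy_le_mul_exp {q f u u' : ℝ → ℝ} {κ δ T : ℝ} (hκ : 0 ≤ κ)
    (hq : ∀ t ∈ Set.Ioo 0 T, 0 ≤ q t) (hf : ∀ t ∈ Set.Ioo 0 T, f t ^ 2 ≤ δ ^ 2)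
    (hu : ContinuousOn u (Set.Icc 0 T)) (hu' : ContinuousOn u' (Set.Icc 0 T))
    (hd : ∀ t ∈ Set.Ioo 0 T, HasDerivAt u (u' t) t)
    (hd' : ∀ t ∈ Set.Ioo 0 T, HasDerivAt u' (-q t * u' t - κ * u t + f t) t)
    {t : ℝ} (ht : t ∈ Set.Icc 0 T) :
    u' t ^ 2 + κ * u t ^ 2 + δ ^ 2 ≤ (u' 0 ^ 2 + κ * u 0 ^ 2 + δ ^ 2) * Real.exp t := by
  have hanti : AntitoneOn (fun t => (u' t ^ 2 + κ * u t ^ 2 + δ ^ 2) * Real.exp (-1 * t))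
      (Set.Icc 0 T) := by
    refine antitoneOn_of_hasDerivAt_nonpos (by fun_prop)
      (fun s hs => hasDerivAt_energy_mul_exp (hd s hs) (hd' s hs)) fun s hs => ?_
    refine mul_nonpos_of_nonpos_of_nonneg ?_ (Real.exp_pos _).le
    nlinarith [hf s hs, sq_nonneg (u' s - f s), mul_nonneg (hq s hs) (sq_nonneg (u' s)),
      mul_nonneg hκ (sq_nonneg (u s))]
  have hle := hanti ⟨le_rfl, ht.1.trans ht.2⟩ ht ht.1
  simpa [Real.exp_neg, ← div_eq_mul_inv, div_le_iff₀ (Real.exp_pos t)] using hle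

theorem eq_zero_of_cauchy_data_eq_zero {q u u' : ℝ → ℝ} {κ a b C : ℝ} (hκ : 0 < κ) (hab : a ≤ b)
    (hC : 0 ≤ C) (hq : ∀ t ∈ Set.Ioo a b, q t ≤ C)
    (hu : ContinuousOn u (Set.Icc a b)) (hu' : ContinuousOn u' (Set.Icc a b))
    (hd : ∀ t ∈ Set.Ioo a b, HasDerivAt u (u' t) t)
    (hd' : ∀ t ∈ Set.Ioo a b, HasDerivAt u' (-q t * u' t - κ * u t) t)
    (hub : u b = 0) (hub' : u' b = 0) : u a = 0 := by
  have hanti : AntitoneOn (fun t => -((u' t ^ 2 + κ * u t ^ 2 + 0) * Real.exp (2 * C * t)))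
      (Set.Icc a b) := by
    refine antitoneOn_of_hasDerivAt_nonpos (by fun_prop)
      (fun s hs => (hasDerivAt_energy_mul_exp (hd s hs) (hd' s hs)).neg) fun s hs => ?_
    refine neg_nonpos.2 (mul_nonneg ?_ (Real.exp_pos _).le)
    nlinarith [mul_nonneg (sub_nonneg.2 (hq s hs)) (sq_nonneg (u' s)),
      mul_nonneg hC (mul_nonneg hκ.le (sq_nonneg (u s)))]
  have hle := hanti ⟨le_rfl, hab⟩ ⟨hab, le_rfl⟩ hab
  have henergy : u' a ^ 2 + κ * u a ^ 2 ≤ 0 := by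
    refine nonpos_of_mul_nonpos_left ?_ (Real.exp_pos (2 * C * a))
    simpa [hub, hub'] using hle
  have hsq : κ * u a ^ 2 = 0 := le_antisymm (by nlinarith [sq_nonneg (u' a)]) (by positivity)
  simpa [hκ.ne'] using hsq

/-! ### The differential equation of the Jacobi functions -/

/-- The first order coefficient `Δ' / Δ` of the Jacobi equation. -/
noncomputable def drift (α β t : ℝ) : ℝ :=
  (2 * α + 1) * (Real.cosh t / Real.sinh t) + (2 * β + 1) * (Real.sinh t / Real.cosh t)

theorem half_lt_cosh_sq (t : ℝ) : 1 / 2 < Real.cosh t ^ 2 := by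
  nlinarith [Real.one_le_cosh t]

theorem jacobiPhi_zero_right (α β l : ℝ) : jacobiPhi α β l 0 = 1 := by
  rw [jacobiPhi_eq_radialPhi]
  simpa using radialPhi_one α β l

theorem jacobiPhi_neg (α β l t : ℝ) : jacobiPhi α β l (-t) = jacobiPhi α β l t := by
  rw [jacobiPhi_eq_radialPhi, jacobiPhi_eq_radialPhi, Real.cosh_neg]

theorem jacobiPhi_abs (α β l t : ℝ) : jacobiPhi α β l |t| = jacobiPhi α β l t := by
  rcases abs_choice t with h | h <;> rw [h]
  exact jacobiPhi_neg α β l t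

theorem jacobiPhi_eq_comp (α β l : ℝ) :
    jacobiPhi α β l = radialPhi α β l ∘ fun t => Real.cosh t ^ 2 :=
  funext fun t => jacobiPhi_eq_radialPhi α β l t

theorem analyticAt_jacobiPhi (α β l t : ℝ) : AnalyticAt ℝ (jacobiPhi α β l) t := by
  have hcosh : AnalyticAt ℝ Real.cosh t := Real.contDiff_cosh.contDiffAt.analyticAt
  rw [jacobiPhi_eq_comp]
  exact (analyticAt_radialPhi α β l (half_lt_cosh_sq t)).comp_of_eq (hcosh.pow 2) rfl

theorem continuous_jacobiPhi (α β l : ℝ) : Continuous (jacobiPhi α β l) :=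
  continuous_iff_continuousAt.2 fun t => (analyticAt_jacobiPhi α β l t).continuousAt

theorem hasDerivAt_jacobiPhi (α β l t : ℝ) :
    HasDerivAt (jacobiPhi α β l) (deriv (jacobiPhi α β l) t) t :=
  (analyticAt_jacobiPhi α β l t).differentiableAt.hasDerivAt

theorem continuous_deriv_jacobiPhi (α β l : ℝ) : Continuous (deriv (jacobiPhi α β l)) :=
  continuous_iff_continuousAt.2 fun t => (analyticAt_jacobiPhi α β l t).deriv.continuousAt

theorem hasDerivAt_cosh_sq (t : ℝ) :
    HasDerivAt (fun t => Real.cosh t ^ 2) (2 * Real.cosh t * Real.sinh t) t := by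
  simpa using (Real.hasDerivAt_cosh t).fun_pow 2

theorem deriv_jacobiPhi (α β l t : ℝ) : deriv (jacobiPhi α β l) t =
    deriv (radialPhi α β l) (Real.cosh t ^ 2) * (2 * Real.cosh t * Real.sinh t) := by
  have hradial := (analyticAt_radialPhi α β l (half_lt_cosh_sq t)).differentiableAt.hasDerivAt
  rw [jacobiPhi_eq_comp]
  exact (hradial.comp t (hasDerivAt_cosh_sq t)).deriv

theorem deriv_jacobiPhi_zero_right (α β l : ℝ) : deriv (jacobiPhi α β l) 0 = 0 := by
  simp [deriv_jacobiPhi]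

theorem deriv_jacobiPhi_neg (α β l t : ℝ) :
    deriv (jacobiPhi α β l) (-t) = -deriv (jacobiPhi α β l) t := by
  rw [deriv_jacobiPhi, deriv_jacobiPhi, Real.cosh_neg, Real.sinh_neg]
  ring

section Parameters

variable {α β : ℝ}

theorem jacobiPhi_zero_pos (hρ : 0 < α + β + 1) (hβα : β < α + 1) (t : ℝ) :
    0 < jacobiPhi α β 0 t := by
  rw [jacobiPhi_eq_radialPhi]
  exact radialPhi_zero_pos hρ hβα (one_le_pow₀ (Real.one_le_cosh t))

theorem drift_nonneg (hβ : -1 / 2 ≤ β) (hα : -1 / 2 ≤ α) {t : ℝ} (ht : 0 < t) :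
    0 ≤ drift α β t := by
  have hsinh := Real.sinh_pos_iff.2 ht
  have hcosh := Real.cosh_pos t
  exact add_nonneg (mul_nonneg (by linarith) (div_pos hcosh hsinh).le)
    (mul_nonneg (by linarith) (div_pos hsinh hcosh).le)

theorem hasDerivAt_drift (α β : ℝ) {t : ℝ} (ht : 0 < t) :
    HasDerivAt (drift α β)
      (-(2 * α + 1) / Real.sinh t ^ 2 + (2 * β + 1) / Real.cosh t ^ 2) t := by
  have hsinh := (Real.sinh_pos_iff.2 ht).ne'
  have hcosh := (Real.cosh_pos t).ne'
  refine ((((Real.hasDerivAt_cosh t).div (Real.hasDerivAt_sinh t) hsinh).const_mul _).add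
    (((Real.hasDerivAt_sinh t).div (Real.hasDerivAt_cosh t) hcosh).const_mul _)).congr_deriv ?_
  have hsq := Real.cosh_sq' t
  field_simp
  linear_combination ((2 * β + 1) * Real.sinh t ^ 2 - (2 * α + 1) * Real.cosh t ^ 2) * hsq

theorem jacobiPhi_ode (β : ℝ) (hα : -1 < α) (l : ℝ) {t : ℝ} (ht : 0 < t) :
    HasDerivAt (deriv (jacobiPhi α β l)) (-drift α β t * deriv (jacobiPhi α β l) t -
      (l ^ 2 + (α + β + 1) ^ 2) * jacobiPhi α β l t) t := by
  have hsinh := (Real.sinh_pos_iff.2 ht).ne'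
  have hcosh := (Real.cosh_pos t).ne'
  have hradial :=
    (analyticAt_radialPhi α β l (half_lt_cosh_sq t)).deriv.differentiableAt.hasDerivAt
  rw [funext (deriv_jacobiPhi α β l)]
  refine ((hradial.comp t (hasDerivAt_cosh_sq t)).mul
    (((Real.hasDerivAt_cosh t).const_mul 2).mul (Real.hasDerivAt_sinh t))).congr_deriv ?_
  have hode := radialPhi_ode β hα l (half_lt_cosh_sq t)
  have hsq : Real.sinh t ^ 2 = Real.cosh t ^ 2 - 1 := by rw [Real.cosh_sq]; ring
  simp only [Function.comp, Pi.mul_apply, jacobiPhi_eq_radialPhi, drift]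
  generalize deriv (deriv (radialPhi α β l)) (Real.cosh t ^ 2) = f'' at *
  generalize deriv (radialPhi α β l) (Real.cosh t ^ 2) = f' at *
  generalize radialPhi α β l (Real.cosh t ^ 2) = f at *
  field_simp
  linear_combination 4 * hode + (4 * f'' * Real.cosh t ^ 2 + (4 * β + 4) * f') * hsq

theorem jacobiEigenvalue_pos (hρ : 0 < α + β + 1) (l : ℝ) : 0 < l ^ 2 + (α + β + 1) ^ 2 := by
  positivity

end Parameters

/-! ### Joint continuity in the spectral parameter -/

theorem continuous_uncurry_of_abs_sub_le {F : ℝ → ℝ → ℝ} {g : ℝ → ℝ} (hg : Continuous g)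
    (hc : ∀ l, Continuous (F l)) (hF : ∀ l μ t, |F l t - F μ t| ≤ |l ^ 2 - μ ^ 2| * g t) :
    Continuous (Function.uncurry F) := by
  rw [continuous_iff_continuousAt]
  rintro ⟨μ, s⟩
  rw [ContinuousAt, tendsto_iff_dist_tendsto_zero]
  have hbound : Tendsto (fun p : ℝ × ℝ => |p.1 ^ 2 - μ ^ 2| * g p.2 + |F μ p.2 - F μ s|)
      (𝓝 (μ, s)) (𝓝 0) := by
    have hcont : Continuous fun p : ℝ × ℝ =>
        |p.1 ^ 2 - μ ^ 2| * g p.2 + |F μ p.2 - F μ s| := by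
      have := hc μ
      fun_prop
    simpa using hcont.tendsto (μ, s)
  refine squeeze_zero (fun _ => dist_nonneg) (fun p => ?_) hbound
  exact (abs_sub_le (F p.1 p.2) (F μ p.2) (F μ s)).trans (add_le_add (hF _ _ _) le_rfl)

section Parameters

variable {α β : ℝ}

theorem sq_jacobiPhi_le_exp (hβ : -1 / 2 ≤ β) (hα : -1 / 2 < α) (l : ℝ) {t : ℝ} (ht : 0 ≤ t) :
    jacobiPhi α β l t ^ 2 ≤ Real.exp t := by
  have hκ := jacobiEigenvalue_pos (α := α) (β := β) (by linarith) l
  have henergy := energy_le_mul_exp (q := drift α β) (f := 0) (u := jacobiPhi α β l)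
    (u' := deriv (jacobiPhi α β l)) (δ := 0) (T := t) hκ.le
    (fun s hs => drift_nonneg hβ hα.le hs.1) (by simp)
    (continuous_jacobiPhi α β l).continuousOn (continuous_deriv_jacobiPhi α β l).continuousOn
    (fun s _ => hasDerivAt_jacobiPhi α β l s)
    (fun s hs => by simpa using jacobiPhi_ode β (by linarith) l hs.1) ⟨ht, le_rfl⟩
  rw [deriv_jacobiPhi_zero_right, jacobiPhi_zero_right] at henergy
  refine le_of_mul_le_mul_left ?_ hκ
  nlinarith [sq_nonneg (deriv (jacobiPhi α β l) t)]

theorem energy_sub_jacobiPhi_le (hβ : -1 / 2 ≤ β) (hα : -1 / 2 < α) (l μ : ℝ) {t : ℝ}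
    (ht : 0 ≤ t) :
    (deriv (jacobiPhi α β l) t - deriv (jacobiPhi α β μ) t) ^ 2 +
      (l ^ 2 + (α + β + 1) ^ 2) * (jacobiPhi α β l t - jacobiPhi α β μ t) ^ 2 ≤
      (|l ^ 2 - μ ^ 2| * Real.exp t) ^ 2 := by
  have hα' : -1 < α := by linarith
  have hκ : 0 ≤ l ^ 2 + (α + β + 1) ^ 2 := by positivity
  have hsource : ∀ s ∈ Set.Ioo 0 t, (-(l ^ 2 - μ ^ 2) * jacobiPhi α β μ s) ^ 2 ≤
      (|l ^ 2 - μ ^ 2| * Real.exp (t / 2)) ^ 2 := by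
    intro s hs
    rw [mul_pow, mul_pow, sq_abs, neg_sq, ← Real.exp_nat_mul]
    refine mul_le_mul_of_nonneg_left ?_ (sq_nonneg _)
    refine (sq_jacobiPhi_le_exp hβ hα μ hs.1.le).trans (Real.exp_le_exp.2 ?_)
    push_cast
    linarith [hs.2]
  have henergy := energy_le_mul_exp (u := fun s => jacobiPhi α β l s - jacobiPhi α β μ s)
    (u' := fun s => deriv (jacobiPhi α β l) s - deriv (jacobiPhi α β μ) s) hκ
    (fun s hs => drift_nonneg hβ hα.le hs.1) hsource
    ((continuous_jacobiPhi α β l).sub (continuous_jacobiPhi α β μ)).continuousOn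
    ((continuous_deriv_jacobiPhi α β l).sub (continuous_deriv_jacobiPhi α β μ)).continuousOn
    (fun s _ => (hasDerivAt_jacobiPhi α β l s).sub (hasDerivAt_jacobiPhi α β μ s))
    (fun s hs => ((jacobiPhi_ode β hα' l hs.1).sub (jacobiPhi_ode β hα' μ hs.1)).congr_deriv
      (by ring)) ⟨ht, le_rfl⟩
  simp only [deriv_jacobiPhi_zero_right, jacobiPhi_zero_right, sub_self] at henergy
  have hexp : (|l ^ 2 - μ ^ 2| * Real.exp (t / 2)) ^ 2 * Real.exp t =
      (|l ^ 2 - μ ^ 2| * Real.exp t) ^ 2 := by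
    rw [mul_pow, mul_pow, ← Real.exp_nat_mul, ← Real.exp_nat_mul, mul_assoc, ← Real.exp_add]
    congr 2
    push_cast
    ring
  nlinarith [sq_nonneg (|l ^ 2 - μ ^ 2| * Real.exp (t / 2))]

theorem continuous_uncurry_jacobiPhi (hβ : -1 / 2 ≤ β) (hα : -1 / 2 < α) :
    Continuous (Function.uncurry (jacobiPhi α β)) := by
  have hρ : 0 < α + β + 1 := by linarith
  refine continuous_uncurry_of_abs_sub_le (g := fun t => Real.exp |t| * (α + β + 1)⁻¹)
    (by fun_prop) (continuous_jacobiPhi α β) fun l μ t => ?_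
  rw [← jacobiPhi_abs α β l, ← jacobiPhi_abs α β μ, ← mul_assoc, ← div_eq_mul_inv, le_div_iff₀ hρ]
  have henergy := energy_sub_jacobiPhi_le hβ hα l μ (abs_nonneg t)
  refine (abs_le_of_sq_le_sq' ?_ (by positivity)).2
  rw [mul_pow, sq_abs]
  nlinarith [sq_nonneg (deriv (jacobiPhi α β l) |t| - deriv (jacobiPhi α β μ) |t|),
    mul_nonneg (sq_nonneg l) (sq_nonneg (jacobiPhi α β l |t| - jacobiPhi α β μ |t|))]

theorem continuous_uncurry_deriv_jacobiPhi (hβ : -1 / 2 ≤ β) (hα : -1 / 2 < α) :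
    Continuous (Function.uncurry fun l => deriv (jacobiPhi α β l)) := by
  refine continuous_uncurry_of_abs_sub_le (g := fun t => Real.exp |t|) (by fun_prop)
    (continuous_deriv_jacobiPhi α β) fun l μ t => ?_
  have habs : |deriv (jacobiPhi α β l) t - deriv (jacobiPhi α β μ) t| =
      |deriv (jacobiPhi α β l) (|t|) - deriv (jacobiPhi α β μ) (|t|)| := by
    rcases abs_choice t with h | h <;> rw [h]
    rw [deriv_jacobiPhi_neg, deriv_jacobiPhi_neg, ← neg_sub', abs_neg]
  rw [habs]
  have henergy := energy_sub_jacobiPhi_le hβ hα l μ (abs_nonneg t)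
  refine (abs_le_of_sq_le_sq' ?_ (by positivity)).2
  rw [sq_abs]
  refine (le_add_of_nonneg_right ?_).trans henergy
  positivity

theorem jacobiPhi_ne_zero_or_deriv_ne_zero (hβ : -1 / 2 ≤ β) (hα : -1 / 2 < α) (l : ℝ) {t : ℝ}
    (ht : 0 < t) : jacobiPhi α β l t ≠ 0 ∨ deriv (jacobiPhi α β l) t ≠ 0 := by
  by_contra! ⟨hzero, hzero'⟩
  have hleft : ∀ s ∈ Set.Ioo 0 t, jacobiPhi α β l s = 0 := by
    intro s hs
    have hdrift : ContinuousOn (drift α β) (Set.Icc s t) := fun x hx =>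
      (hasDerivAt_drift α β (hs.1.trans_le hx.1)).continuousAt.continuousWithinAt
    obtain ⟨C, hC⟩ := isCompact_Icc.bddAbove_image hdrift
    have hdrift_le : ∀ x ∈ Set.Icc s t, drift α β x ≤ C := fun x hx => hC ⟨x, hx, rfl⟩
    exact eq_zero_of_cauchy_data_eq_zero (jacobiEigenvalue_pos (by linarith) l) hs.2.le
      ((drift_nonneg hβ hα.le hs.1).trans (hdrift_le s ⟨le_rfl, hs.2.le⟩))
      (fun x hx => hdrift_le x ⟨hx.1.le, hx.2.le⟩)
      (continuous_jacobiPhi α β l).continuousOn (continuous_deriv_jacobiPhi α β l).continuousOn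
      (fun x _ => hasDerivAt_jacobiPhi α β l x)
      (fun x hx => jacobiPhi_ode β (by linarith) l (hs.1.trans hx.1)) hzero hzero'
  have hlim : Tendsto (jacobiPhi α β l) (𝓝[>] 0) (𝓝 1) := by
    rw [← jacobiPhi_zero_right α β l]
    exact (continuous_jacobiPhi α β l).continuousAt.tendsto.mono_left nhdsWithin_le_nhds
  have hlim' : Tendsto (jacobiPhi α β l) (𝓝[>] 0) (𝓝 0) := by
    refine tendsto_const_nhds.congr' ?_
    filter_upwards [Ioo_mem_nhdsGT ht] with s hs using (hleft s hs).symm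
  exact one_ne_zero (tendsto_nhds_unique hlim hlim')

end Parameters

/-! ### Oscillation -/

theorem not_forall_hasDerivAt_riccati {s X : ℝ → ℝ} {a R : ℝ} (ha : 0 < a)
    (hX : ∀ t ≥ R, a ^ 2 ≤ X t) : ¬∀ t ≥ R, HasDerivAt s (-(s t ^ 2 + X t)) t := by
  intro hs
  set b := R + Real.pi / a with hb
  have hRb : R ≤ b := le_add_of_nonneg_right (by positivity)
  have hderiv : ∀ t ≥ R, HasDerivAt (fun t => Real.arctan (s t / a) + a * t)
      (a * (a ^ 2 - X t) / (a ^ 2 + s t ^ 2)) t := by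
    intro t ht
    refine ((((hs t ht).div_const a).arctan).add ((hasDerivAt_id t).const_mul a)).congr_deriv ?_
    field_simp
    ring
  have hanti := antitoneOn_of_hasDerivAt_nonpos (a := R) (b := b)
    (fun t ht => (hderiv t ht.1).continuousAt.continuousWithinAt) (fun t ht => hderiv t ht.1.le)
    fun t ht => div_nonpos_of_nonpos_of_nonneg
      (mul_nonpos_of_nonneg_of_nonpos ha.le (sub_nonpos.2 (hX t ht.1.le))) (by positivity)
  have hle := hanti ⟨le_rfl, hRb⟩ ⟨hRb, le_rfl⟩ hRb
  have hincr : a * b = a * R + Real.pi := by rw [hb]; field_simp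
  simp only [hincr] at hle
  linarith [Real.neg_pi_div_two_lt_arctan (s b / a), Real.arctan_lt_pi_div_two (s R / a)]

/-- If `u` had no zeros, `u' / u + q / 2` would solve a Riccati equation with potential
`κ - q ^ 2 / 4 - q' / 2`, whose limit is positive. -/
theorem exists_gt_eq_zero_of_tendsto {u u' q q' : ℝ → ℝ} {κ Q : ℝ} (hκ : (Q / 2) ^ 2 < κ)
    (hu : ∀ t > 0, HasDerivAt u (u' t) t)
    (hu' : ∀ t > 0, HasDerivAt u' (-q t * u' t - κ * u t) t) (hq : ∀ t > 0, HasDerivAt q (q' t) t)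
    (hqlim : Tendsto q atTop (𝓝 Q)) (hq'lim : Tendsto q' atTop (𝓝 0)) (T : ℝ) :
    ∃ t > T, u t = 0 := by
  by_contra! hne
  obtain ⟨a, ha, haκ⟩ : ∃ a > 0, a ^ 2 < κ - (Q / 2) ^ 2 := by
    have hpos : 0 < κ - (Q / 2) ^ 2 := sub_pos.2 hκ
    refine ⟨√((κ - (Q / 2) ^ 2) / 2), Real.sqrt_pos.2 (by positivity), ?_⟩
    rw [Real.sq_sqrt (by positivity)]
    exact half_lt_self hpos
  have hlim : Tendsto (fun t => κ - (q t / 2) ^ 2 - q' t / 2) atTop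
      (𝓝 (κ - (Q / 2) ^ 2 - 0 / 2)) :=
    (((hqlim.div_const 2).pow 2).const_sub κ).sub (hq'lim.div_const 2)
  rw [zero_div, sub_zero] at hlim
  obtain ⟨R, hR⟩ := eventually_atTop.1 ((hlim.eventually_const_le haκ).and
    ((eventually_gt_atTop T).and (eventually_gt_atTop 0)))
  refine not_forall_hasDerivAt_riccati (s := fun t => u' t / u t + q t / 2) ha
    (fun t ht => (hR t ht).1) fun t ht => ?_
  obtain ⟨-, hTt, ht0⟩ := hR t ht
  have hut := hne t hTt
  refine (((hu' t ht0).div (hu t ht0) hut).add ((hq t ht0).div_const 2)).congr_deriv ?_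
  field_simp
  ring

theorem tendsto_cosh_div_sinh : Tendsto (fun t => Real.cosh t / Real.sinh t) atTop (𝓝 1) := by
  have hexp : Tendsto (fun t : ℝ => Real.exp (-2 * t)) atTop (𝓝 0) :=
    Real.tendsto_exp_atBot.comp (tendsto_id.const_mul_atTop_of_neg (by norm_num))
  have hquot : Tendsto (fun t : ℝ => (1 + Real.exp (-2 * t)) / (1 - Real.exp (-2 * t))) atTop
      (𝓝 ((1 + 0) / (1 - 0))) := (hexp.const_add 1).div (hexp.const_sub 1) (by norm_num)
  simp only [add_zero, sub_zero, div_one] at hquot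
  refine hquot.congr' ?_
  filter_upwards [eventually_gt_atTop 0] with t ht
  have hratio : Real.exp (-2 * t) = Real.exp (-t) / Real.exp t := by
    rw [← Real.exp_sub]; congr 1; ring
  have hlt : Real.exp (-t) < Real.exp t := Real.exp_lt_exp.2 (by linarith)
  have hden : Real.exp t - Real.exp (-t) ≠ 0 := by linarith
  rw [Real.cosh_eq, Real.sinh_eq, hratio]
  field_simp

theorem tendsto_drift (α β : ℝ) : Tendsto (drift α β) atTop (𝓝 (2 * (α + β + 1))) := by
  have htanh : Tendsto (fun t => Real.sinh t / Real.cosh t) atTop (𝓝 1) := by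
    simpa using tendsto_cosh_div_sinh.inv₀ one_ne_zero
  have hlimit : 2 * (α + β + 1) = (2 * α + 1) * 1 + (2 * β + 1) * 1 := by ring
  rw [hlimit]
  exact (tendsto_cosh_div_sinh.const_mul (2 * α + 1)).add (htanh.const_mul (2 * β + 1))

theorem tendsto_deriv_drift (α β : ℝ) :
    Tendsto (fun t => -(2 * α + 1) / Real.sinh t ^ 2 + (2 * β + 1) / Real.cosh t ^ 2) atTop
      (𝓝 0) := by
  have hsinh : Tendsto (fun t => Real.sinh t ^ 2) atTop atTop :=
    (tendsto_pow_atTop two_ne_zero).comp <| tendsto_atTop_mono'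
      _ ((eventually_ge_atTop 0).mono fun _ ht => Real.self_le_sinh_iff.2 ht) tendsto_id
  have hcosh : Tendsto (fun t => Real.cosh t ^ 2) atTop atTop :=
    tendsto_atTop_mono (fun t => by rw [Real.cosh_sq]; linarith) hsinh
  simpa using (hsinh.const_div_atTop (-(2 * α + 1))).add (hcosh.const_div_atTop (2 * β + 1))

theorem exists_jacobiPhi_eq_zero_gt {α : ℝ} (β : ℝ) (hα : -1 < α) {l : ℝ} (hl : 0 < l) (T : ℝ) :
    ∃ t > T, jacobiPhi α β l t = 0 :=
  exists_gt_eq_zero_of_tendsto (κ := l ^ 2 + (α + β + 1) ^ 2) (by nlinarith)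
    (fun t _ => hasDerivAt_jacobiPhi α β l t) (fun _ ht => jacobiPhi_ode β hα l ht)
    (fun _ ht => hasDerivAt_drift α β ht) (tendsto_drift α β) (tendsto_deriv_drift α β) T

/-! ### Sturm–Liouville families and the Prüfer angle -/

/-- A family `ψ l` of regular solutions of `(w ψ')' + l² w ψ = 0`, `ψ l 0 = 1`, on the half-line,
with a weight `w` that vanishes at the origin. -/
structure SturmFamily (w : ℝ → ℝ) (ψ : ℝ → ℝ → ℝ) : Prop where
  continuous_weight : Continuous w
  weight_zero : w 0 = 0
  weight_pos : ∀ t, 0 < t → 0 < w t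
  analyticAt_weight : ∀ t, 0 < t → AnalyticAt ℝ w t
  analyticAt : ∀ l t, AnalyticAt ℝ (ψ l) t
  continuous_uncurry : Continuous (Function.uncurry ψ)
  continuous_uncurry_deriv : Continuous (Function.uncurry fun l => deriv (ψ l))
  ode : ∀ l t, 0 < t → HasDerivAt (fun s => w s * deriv (ψ l) s) (-(l ^ 2) * w t * ψ l t) t
  zero_right : ∀ l, ψ l 0 = 1
  zero_left : ∀ t, ψ 0 t = 1
  ne_zero_or : ∀ l t, 0 < t → ψ l t ≠ 0 ∨ deriv (ψ l) t ≠ 0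
  exists_zero_gt : ∀ l, 0 < l → ∀ T, ∃ t > T, ψ l t = 0

/-- The derivative in `s > 0` of the Prüfer angle; the absolute values make it continuous on the
whole line. -/
noncomputable def pruferRate (w : ℝ → ℝ) (ψ : ℝ → ℝ → ℝ) (l s : ℝ) : ℝ :=
  w |s| * (l ^ 2 * ψ l |s| ^ 2 + deriv (ψ l) |s| ^ 2) /
    (ψ l |s| ^ 2 + (w |s| * deriv (ψ l) |s|) ^ 2)

/-- The Prüfer angle `ϑ` of `ψ l` at `t`, characterized by `(ψ, -w ψ') = R (cos ϑ, sin ϑ)` with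
`R > 0` and by vanishing at `t = 0`, see `SturmFamily.exists_polar`. -/
noncomputable def prufer (w : ℝ → ℝ) (ψ : ℝ → ℝ → ℝ) (l t : ℝ) : ℝ :=
  ∫ s in (0 : ℝ)..t, pruferRate w ψ l s

theorem eq_of_hasDerivAt_eq_zero {f : ℝ → ℝ} {a b : ℝ} (hab : a ≤ b)
    (hc : ContinuousOn f (Set.Icc a b)) (hd : ∀ s ∈ Set.Ioo a b, HasDerivAt f 0 s) :
    f b = f a := by
  rcases hab.eq_or_lt with rfl | hlt
  · rfl
  obtain ⟨s, -, hs⟩ := exists_hasDerivAt_eq_slope f (fun _ => 0) hlt hc hd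
  exact sub_eq_zero.1 ((div_eq_zero_iff.1 hs.symm).resolve_right (sub_pos.2 hlt).ne')

theorem strictMonoOn_Ici_of_eventually_lt {f : ℝ → ℝ} {a : ℝ} (hc : ContinuousOn f (Set.Ici a))
    (h : ∀ x ≥ a, ∀ᶠ y in 𝓝[>] x, f x < f y) : StrictMonoOn f (Set.Ici a) := by
  intro x hx y _ hxy
  have hgrow : ∀ s ∈ Set.Ico x y, ∃ u ∈ Set.Icc x y, f s < f u := by
    intro s hs
    obtain ⟨u, hu, hlt⟩ := ((h s (le_trans hx hs.1)).and (Ioo_mem_nhdsGT hs.2)).exists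
    exact ⟨u, ⟨hs.1.trans hlt.1.le, hlt.2.le⟩, hu⟩
  obtain ⟨z, hz, hmax⟩ := isCompact_Icc.exists_isMaxOn (Set.nonempty_Icc.2 hxy.le)
    (hc.mono (fun s hs => le_trans hx hs.1 : Set.Icc x y ⊆ Set.Ici a))
  obtain rfl : z = y := by
    by_contra hne
    obtain ⟨u, hu, hlt⟩ := hgrow z ⟨hz.1, lt_of_le_of_ne hz.2 hne⟩
    exact absurd (hmax hu) (not_le.2 hlt)
  obtain ⟨u, hu, hlt⟩ := hgrow x ⟨le_rfl, hxy⟩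
  exact hlt.trans_le (hmax hu)

namespace SturmFamily

variable {w : ℝ → ℝ} {ψ : ℝ → ℝ → ℝ} (S : SturmFamily w ψ)
include S

theorem weight_nonneg {t : ℝ} (ht : 0 ≤ t) : 0 ≤ w t := by
  rcases ht.eq_or_lt with rfl | h
  · exact S.weight_zero.ge
  · exact (S.weight_pos t h).le

theorem hasDerivAt (l t : ℝ) : HasDerivAt (ψ l) (deriv (ψ l) t) t :=
  (S.analyticAt l t).differentiableAt.hasDerivAt

theorem continuous (l : ℝ) : Continuous (ψ l) :=
  S.continuous_uncurry.comp (by fun_prop : Continuous fun t : ℝ => (l, t))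

theorem continuous_deriv (l : ℝ) : Continuous (deriv (ψ l)) :=
  S.continuous_uncurry_deriv.comp (by fun_prop : Continuous fun t : ℝ => (l, t))

theorem modulus_pos (l : ℝ) {t : ℝ} (ht : 0 ≤ t) :
    0 < ψ l t ^ 2 + (w t * deriv (ψ l) t) ^ 2 := by
  rcases ht.eq_or_lt with rfl | h
  · rw [S.zero_right]; positivity
  · have hw := S.weight_pos t h
    rcases S.ne_zero_or l t h with hψ | hψ' <;> positivity

theorem continuous_uncurry_pruferRate : Continuous (Function.uncurry (pruferRate w ψ)) := by
  have habs : Continuous fun p : ℝ × ℝ => (p.1, |p.2|) := by fun_prop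
  have hψ : Continuous fun p : ℝ × ℝ => ψ p.1 |p.2| := S.continuous_uncurry.comp habs
  have hψ' : Continuous fun p : ℝ × ℝ => deriv (ψ p.1) |p.2| :=
    S.continuous_uncurry_deriv.comp habs
  have hw : Continuous fun p : ℝ × ℝ => w |p.2| := S.continuous_weight.comp (by fun_prop)
  exact (hw.mul (((continuous_fst.pow 2).mul (hψ.pow 2)).add (hψ'.pow 2))).div
    ((hψ.pow 2).add ((hw.mul hψ').pow 2)) fun p => (S.modulus_pos p.1 (abs_nonneg p.2)).ne'

theorem continuous_pruferRate (l : ℝ) : Continuous (pruferRate w ψ l) :=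
  S.continuous_uncurry_pruferRate.comp (by fun_prop : Continuous fun t : ℝ => (l, t))

theorem continuous_prufer_right (l : ℝ) : Continuous (prufer w ψ l) :=
  intervalIntegral.continuous_primitive (S.continuous_pruferRate l).intervalIntegrable 0

theorem continuous_prufer_left (t : ℝ) : Continuous fun l => prufer w ψ l t :=
  intervalIntegral.continuous_parametric_intervalIntegral_of_continuous'
    S.continuous_uncurry_pruferRate 0 t

theorem hasDerivAt_prufer (l t : ℝ) : HasDerivAt (prufer w ψ l) (pruferRate w ψ l t) t :=
  (S.continuous_pruferRate l).integral_hasStrictDerivAt 0 t |>.hasDerivAt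

omit S in
theorem prufer_zero_right (l : ℝ) : prufer w ψ l 0 = 0 := intervalIntegral.integral_same

theorem prufer_zero_left (t : ℝ) : prufer w ψ 0 t = 0 := by
  have h : ψ 0 = fun _ => 1 := funext S.zero_left
  simp [prufer, pruferRate, h]

theorem strictMonoOn_prufer_right {l : ℝ} (hl : 0 < l) :
    StrictMonoOn (prufer w ψ l) (Set.Ici 0) := by
  refine strictMonoOn_of_deriv_pos (convex_Ici 0) (S.continuous_prufer_right l).continuousOn ?_
  intro t ht
  rw [interior_Ici] at ht
  have ht' : 0 < t := ht
  rw [(S.hasDerivAt_prufer l t).deriv, pruferRate, abs_of_pos ht']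
  refine div_pos (mul_pos (S.weight_pos t ht') ?_) (S.modulus_pos l ht'.le)
  rcases S.ne_zero_or l t ht' with h | h <;> positivity

theorem hasDerivAt_sin_defect (l : ℝ) {s : ℝ} (hs : 0 < s) :
    HasDerivAt (fun s => (ψ l s * Real.sin (prufer w ψ l s) +
      w s * deriv (ψ l) s * Real.cos (prufer w ψ l s)) ^ 2 /
      (ψ l s ^ 2 + (w s * deriv (ψ l) s) ^ 2)) 0 s := by
  have hψ := S.hasDerivAt l s
  have hflux := S.ode l s hs
  have hϑ := S.hasDerivAt_prufer l s
  have hmod := (S.modulus_pos l hs.le).ne'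
  have hw := (S.weight_pos s hs).ne'
  refine ((((hψ.mul hϑ.sin).add (hflux.mul hϑ.cos)).pow 2).div ((hψ.pow 2).add (hflux.pow 2))
    hmod).congr_deriv ?_
  simp only [Pi.add_apply, Pi.mul_apply, Pi.pow_apply, pruferRate, abs_of_pos hs]
  obtain ⟨V, hV⟩ : ∃ V, w s * deriv (ψ l) s = V := ⟨_, rfl⟩
  rw [hV] at hmod ⊢
  rw [eq_div_of_mul_eq hw ((mul_comm _ _).trans hV)]
  field_simp
  push_cast
  ring

theorem mul_sin_add_mul_cos_prufer (l : ℝ) {t : ℝ} (ht : 0 ≤ t) :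
    ψ l t * Real.sin (prufer w ψ l t) + w t * deriv (ψ l) t * Real.cos (prufer w ψ l t) = 0 := by
  have hw := S.continuous_weight
  have hψ := S.continuous l
  have hψ' := S.continuous_deriv l
  have hϑ := S.continuous_prufer_right l
  have hconst := eq_of_hasDerivAt_eq_zero ht
    (ContinuousOn.div (by fun_prop) (by fun_prop) fun s hs => (S.modulus_pos l hs.1).ne')
    (fun s hs => S.hasDerivAt_sin_defect l hs.1)
  simpa [prufer_zero_right, S.weight_zero, (S.modulus_pos l ht).ne'] using hconst

theorem mul_cos_sub_mul_sin_prufer_pos (l : ℝ) {t : ℝ} (ht : 0 ≤ t) :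
    0 < ψ l t * Real.cos (prufer w ψ l t) - w t * deriv (ψ l) t * Real.sin (prufer w ψ l t) := by
  have hw := S.continuous_weight
  have hψ := S.continuous l
  have hψ' := S.continuous_deriv l
  have hϑ := S.continuous_prufer_right l
  set C : ℝ → ℝ := fun s =>
    ψ l s * Real.cos (prufer w ψ l s) - w s * deriv (ψ l) s * Real.sin (prufer w ψ l s) with hC
  have hsq : ∀ s, 0 ≤ s → C s ^ 2 = ψ l s ^ 2 + (w s * deriv (ψ l) s) ^ 2 := by
    intro s hs
    linear_combination (ψ l s ^ 2 + (w s * deriv (ψ l) s) ^ 2) *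
      Real.sin_sq_add_cos_sq (prufer w ψ l s) -
      (ψ l s * Real.sin (prufer w ψ l s) + w s * deriv (ψ l) s * Real.cos (prufer w ψ l s)) *
      S.mul_sin_add_mul_cos_prufer l hs
  have hC0 : C 0 = 1 := by simp [hC, S.zero_right, S.weight_zero, prufer_zero_right]
  by_contra! hneg
  obtain ⟨s, hs, hCs⟩ := intermediate_value_Icc' ht (by fun_prop : Continuous C).continuousOn
    (show (0 : ℝ) ∈ Set.Icc (C t) (C 0) from ⟨hneg, hC0 ▸ zero_le_one⟩)
  exact (S.modulus_pos l hs.1).ne' (by rw [← hsq s hs.1, hCs, zero_pow two_ne_zero])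

theorem exists_polar (l : ℝ) {t : ℝ} (ht : 0 ≤ t) :
    ∃ R > 0, ψ l t = R * Real.cos (prufer w ψ l t) ∧
      w t * deriv (ψ l) t = -(R * Real.sin (prufer w ψ l t)) := by
  have hsin := S.mul_sin_add_mul_cos_prufer l ht
  have hone := Real.sin_sq_add_cos_sq (prufer w ψ l t)
  refine ⟨_, S.mul_cos_sub_mul_sin_prufer_pos l ht, ?_, ?_⟩
  · linear_combination -(ψ l t) * hone + Real.sin (prufer w ψ l t) * hsin
  · linear_combination -(w t * deriv (ψ l) t) * hone + Real.cos (prufer w ψ l t) * hsin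

theorem wronskian_eq_integral (l μ : ℝ) {t : ℝ} (ht : 0 ≤ t) :
    w t * deriv (ψ l) t * ψ μ t - ψ l t * (w t * deriv (ψ μ) t) =
      (μ ^ 2 - l ^ 2) * ∫ s in (0 : ℝ)..t, w s * (ψ l s * ψ μ s) := by
  have hw := S.continuous_weight
  have hψl := S.continuous l
  have hψμ := S.continuous μ
  have hψl' := S.continuous_deriv l
  have hψμ' := S.continuous_deriv μ
  rw [← intervalIntegral.integral_const_mul,
    intervalIntegral.integral_eq_sub_of_hasDerivAt_of_le ht
      (f := fun t => w t * deriv (ψ l) t * ψ μ t - ψ l t * (w t * deriv (ψ μ) t)) (by fun_prop)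
      (fun s hs => (((S.ode l s hs.1).mul (S.hasDerivAt μ s)).sub
        ((S.hasDerivAt l s).mul (S.ode μ s hs.1))).congr_deriv (by ring))
      (Continuous.intervalIntegrable (by fun_prop) _ _)]
  simp [S.weight_zero]

theorem integral_weight_mul_self_pos (l : ℝ) {t : ℝ} (ht : 0 < t) :
    0 < ∫ s in (0 : ℝ)..t, w s * (ψ l s * ψ l s) := by
  have hw := S.continuous_weight
  have hψ := S.continuous l
  refine intervalIntegral.integral_pos ht (by fun_prop)
    (fun s hs => mul_nonneg (S.weight_nonneg hs.1.le) (mul_self_nonneg _)) ?_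
  have hψ_pos : ∀ᶠ s in 𝓝[>] (0 : ℝ), 0 < ψ l s :=
    nhdsWithin_le_nhds (hψ.continuousAt.eventually (lt_mem_nhds (by simp [S.zero_right])))
  obtain ⟨s, hs, hst⟩ := (hψ_pos.and (Ioo_mem_nhdsGT ht)).exists
  exact ⟨s, ⟨hst.1.le, hst.2.le⟩, mul_pos (S.weight_pos s hst.1) (mul_pos hs hs)⟩

theorem continuous_integral_weight_mul (l t : ℝ) :
    Continuous fun μ => ∫ s in (0 : ℝ)..t, w s * (ψ μ s * ψ l s) := by
  have hψ : Continuous fun p : ℝ × ℝ => ψ p.1 p.2 := S.continuous_uncurry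
  have hψl := S.continuous l
  have hw := S.continuous_weight
  exact intervalIntegral.continuous_parametric_intervalIntegral_of_continuous'
    (f := fun μ s => w s * (ψ μ s * ψ l s)) (by unfold Function.uncurry; fun_prop) 0 t

theorem eventually_prufer_lt {l : ℝ} (hl : 0 ≤ l) {t : ℝ} (ht : 0 < t) :
    ∀ᶠ μ in 𝓝[>] l, prufer w ψ l t < prufer w ψ μ t := by
  have hintegral_pos : ∀ᶠ μ in 𝓝[>] l, 0 < ∫ s in (0 : ℝ)..t, w s * (ψ μ s * ψ l s) :=
    nhdsWithin_le_nhds <| (S.continuous_integral_weight_mul l t).continuousAt.eventually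
      (lt_mem_nhds (S.integral_weight_mul_self_pos l ht))
  have hclose : ∀ᶠ μ in 𝓝[>] l, prufer w ψ l t - Real.pi < prufer w ψ μ t :=
    nhdsWithin_le_nhds <| (S.continuous_prufer_left t).continuousAt.eventually
      (lt_mem_nhds (sub_lt_self _ Real.pi_pos))
  filter_upwards [hintegral_pos, hclose, self_mem_nhdsWithin] with μ hI hπ (hμ : l < μ)
  by_contra! hle
  obtain ⟨R, hR, hψl, hfluxl⟩ := S.exists_polar l ht.le
  obtain ⟨Q, hQ, hψμ, hfluxμ⟩ := S.exists_polar μ ht.le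
  have hsin : 0 ≤ Real.sin (prufer w ψ l t - prufer w ψ μ t) :=
    Real.sin_nonneg_of_nonneg_of_le_pi (by linarith) (by linarith)
  have hneg : (l ^ 2 - μ ^ 2) * ∫ s in (0 : ℝ)..t, w s * (ψ μ s * ψ l s) < 0 :=
    mul_neg_of_neg_of_pos (by nlinarith) hI
  rw [← S.wronskian_eq_integral μ l ht.le, hψl, hfluxl, hψμ, hfluxμ] at hneg
  rw [Real.sin_sub] at hsin
  linarith [mul_nonneg (mul_pos hR hQ).le hsin]

theorem strictMonoOn_prufer_left {t : ℝ} (ht : 0 < t) :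
    StrictMonoOn (fun l => prufer w ψ l t) (Set.Ici 0) :=
  strictMonoOn_Ici_of_eventually_lt (S.continuous_prufer_left t).continuousOn
    fun _ hl => S.eventually_prufer_lt hl ht

theorem prufer_pos {l t : ℝ} (hl : 0 < l) (ht : 0 < t) : 0 < prufer w ψ l t := by
  simpa [prufer_zero_right] using S.strictMonoOn_prufer_right hl Set.self_mem_Ici ht.le ht

theorem eq_zero_iff_cos (l : ℝ) {t : ℝ} (ht : 0 ≤ t) :
    ψ l t = 0 ↔ Real.cos (prufer w ψ l t) = 0 := by
  obtain ⟨R, hR, hψ, -⟩ := S.exists_polar l ht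
  rw [hψ, mul_eq_zero, or_iff_right hR.ne']

theorem deriv_eq_zero_iff_sin (l : ℝ) {t : ℝ} (ht : 0 < t) :
    deriv (ψ l) t = 0 ↔ Real.sin (prufer w ψ l t) = 0 := by
  obtain ⟨R, hR, -, hflux⟩ := S.exists_polar l ht.le
  rw [← mul_eq_zero_iff_left (S.weight_pos t ht).ne', hflux, neg_eq_zero, mul_eq_zero,
    or_iff_right hR.ne']

end SturmFamily

/-! ### Counting zeros -/

/-- The zeros of `f` in `I`, each counted once. -/
def zerosOn (f : ℝ → ℝ) (I : Set ℝ) : Set ℝ := {t | t ∈ I ∧ f t = 0}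

theorem zerosOn_mono (f : ℝ → ℝ) {I J : Set ℝ} (h : I ⊆ J) : zerosOn f I ⊆ zerosOn f J :=
  fun _ ht => ⟨h ht.1, ht.2⟩

section Counting

variable {f g : ℝ → ℝ} {u : ℕ → ℝ}

theorem exists_pos_le_eq_of_le (hf : ContinuousOn f (Set.Ici 0)) {x y : ℝ} (hx : 0 ≤ x)
    (h0 : f 0 < y) (hy : y ≤ f x) : ∃ z, 0 < z ∧ z ≤ x ∧ f z = y := by
  obtain ⟨z, hz, hfz⟩ := intermediate_value_Icc hx (hf.mono Set.Icc_subset_Ici_self) ⟨h0.le, hy⟩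
  exact ⟨z, hz.1.lt_of_ne (by rintro rfl; exact h0.ne hfz), hz.2, hfz⟩

theorem encard_zeros_Ioc_eq (hf : ContinuousOn f (Set.Ici 0)) (hmono : StrictMonoOn f (Set.Ici 0))
    (hu : StrictMono u) (hg : ∀ y, 0 < y → (g y = 0 ↔ ∃ k, f y = u k)) (h0 : f 0 < u 0) {k : ℕ}
    {x : ℝ} (hx : 0 < x) (hfx : f x = u k) :
    {y : ℝ | 0 < y ∧ y ≤ x ∧ g y = 0}.encard = (k + 1 : ℕ) := by
  have hex : ∀ j : ℕ, ∃ y, j ≤ k → 0 < y ∧ y ≤ x ∧ f y = u j := fun j => by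
    by_cases hj : j ≤ k
    · obtain ⟨y, hy⟩ := exists_pos_le_eq_of_le hf hx.le (h0.trans_le (hu.monotone j.zero_le))
        (hfx ▸ hu.monotone hj)
      exact ⟨y, fun _ => hy⟩
    · exact ⟨0, fun h => absurd h hj⟩
  choose y hy using hex
  have himage : {z : ℝ | 0 < z ∧ z ≤ x ∧ g z = 0} = y '' Set.Iic k := by
    ext z
    constructor
    · rintro ⟨hz, hzx, hgz⟩
      obtain ⟨j, hj⟩ := (hg z hz).1 hgz
      have hjk : j ≤ k := by
        rw [← hu.le_iff_le, ← hj, ← hfx]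
        exact hmono.monotoneOn hz.le hx.le hzx
      exact ⟨j, hjk, hmono.injOn (hy j hjk).1.le hz.le ((hy j hjk).2.2.trans hj.symm)⟩
    · rintro ⟨j, hj, rfl⟩
      obtain ⟨hpos, hle, heq⟩ := hy j hj
      exact ⟨hpos, hle, (hg _ hpos).2 ⟨j, heq⟩⟩
  have hinj : Set.InjOn y (Set.Iic k) := fun i hi j hj hij =>
    hu.injective ((hy i hi).2.2.symm.trans ((congrArg f hij).trans (hy j hj).2.2))
  rw [himage, hinj.encard_image, ← Finset.coe_Iic, Set.encard_coe_eq_coe_finsetCard, Nat.card_Iic]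

theorem isNthPosZero_iff (hf : ContinuousOn f (Set.Ici 0)) (hmono : StrictMonoOn f (Set.Ici 0))
    (hu : StrictMono u) (hg : ∀ y, 0 < y → (g y = 0 ↔ ∃ k, f y = u k)) (h0 : f 0 < u 0) (k : ℕ)
    (x : ℝ) : IsNthPosZero g (k + 1) x ↔ 0 < x ∧ f x = u k := by
  constructor
  · rintro ⟨hx, hgx, hcard⟩
    obtain ⟨j, hj⟩ := (hg x hx).1 hgx
    rw [encard_zeros_Ioc_eq hf hmono hu hg h0 hx hj] at hcard
    have hjk : j + 1 = k + 1 := by exact_mod_cast hcard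
    exact ⟨hx, Nat.succ_injective hjk ▸ hj⟩
  · rintro ⟨hx, hfx⟩
    exact ⟨hx, (hg x hx).2 ⟨k, hfx⟩, encard_zeros_Ioc_eq hf hmono hu hg h0 hx hfx⟩

end Counting

theorem nthPosZero_eq {f : ℝ → ℝ} {k : ℕ} {x : ℝ} (h : ∀ y, IsNthPosZero f k y ↔ y = x) :
    nthPosZero f k = x := by
  rw [nthPosZero, show {y | IsNthPosZero f k y} = {x} from Set.ext h, csInf_singleton]

theorem cos_eq_zero_iff_of_nonneg {x : ℝ} (hx : 0 ≤ x) :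
    Real.cos x = 0 ↔ ∃ k : ℕ, x = (k + 1 / 2) * Real.pi := by
  rw [Real.cos_eq_zero_iff]
  constructor
  · rintro ⟨k, hk⟩
    have hk0 : 0 ≤ k := by
      by_contra! hneg
      have : (k : ℝ) ≤ -1 := by exact_mod_cast Int.le_sub_one_of_lt hneg
      nlinarith [Real.pi_pos]
    lift k to ℕ using hk0
    exact ⟨k, by rw [hk]; push_cast; ring⟩
  · rintro ⟨k, hk⟩
    exact ⟨k, by rw [hk]; push_cast; ring⟩

theorem sin_eq_zero_iff_of_pos {x : ℝ} (hx : 0 < x) :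
    Real.sin x = 0 ↔ ∃ k : ℕ, x = (k + 1) * Real.pi := by
  rw [Real.sin_eq_zero_iff]
  constructor
  · rintro ⟨k, hk⟩
    have hk0 : 0 < k := by
      by_contra! hneg
      have : (k : ℝ) ≤ 0 := by exact_mod_cast hneg
      nlinarith [Real.pi_pos]
    obtain ⟨n, rfl⟩ := Int.eq_succ_of_zero_lt hk0
    exact ⟨n, by rw [← hk]; push_cast; ring⟩
  · rintro ⟨k, hk⟩
    exact ⟨k + 1, by rw [hk]; push_cast; ring⟩

theorem strictMono_nat_add_mul_pi (c : ℝ) : StrictMono fun k : ℕ => (k + c) * Real.pi := by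
  intro i j hij
  have : (i : ℝ) < j := by exact_mod_cast hij
  exact mul_lt_mul_of_pos_right (by linarith) Real.pi_pos

namespace SturmFamily

variable {w : ℝ → ℝ} {ψ : ℝ → ℝ → ℝ} (S : SturmFamily w ψ)
include S

theorem prufer_nonneg {l t : ℝ} (hl : 0 < l) (ht : 0 ≤ t) : 0 ≤ prufer w ψ l t := by
  rcases ht.eq_or_lt with rfl | h
  · rw [prufer_zero_right]
  · exact (S.prufer_pos hl h).le

theorem eq_zero_iff_exists_prufer {l t : ℝ} (hl : 0 < l) (ht : 0 ≤ t) :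
    ψ l t = 0 ↔ ∃ k : ℕ, prufer w ψ l t = (k + 1 / 2) * Real.pi := by
  rw [S.eq_zero_iff_cos l ht, cos_eq_zero_iff_of_nonneg (S.prufer_nonneg hl ht)]

theorem isNthPosZero_left {t : ℝ} (ht : 0 < t) (k : ℕ) (l : ℝ) :
    IsNthPosZero (fun μ => ψ μ t) (k + 1) l ↔ 0 < l ∧ prufer w ψ l t = (k + 1 / 2) * Real.pi := by
  refine isNthPosZero_iff (S.continuous_prufer_left t).continuousOn
    (S.strictMonoOn_prufer_left ht) (strictMono_nat_add_mul_pi (1 / 2))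
    (fun l hl => S.eq_zero_iff_exists_prufer hl ht.le) ?_ k l
  rw [S.prufer_zero_left]
  positivity

theorem isNthPosZero_deriv_left {t : ℝ} (ht : 0 < t) (k : ℕ) (l : ℝ) :
    IsNthPosZero (fun μ => deriv (ψ μ) t) (k + 1) l ↔
      0 < l ∧ prufer w ψ l t = (k + 1) * Real.pi := by
  refine isNthPosZero_iff (S.continuous_prufer_left t).continuousOn
    (S.strictMonoOn_prufer_left ht) (strictMono_nat_add_mul_pi 1) (fun l hl => ?_) ?_ k l
  · rw [S.deriv_eq_zero_iff_sin l ht, sin_eq_zero_iff_of_pos (S.prufer_pos hl ht)]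
  · rw [S.prufer_zero_left]
    positivity

theorem encard_zerosOn_Ioc_le {l τ : ℝ} (hl : 0 < l) {m : ℕ}
    (hτ : prufer w ψ l τ < (m + 1 / 2) * Real.pi) : (zerosOn (ψ l) (Set.Ioc 0 τ)).encard ≤ m := by
  have hex : ∀ t : ℝ, ∃ k : ℕ, t ∈ zerosOn (ψ l) (Set.Ioc 0 τ) →
      prufer w ψ l t = (k + 1 / 2) * Real.pi := fun t => by
    by_cases ht : t ∈ zerosOn (ψ l) (Set.Ioc 0 τ)
    · exact ((S.eq_zero_iff_exists_prufer hl ht.1.1.le).1 ht.2).imp fun k hk _ => hk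
    · exact ⟨0, fun h => absurd h ht⟩
  choose k hk using hex
  have hmono := S.strictMonoOn_prufer_right hl
  have hmaps : Set.MapsTo k (zerosOn (ψ l) (Set.Ioc 0 τ)) (Finset.range m) := fun t ht => by
    have hangle := (hmono.monotoneOn ht.1.1.le (ht.1.1.le.trans ht.1.2) ht.1.2).trans_lt hτ
    rw [hk t ht] at hangle
    have hlt : (k t : ℝ) < m := by linarith [lt_of_mul_lt_mul_right hangle Real.pi_pos.le]
    simpa using hlt
  have hinj : Set.InjOn k (zerosOn (ψ l) (Set.Ioc 0 τ)) := fun x hx y hy hxy =>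
    hmono.injOn hx.1.1.le hy.1.1.le ((hk x hx).trans (hxy ▸ (hk y hy).symm))
  simpa only [Set.encard_coe_eq_coe_finsetCard, Finset.card_range] using
    Set.encard_le_encard_of_injOn hmaps hinj

theorem exists_prufer_ge {l : ℝ} (hl : 0 < l) (n : ℕ) : ∃ t > 0, n * Real.pi ≤ prufer w ψ l t := by
  induction n with
  | zero => exact ⟨1, one_pos, by simpa using S.prufer_nonneg hl zero_le_one⟩
  | succ n ih =>
    obtain ⟨t, ht, hn⟩ := ih
    obtain ⟨t₁, ht₁, hzero₁⟩ := S.exists_zero_gt l hl t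
    obtain ⟨t₂, ht₂, hzero₂⟩ := S.exists_zero_gt l hl t₁
    have hpos₁ : 0 < t₁ := ht.trans ht₁
    have hpos₂ : 0 < t₂ := hpos₁.trans ht₂
    have hmono := S.strictMonoOn_prufer_right hl
    have hangle₁ := hmono ht.le hpos₁.le ht₁
    have hangle₂ := hmono hpos₁.le hpos₂.le ht₂
    obtain ⟨k₁, hk₁⟩ := (S.eq_zero_iff_exists_prufer hl hpos₁.le).1 hzero₁
    obtain ⟨k₂, hk₂⟩ := (S.eq_zero_iff_exists_prufer hl hpos₂.le).1 hzero₂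
    rw [hk₁] at hangle₁
    rw [hk₁, hk₂] at hangle₂
    have hk : (k₁ : ℝ) < k₂ := by linarith [lt_of_mul_lt_mul_right hangle₂ Real.pi_pos.le]
    have hk' : (k₁ : ℝ) + 1 ≤ k₂ := by exact_mod_cast hk
    refine ⟨t₂, hpos₂, ?_⟩
    rw [hk₂]
    push_cast
    nlinarith [Real.pi_pos]

theorem exists_prufer_eq {l x : ℝ} (hl : 0 < l) (hx : 0 < x) : ∃ t > 0, prufer w ψ l t = x := by
  obtain ⟨n, hn⟩ := exists_nat_ge (x / Real.pi)
  obtain ⟨T, hT, hTn⟩ := S.exists_prufer_ge hl n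
  obtain ⟨t, ht, -, heq⟩ := exists_pos_le_eq_of_le (S.continuous_prufer_right l).continuousOn hT.le
    (by rwa [prufer_zero_right]) (((div_le_iff₀ Real.pi_pos).1 hn).trans hTn)
  exact ⟨t, ht, heq⟩

theorem exists_prufer_left_eq {l t x : ℝ} (hl : 0 ≤ l) (hx : 0 < x)
    (hxl : x ≤ prufer w ψ l t) : ∃ μ > 0, μ ≤ l ∧ prufer w ψ μ t = x :=
  exists_pos_le_eq_of_le (S.continuous_prufer_left t).continuousOn hl
    (by rwa [S.prufer_zero_left]) hxl

end SturmFamily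

/-! ### Rolle's theorem for zero counts -/

theorem encard_zerosOn_le_add_one {f f' : ℝ → ℝ} {a b : ℝ} (hf : ContinuousOn f (Set.Icc a b))
    (hd : ∀ t ∈ Set.Ioo a b, HasDerivAt f (f' t) t) :
    (zerosOn f (Set.Icc a b)).encard ≤ (zerosOn f' (Set.Ioo a b)).encard + 1 := by
  rcases (zerosOn f' (Set.Ioo a b)).finite_or_infinite with hfin | hinf
  swap
  · simp [hinf.encard_eq]
  have hcard : ∀ s : Finset ℝ, ↑s ⊆ zerosOn f (Set.Icc a b) → s.card ≤ hfin.toFinset.card + 1 := by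
    refine fun s hs => Finset.card_le_of_interleaved fun x hx y hy hxy _ => ?_
    obtain ⟨⟨hax, -⟩, hfx⟩ := hs hx
    obtain ⟨⟨-, hyb⟩, hfy⟩ := hs hy
    obtain ⟨z, hz, hf'z⟩ := exists_hasDerivAt_eq_zero hxy (hf.mono (Set.Icc_subset_Icc hax hyb))
      (hfx.trans hfy.symm) fun t ht => hd t (Set.Ioo_subset_Ioo hax hyb ht)
    exact ⟨z, hfin.mem_toFinset.2 ⟨Set.Ioo_subset_Ioo hax hyb hz, hf'z⟩, hz⟩
  rw [hfin.encard_eq_coe_toFinset_card]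
  by_contra! hlt
  obtain ⟨T, hT, hTcard⟩ := Set.exists_subset_encard_eq (Order.add_one_le_of_lt hlt)
  have hTfin : T.Finite := Set.finite_of_encard_eq_coe (k := hfin.toFinset.card + 1 + 1) hTcard
  have hle := hcard hTfin.toFinset (by simpa using hT)
  rw [hTfin.encard_eq_coe_toFinset_card] at hTcard
  have heq : hTfin.toFinset.card = hfin.toFinset.card + 1 + 1 := by exact_mod_cast hTcard
  omega

theorem encard_zerosOn_Ioc_le_of_flux {w h' g : ℝ → ℝ} {τ : ℝ} (hτ : 0 < τ)
    (hw : ContinuousOn w (Set.Icc 0 τ)) (hw0 : w 0 = 0) (hwpos : ∀ t, 0 < t → 0 < w t)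
    (hh' : ContinuousOn h' (Set.Icc 0 τ))
    (hflux : ∀ t, 0 < t → HasDerivAt (fun s => w s * h' s) (-(w t * g t)) t) :
    (zerosOn h' (Set.Ioc 0 τ)).encard ≤ (zerosOn g (Set.Ioo 0 τ)).encard := by
  have hinsert : insert 0 (zerosOn h' (Set.Ioc 0 τ)) ⊆
      zerosOn (fun s => w s * h' s) (Set.Icc 0 τ) := by
    rintro t (rfl | ⟨ht, hzero⟩)
    · exact ⟨⟨le_rfl, hτ.le⟩, by simp [hw0]⟩
    · exact ⟨⟨ht.1.le, ht.2⟩, by simp [hzero]⟩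
  have hsub : zerosOn (fun t => -(w t * g t)) (Set.Ioo 0 τ) ⊆ zerosOn g (Set.Ioo 0 τ) :=
    fun t ht => ⟨ht.1, by simpa [(hwpos t ht.1.1).ne'] using ht.2⟩
  refine (WithTop.add_le_add_iff_right ENat.one_ne_top).1 ?_
  calc (zerosOn h' (Set.Ioc 0 τ)).encard + 1
      = (insert 0 (zerosOn h' (Set.Ioc 0 τ))).encard :=
        (Set.encard_insert_of_notMem fun h0 => h0.1.1.false).symm
    _ ≤ (zerosOn (fun s => w s * h' s) (Set.Icc 0 τ)).encard := Set.encard_le_encard hinsert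
    _ ≤ (zerosOn (fun t => -(w t * g t)) (Set.Ioo 0 τ)).encard + 1 :=
        encard_zerosOn_le_add_one (hw.mul hh') fun t ht => hflux t ht.1
    _ ≤ (zerosOn g (Set.Ioo 0 τ)).encard + 1 := by gcongr

theorem encard_zerosOn_Ioo_add_one_le {f : ℝ → ℝ} {a b : ℝ} (hab : a < b) (hb : f b = 0) :
    (zerosOn f (Set.Ioo a b)).encard + 1 ≤ (zerosOn f (Set.Ioc a b)).encard := by
  rw [← Set.encard_insert_of_notMem fun h => (h.1.2.false : False)]
  refine Set.encard_le_encard ?_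
  rintro t (rfl | ht)
  exacts [⟨⟨hab, le_rfl⟩, hb⟩, ⟨Set.Ioo_subset_Ioc_self ht.1, ht.2⟩]

/-! ### Linear combinations of a Sturm–Liouville family -/

/-- The image under the `k`-th power of `f ↦ -(w f')' / w` of the combination `∑ cᵢ ψ_{μᵢ}`. -/
noncomputable def combination {ι : Type*} (ψ : ℝ → ℝ → ℝ) (s : Finset ι) (c μ : ι → ℝ) (k : ℕ)
    (t : ℝ) : ℝ :=
  ∑ i ∈ s, c i * (μ i ^ 2) ^ k * ψ (μ i) t

namespace SturmFamily

variable {ι : Type*} {w : ℝ → ℝ} {ψ : ℝ → ℝ → ℝ} (S : SturmFamily w ψ) (s : Finset ι)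
  (c μ : ι → ℝ)
include S

theorem analyticAt_combination (k : ℕ) (t : ℝ) : AnalyticAt ℝ (combination ψ s c μ k) t := by
  unfold combination
  exact Finset.analyticAt_fun_sum s fun i _ => analyticAt_const.mul (S.analyticAt _ _)

theorem deriv_combination (k : ℕ) (t : ℝ) : deriv (combination ψ s c μ k) t =
    ∑ i ∈ s, c i * (μ i ^ 2) ^ k * deriv (ψ (μ i)) t :=
  (HasDerivAt.fun_sum fun i _ => (S.hasDerivAt (μ i) t).const_mul _).deriv

theorem continuous_combination (k : ℕ) : Continuous (combination ψ s c μ k) :=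
  continuous_iff_continuousAt.2 fun t => (S.analyticAt_combination s c μ k t).continuousAt

theorem continuous_deriv_combination (k : ℕ) : Continuous (deriv (combination ψ s c μ k)) :=
  continuous_iff_continuousAt.2 fun t => (S.analyticAt_combination s c μ k t).deriv.continuousAt

theorem hasDerivAt_combination (k : ℕ) (t : ℝ) :
    HasDerivAt (combination ψ s c μ k) (deriv (combination ψ s c μ k) t) t :=
  (S.analyticAt_combination s c μ k t).differentiableAt.hasDerivAt

theorem ode_combination (k : ℕ) (t : ℝ) (ht : 0 < t) :
    HasDerivAt (fun x => w x * deriv (combination ψ s c μ k) x)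
      (-(w t * combination ψ s c μ (k + 1) t)) t := by
  have hsum : (fun x => w x * deriv (combination ψ s c μ k) x) =
      fun x => ∑ i ∈ s, c i * (μ i ^ 2) ^ k * (w x * deriv (ψ (μ i)) x) := by
    funext x
    rw [S.deriv_combination, Finset.mul_sum]
    exact Finset.sum_congr rfl fun i _ => by ring
  rw [hsum]
  refine (HasDerivAt.fun_sum fun i (_ : i ∈ s) =>
    (S.ode (μ i) t ht).const_mul (c i * (μ i ^ 2) ^ k)).congr_deriv ?_
  rw [combination, Finset.mul_sum, ← Finset.sum_neg_distrib]
  exact Finset.sum_congr rfl fun i _ => by ring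

theorem encard_zerosOn_combination_le_deriv (k : ℕ) (τ : ℝ) :
    (zerosOn (combination ψ s c μ k) (Set.Ioc 0 τ)).encard ≤
      (zerosOn (deriv (combination ψ s c μ k)) (Set.Ioo 0 τ)).encard + 1 :=
  (Set.encard_le_encard (zerosOn_mono _ Set.Ioc_subset_Icc_self)).trans
    (encard_zerosOn_le_add_one (S.continuous_combination s c μ k).continuousOn
      fun t _ => S.hasDerivAt_combination s c μ k t)

section ZeroCount

variable {τ : ℝ} (hτ : 0 < τ) {k : ℕ}
include hτ

theorem encard_zerosOn_deriv_combination_le_succ :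
    (zerosOn (deriv (combination ψ s c μ k)) (Set.Ioc 0 τ)).encard ≤
      (zerosOn (combination ψ s c μ (k + 1)) (Set.Ioo 0 τ)).encard :=
  encard_zerosOn_Ioc_le_of_flux hτ S.continuous_weight.continuousOn S.weight_zero S.weight_pos
    (S.continuous_deriv_combination s c μ k).continuousOn (S.ode_combination s c μ k)

theorem encard_zerosOn_combination_le_succ (h0 : combination ψ s c μ k τ = 0) :
    (zerosOn (combination ψ s c μ k) (Set.Ioo 0 τ)).encard ≤
      (zerosOn (combination ψ s c μ (k + 1)) (Set.Ioo 0 τ)).encard := by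
  refine (WithTop.add_le_add_iff_right ENat.one_ne_top).1 ?_
  calc (zerosOn (combination ψ s c μ k) (Set.Ioo 0 τ)).encard + 1
      ≤ (zerosOn (combination ψ s c μ k) (Set.Ioc 0 τ)).encard :=
        encard_zerosOn_Ioo_add_one_le hτ h0
    _ ≤ (zerosOn (deriv (combination ψ s c μ k)) (Set.Ioo 0 τ)).encard + 1 :=
        S.encard_zerosOn_combination_le_deriv s c μ k τ
    _ ≤ (zerosOn (deriv (combination ψ s c μ k)) (Set.Ioc 0 τ)).encard + 1 := by
        gcongr; exact zerosOn_mono _ Set.Ioo_subset_Ioc_self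
    _ ≤ (zerosOn (combination ψ s c μ (k + 1)) (Set.Ioo 0 τ)).encard + 1 :=
        add_le_add_left (S.encard_zerosOn_deriv_combination_le_succ s c μ hτ) 1

theorem encard_zerosOn_Ioc_combination_le_succ (h0' : deriv (combination ψ s c μ k) τ = 0) :
    (zerosOn (combination ψ s c μ k) (Set.Ioc 0 τ)).encard ≤
      (zerosOn (combination ψ s c μ (k + 1)) (Set.Ioo 0 τ)).encard :=
  (S.encard_zerosOn_combination_le_deriv s c μ k τ).trans
    ((encard_zerosOn_Ioo_add_one_le hτ h0').trans
      (S.encard_zerosOn_deriv_combination_le_succ s c μ hτ))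

theorem encard_zerosOn_combination_add_one_le_succ (h0 : combination ψ s c μ k τ = 0)
    (h0' : deriv (combination ψ s c μ k) τ = 0) :
    (zerosOn (combination ψ s c μ k) (Set.Ioo 0 τ)).encard + 1 ≤
      (zerosOn (combination ψ s c μ (k + 1)) (Set.Ioo 0 τ)).encard :=
  (encard_zerosOn_Ioo_add_one_le hτ h0).trans
    (S.encard_zerosOn_Ioc_combination_le_succ s c μ hτ h0')

end ZeroCount

theorem analyticOrderAt_combination {τ : ℝ} {k : ℕ} (hτ : 0 < τ)
    (h0 : combination ψ s c μ k τ = 0) (h0' : deriv (combination ψ s c μ k) τ = 0) :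
    analyticOrderAt (combination ψ s c μ k) τ =
      analyticOrderAt (combination ψ s c μ (k + 1)) τ + 2 := by
  have hw := S.analyticAt_weight τ hτ
  have hworder : analyticOrderAt w τ = 0 := hw.analyticOrderAt_eq_zero.2 (S.weight_pos τ hτ).ne'
  have hG := S.analyticAt_combination s c μ k τ
  have hG_succ := S.analyticAt_combination s c μ (k + 1) τ
  have horder_deriv := hG.analyticOrderAt_deriv_add_one
  have horder_flux := (hw.mul hG.deriv).analyticOrderAt_deriv_add_one
  simp only [h0, sub_zero] at horder_deriv
  simp only [Pi.mul_apply, h0', mul_zero, sub_zero] at horder_flux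
  have hflux_deriv : analyticOrderAt (deriv (w * deriv (combination ψ s c μ k))) τ =
      analyticOrderAt (combination ψ s c μ (k + 1)) τ := by
    have hode : deriv (w * deriv (combination ψ s c μ k)) =ᶠ[𝓝 τ]
        -(w * combination ψ s c μ (k + 1)) := by
      filter_upwards [lt_mem_nhds hτ] with t ht
      exact (S.ode_combination s c μ k t ht).deriv
    rw [analyticOrderAt_congr hode, analyticOrderAt_neg, analyticOrderAt_mul hw hG_succ, hworder,
      zero_add]
  have hflux : analyticOrderAt (fun x => w x * deriv (combination ψ s c μ k) x) τ =
      analyticOrderAt (deriv (combination ψ s c μ k)) τ :=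
    (analyticOrderAt_mul hw hG.deriv).trans (by rw [hworder, zero_add])
  rw [hflux_deriv, hflux] at horder_flux
  rw [← horder_deriv, ← horder_flux, add_assoc, one_add_one_eq_two]

theorem analyticOrderAt_combination_eq_add {τ : ℝ} {n : ℕ} (hτ : 0 < τ)
    (h0 : ∀ k < n, combination ψ s c μ k τ = 0)
    (h0' : ∀ k < n, deriv (combination ψ s c μ k) τ = 0) :
    analyticOrderAt (combination ψ s c μ 0) τ =
      analyticOrderAt (combination ψ s c μ n) τ + (2 * n : ℕ) := by
  induction n with
  | zero => simp
  | succ n ih =>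
    rw [ih (fun k hk => h0 k (by omega)) (fun k hk => h0' k (by omega)),
      S.analyticOrderAt_combination s c μ hτ (h0 n (by omega)) (h0' n (by omega))]
    push_cast
    ring

end SturmFamily

/-! ### Combinations with a zero of maximal order -/

theorem exists_strictMono_of_le_encard {s : Set ℝ} {q : ℕ} (h : (q : ℕ∞) ≤ s.encard) :
    ∃ x : Fin q → ℝ, StrictMono x ∧ ∀ i, x i ∈ s := by
  obtain ⟨T, hTs, hT⟩ := Set.exists_subset_encard_eq h
  have hfin : T.Finite := Set.finite_of_encard_eq_coe hT
  rw [hfin.encard_eq_coe_toFinset_card] at hT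
  have hcard : hfin.toFinset.card = q := by exact_mod_cast hT
  exact ⟨hfin.toFinset.orderEmbOfFin hcard, OrderEmbedding.strictMono _, fun i =>
    hTs (hfin.mem_toFinset.1 (hfin.toFinset.orderEmbOfFin_mem hcard i))⟩

theorem le_encard_zerosOn_of_tendsto {h : ℕ → ℝ → ℝ} {f f' : ℝ → ℝ} {a b : ℝ} {q : ℕ}
    (hd : ∀ k, Differentiable ℝ (h k))
    (hf : ∀ y, Tendsto (fun p : ℕ × ℝ => h p.1 p.2) (atTop ×ˢ 𝓝 y) (𝓝 (f y)))
    (hf' : ∀ y, Tendsto (fun p : ℕ × ℝ => deriv (h p.1) p.2) (atTop ×ˢ 𝓝 y) (𝓝 (f' y)))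
    (hsimple : ∀ y ∈ Set.Icc a b, f y ≠ 0 ∨ f' y ≠ 0)
    (hz : ∀ k, (q : ℕ∞) ≤ (zerosOn (h k) (Set.Icc a b)).encard) :
    (q : ℕ∞) ≤ (zerosOn f (Set.Icc a b)).encard := by
  choose X hmono hX using fun k => exists_strictMono_of_le_encard (hz k)
  obtain ⟨Y, hY, φ, hφ, hlim⟩ := (isCompact_univ_pi fun _ : Fin q => isCompact_Icc).tendsto_subseq
    (x := X) fun k i _ => (hX k i).1
  rw [tendsto_pi_nhds] at hlim
  have hYzero : ∀ i, f (Y i) = 0 := fun i =>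
    tendsto_nhds_unique ((hf _).comp (hφ.tendsto_atTop.prodMk (hlim i)))
      (tendsto_const_nhds.congr fun n => (hX (φ n) i).2.symm)
  have hne : ∀ i j : Fin q, i < j → Y i ≠ Y j := by
    intro i j hij heq
    have hrolle : ∀ n, ∃ ξ ∈ Set.Ioo (X (φ n) i) (X (φ n) j), deriv (h (φ n)) ξ = 0 := fun n =>
      exists_deriv_eq_zero (hmono _ hij) (hd _).continuous.continuousOn
        ((hX (φ n) i).2.trans (hX (φ n) j).2.symm)
    choose ξ hξ hξzero using hrolle
    have hξlim : Tendsto ξ atTop (𝓝 (Y i)) :=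
      tendsto_of_tendsto_of_tendsto_of_le_of_le (hlim i) (heq ▸ hlim j) (fun n => (hξ n).1.le)
        (fun n => (hξ n).2.le)
    have hf'zero : f' (Y i) = 0 :=
      tendsto_nhds_unique ((hf' _).comp (hφ.tendsto_atTop.prodMk hξlim))
        (tendsto_const_nhds.congr fun n => (hξzero n).symm)
    rcases hsimple (Y i) (hY i trivial) with hne | hne
    exacts [hne (hYzero i), hne hf'zero]
  have hinj : Function.Injective Y := fun i j hij => by
    by_contra hij'
    rcases lt_or_gt_of_ne hij' with hlt | hlt
    exacts [hne i j hlt hij, hne j i hlt hij.symm]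
  calc (q : ℕ∞) = (Set.range Y).encard := by
        rw [← Set.image_univ, hinj.injOn.encard_image, Set.encard_univ,
          ENat.card_eq_coe_fintype_card, Fintype.card_fin]
    _ ≤ (zerosOn f (Set.Icc a b)).encard :=
        Set.encard_le_encard (Set.range_subset_iff.2 fun i => ⟨hY i trivial, hYzero i⟩)

theorem add_one_le_of_step {N : ℕ → ℕ∞} {n : ℕ} (h0 : 1 ≤ N 0) (hlt : ∀ k < n, N k + 1 ≤ N (k + 1))
    (hge : ∀ k ≥ n, N k ≤ N (k + 1)) : ∀ k ≥ n, ((n + 1 : ℕ) : ℕ∞) ≤ N k := by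
  have hgrow : ∀ k ≤ n, ((k + 1 : ℕ) : ℕ∞) ≤ N k := by
    intro k
    induction k with
    | zero => simpa using h0
    | succ k ih =>
      exact fun hk => (add_le_add_left (ih (by omega)) 1).trans (hlt k hk)
  exact Nat.le_induction (hgrow n le_rfl) fun k hk ih => ih.trans (hge k hk)

section Dominant

variable {ι : Type*} {s : Finset ι} {c r : ι → ℝ} {M : ι}

theorem tendsto_sum_mul_pow_div {F : ι → ℝ → ℝ} (hF : ∀ i, Continuous (F i)) (hM : M ∈ s)
    (hcM : c M ≠ 0) (hrM : 0 < r M) (hr : ∀ i ∈ s, i ≠ M → |r i| < r M) (y : ℝ) :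
    Tendsto (fun p : ℕ × ℝ => (∑ i ∈ s, c i * r i ^ p.1 * F i p.2) / (c M * r M ^ p.1))
      (atTop ×ˢ 𝓝 y) (𝓝 (F M y)) := by
  classical
  suffices h : Tendsto (fun p : ℕ × ℝ => ∑ i ∈ s, c i / c M * (r i / r M) ^ p.1 * F i p.2)
      (atTop ×ˢ 𝓝 y) (𝓝 (∑ i ∈ s, if i = M then F i y else 0)) by
    rw [Finset.sum_ite_eq' s M, if_pos hM] at h
    refine h.congr fun p => ?_
    rw [Finset.sum_div]
    exact Finset.sum_congr rfl fun i _ => by rw [div_pow]; field_simp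
  refine tendsto_finsetSum s fun i hi => ?_
  have hFi : Tendsto (fun p : ℕ × ℝ => F i p.2) (atTop ×ˢ 𝓝 y) (𝓝 (F i y)) :=
    ((hF i).tendsto y).comp tendsto_snd
  rcases eq_or_ne i M with rfl | hiM
  · simpa [hcM, hrM.ne'] using hFi
  · have hratio : |r i / r M| < 1 := by
      rw [abs_div, abs_of_pos hrM, div_lt_one hrM]
      exact hr i hi hiM
    simpa [hiM] using
      (((tendsto_pow_atTop_nhds_zero_of_abs_lt_one hratio).comp tendsto_fst).const_mul
        (c i / c M)).mul hFi

end Dominant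

namespace SturmFamily

variable {ι : Type*} {w : ℝ → ℝ} {ψ : ℝ → ℝ → ℝ} (S : SturmFamily w ψ) {s : Finset ι}
  {c μ : ι → ℝ} {M : ι} (hM : M ∈ s) (hcM : c M ≠ 0) (hμM : 0 < μ M)
  (hμ : ∀ i ∈ s, i ≠ M → μ i ^ 2 < μ M ^ 2)

include S hM hcM hμM hμ

/-- After division by `c M * μ M ^ (2 * k)`, the iterates converge to the component with the largest
eigenvalue, whose zeros are simple. -/
theorem le_encard_zerosOn_of_forall_combination {τ : ℝ} {q k₀ : ℕ}
    (hz : ∀ k ≥ k₀, (q : ℕ∞) ≤ (zerosOn (combination ψ s c μ k) (Set.Ioc 0 τ)).encard) :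
    (q : ℕ∞) ≤ (zerosOn (ψ (μ M)) (Set.Ioc 0 τ)).encard := by
  have hr : ∀ i ∈ s, i ≠ M → |μ i ^ 2| < μ M ^ 2 := fun i hi hiM => by
    simpa using hμ i hi hiM
  have hμM2 : 0 < μ M ^ 2 := by positivity
  have hshift (y : ℝ) : Tendsto (fun p : ℕ × ℝ => (p.1 + k₀, p.2)) (atTop ×ˢ 𝓝 y)
      (atTop ×ˢ 𝓝 y) :=
    ((tendsto_add_atTop_nat k₀).comp tendsto_fst).prodMk tendsto_snd
  set h : ℕ → ℝ → ℝ := fun k t =>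
    combination ψ s c μ (k + k₀) t / (c M * (μ M ^ 2) ^ (k + k₀)) with hdef
  have hlim (y : ℝ) : Tendsto (fun p : ℕ × ℝ => h p.1 p.2) (atTop ×ˢ 𝓝 y) (𝓝 (ψ (μ M) y)) := by
    simpa only [hdef, combination, Function.comp_def] using
      (tendsto_sum_mul_pow_div (fun i => S.continuous (μ i)) hM hcM hμM2 hr y).comp (hshift y)
  have hlim' (y : ℝ) : Tendsto (fun p : ℕ × ℝ => deriv (h p.1) p.2) (atTop ×ˢ 𝓝 y)
      (𝓝 (deriv (ψ (μ M)) y)) := by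
    simpa only [hdef, deriv_div_const, S.deriv_combination, Function.comp_def] using
      (tendsto_sum_mul_pow_div (fun i => S.continuous_deriv (μ i)) hM hcM hμM2 hr y).comp (hshift y)
  have hsimple : ∀ y ∈ Set.Icc 0 τ, ψ (μ M) y ≠ 0 ∨ deriv (ψ (μ M)) y ≠ 0 := fun y hy => by
    rcases hy.1.eq_or_lt with rfl | hpos
    · simp [S.zero_right]
    · exact S.ne_zero_or _ y hpos
  have hdiff (k : ℕ) : Differentiable ℝ (h k) := fun t =>
    (S.analyticAt_combination s c μ (k + k₀) t).differentiableAt.div_const _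
  have hzeros (k : ℕ) : (q : ℕ∞) ≤ (zerosOn (h k) (Set.Icc 0 τ)).encard := by
    refine (hz (k + k₀) (Nat.le_add_left k₀ k)).trans (Set.encard_le_encard fun t ht => ?_)
    exact ⟨Set.Ioc_subset_Icc_self ht.1, by simp only [hdef, ht.2, zero_div]⟩
  have hlimit := le_encard_zerosOn_of_tendsto hdiff hlim hlim' hsimple hzeros
  refine hlimit.trans (Set.encard_le_encard fun t ht => ⟨⟨ht.1.1.lt_of_ne ?_, ht.1.2⟩, ht.2⟩)
  rintro rfl
  exact one_ne_zero ((S.zero_right _).symm.trans ht.2)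

theorem combination_ne_zero_of_dirichlet {τ : ℝ} {n : ℕ}
    (hτ : prufer w ψ (μ M) τ < (n + 1 + 1 / 2) * Real.pi)
    (h0 : ∀ k, combination ψ s c μ k τ = 0)
    (h0' : ∀ k < n, deriv (combination ψ s c μ k) τ = 0) {t : ℝ} (ht0 : 0 < t) (htτ : t < τ) :
    combination ψ s c μ 0 t ≠ 0 := by
  intro hzero
  have hτ0 : 0 < τ := ht0.trans htτ
  have hcount := add_one_le_of_step
    (N := fun k => (zerosOn (combination ψ s c μ k) (Set.Ioo 0 τ)).encard)
    (Set.one_le_encard_iff_nonempty.2 ⟨t, ⟨ht0, htτ⟩, hzero⟩)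
    (fun k hk => S.encard_zerosOn_combination_add_one_le_succ s c μ hτ0 (h0 k) (h0' k hk))
    (fun k _ => S.encard_zerosOn_combination_le_succ s c μ hτ0 (h0 k))
  have hlower := S.le_encard_zerosOn_of_forall_combination hM hcM hμM hμ (q := n + 1 + 1)
    fun k hk => (add_le_add_left (hcount k hk) 1).trans (encard_zerosOn_Ioo_add_one_le hτ0 (h0 k))
  have hupper := S.encard_zerosOn_Ioc_le hμM (m := n + 1) (by push_cast; exact hτ)
  exact (Nat.lt_succ_self (n + 1)).not_ge (by exact_mod_cast hlower.trans hupper)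

theorem combination_ne_zero_of_neumann {τ : ℝ} {n : ℕ}
    (hτ : prufer w ψ (μ M) τ < (n + 1 / 2) * Real.pi)
    (h0 : ∀ k < n, combination ψ s c μ k τ = 0)
    (h0' : ∀ k, deriv (combination ψ s c μ k) τ = 0) {t : ℝ} (ht0 : 0 < t) (htτ : t < τ) :
    combination ψ s c μ 0 t ≠ 0 := by
  intro hzero
  have hτ0 : 0 < τ := ht0.trans htτ
  have hIoc (k : ℕ) : (zerosOn (combination ψ s c μ k) (Set.Ioo 0 τ)).encard ≤
      (zerosOn (combination ψ s c μ k) (Set.Ioc 0 τ)).encard :=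
    Set.encard_le_encard (zerosOn_mono _ Set.Ioo_subset_Ioc_self)
  have hcount := add_one_le_of_step
    (N := fun k => (zerosOn (combination ψ s c μ k) (Set.Ioo 0 τ)).encard)
    (Set.one_le_encard_iff_nonempty.2 ⟨t, ⟨ht0, htτ⟩, hzero⟩)
    (fun k hk => S.encard_zerosOn_combination_add_one_le_succ s c μ hτ0 (h0 k hk) (h0' k))
    (fun k _ => (hIoc k).trans (S.encard_zerosOn_Ioc_combination_le_succ s c μ hτ0 (h0' k)))
  have hlower := S.le_encard_zerosOn_of_forall_combination hM hcM hμM hμ (q := n + 1)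
    fun k hk => (hcount k hk).trans (hIoc k)
  have hupper := S.encard_zerosOn_Ioc_le hμM hτ
  exact (Nat.lt_succ_self n).not_ge (by exact_mod_cast hlower.trans hupper)

end SturmFamily

/-! ### The Jacobi functions form a Sturm–Liouville family -/

theorem hasDerivAt_weight (α β : ℝ) {t : ℝ} (ht : 0 < t) :
    HasDerivAt (weight α β) (drift α β t * weight α β t) t := by
  have hs := Real.sinh_pos_iff.2 ht
  have hc := Real.cosh_pos t
  have hsinh := (Real.hasDerivAt_sinh t).rpow_const (p := 2 * α + 1) (Or.inl hs.ne')
  have hcosh := (Real.hasDerivAt_cosh t).rpow_const (p := 2 * β + 1) (Or.inl hc.ne')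
  refine ((hsinh.const_mul ((2 : ℝ) ^ (2 * (α + β + 1)))).mul hcosh).congr_deriv ?_
  rw [drift, weight, add_sub_cancel_right, add_sub_cancel_right, Real.rpow_add hs,
    Real.rpow_add hc, Real.rpow_one, Real.rpow_one]
  field_simp

theorem weight_pos (α β : ℝ) {t : ℝ} (ht : 0 < t) : 0 < weight α β t := by
  have := Real.sinh_pos_iff.2 ht
  unfold weight
  positivity

theorem analyticAt_weight (α β : ℝ) {t : ℝ} (ht : 0 < t) : AnalyticAt ℝ (weight α β) t := by
  have hsinh : AnalyticAt ℝ (fun t => Real.sinh t ^ (2 * α + 1)) t :=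
    (Real.contDiff_sinh.contDiffAt.rpow_const_of_ne (Real.sinh_pos_iff.2 ht).ne').analyticAt
  have hcosh : AnalyticAt ℝ (fun t => Real.cosh t ^ (2 * β + 1)) t :=
    (Real.contDiff_cosh.contDiffAt.rpow_const_of_ne (Real.cosh_pos t).ne').analyticAt
  exact (analyticAt_const.mul hsinh).mul hcosh

theorem continuous_weight {α β : ℝ} (hα : -1 / 2 ≤ α) (hβ : -1 / 2 ≤ β) :
    Continuous (weight α β) := by
  have hsinh : Continuous fun t => Real.sinh t ^ (2 * α + 1) :=
    Real.continuous_sinh.rpow_const fun _ => Or.inr (by linarith)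
  have hcosh : Continuous fun t => Real.cosh t ^ (2 * β + 1) :=
    Real.continuous_cosh.rpow_const fun _ => Or.inr (by linarith)
  exact (continuous_const.mul hsinh).mul hcosh

theorem weight_zero {α : ℝ} (β : ℝ) (hα : -1 / 2 < α) : weight α β 0 = 0 := by
  simp [weight, Real.zero_rpow (show 2 * α + 1 ≠ 0 by linarith)]

section Quotient

variable {α β : ℝ} (hρ : 0 < α + β + 1) (hβα : β < α + 1)
include hρ hβα

theorem jacobiPhi_zero_mul_jacobiPsi (l t : ℝ) :
    jacobiPhi α β 0 t * jacobiPsi α β l t = jacobiPhi α β l t :=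
  mul_div_cancel₀ _ (jacobiPhi_zero_pos hρ hβα t).ne'

theorem jacobiPsi_eq_zero_iff (l t : ℝ) : jacobiPsi α β l t = 0 ↔ jacobiPhi α β l t = 0 := by
  simp [jacobiPsi, (jacobiPhi_zero_pos hρ hβα t).ne']

theorem hasDerivAt_jacobiPsi (l t : ℝ) : HasDerivAt (jacobiPsi α β l)
    ((deriv (jacobiPhi α β l) t * jacobiPhi α β 0 t - jacobiPhi α β l t *
      deriv (jacobiPhi α β 0) t) / jacobiPhi α β 0 t ^ 2) t :=
  (hasDerivAt_jacobiPhi α β l t).div (hasDerivAt_jacobiPhi α β 0 t)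
    (jacobiPhi_zero_pos hρ hβα t).ne'

theorem hasDerivAt_weight_mul_deriv_jacobiPsi (hα : -1 < α) (l : ℝ) {t : ℝ} (ht : 0 < t) :
    HasDerivAt (fun s => weight α β s * jacobiPhi α β 0 s ^ 2 * deriv (jacobiPsi α β l) s)
      (-l ^ 2 * (weight α β t * jacobiPhi α β 0 t ^ 2) * jacobiPsi α β l t) t := by
  have hwronskian : (fun s => weight α β s * jacobiPhi α β 0 s ^ 2 * deriv (jacobiPsi α β l) s) =
      fun s => weight α β s * (deriv (jacobiPhi α β l) s * jacobiPhi α β 0 s -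
        jacobiPhi α β l s * deriv (jacobiPhi α β 0) s) := by
    funext s
    have := (jacobiPhi_zero_pos hρ hβα s).ne'
    rw [(hasDerivAt_jacobiPsi hρ hβα l s).deriv]
    field_simp
  rw [hwronskian]
  refine ((hasDerivAt_weight α β ht).mul
    (((jacobiPhi_ode β hα l ht).mul (hasDerivAt_jacobiPhi α β 0 t)).sub
      ((hasDerivAt_jacobiPhi α β l t).mul (jacobiPhi_ode β hα 0 ht)))).congr_deriv ?_
  have := (jacobiPhi_zero_pos hρ hβα t).ne'
  simp only [jacobiPsi, Pi.mul_apply, Pi.sub_apply]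
  field_simp
  ring

end Quotient

section Parameters

variable {α β : ℝ} (hβ : -1 / 2 ≤ β) (hβα : β < α + 1) (hα : -1 / 2 < α)
include hβ hβα hα

theorem continuous_uncurry_jacobiPsi : Continuous (Function.uncurry (jacobiPsi α β)) := by
  have hφ₀ : Continuous fun p : ℝ × ℝ => jacobiPhi α β 0 p.2 :=
    (continuous_jacobiPhi α β 0).comp continuous_snd
  exact (continuous_uncurry_jacobiPhi hβ hα).div hφ₀ fun p =>
    (jacobiPhi_zero_pos (by linarith) hβα p.2).ne'

theorem continuous_uncurry_deriv_jacobiPsi :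
    Continuous (Function.uncurry fun l => deriv (jacobiPsi α β l)) := by
  have hφ := continuous_uncurry_jacobiPhi hβ hα
  have hφ' := continuous_uncurry_deriv_jacobiPhi hβ hα
  have hφ₀ : Continuous fun p : ℝ × ℝ => jacobiPhi α β 0 p.2 :=
    (continuous_jacobiPhi α β 0).comp continuous_snd
  have hφ₀' : Continuous fun p : ℝ × ℝ => deriv (jacobiPhi α β 0) p.2 :=
    (continuous_deriv_jacobiPhi α β 0).comp continuous_snd
  refine (((hφ'.mul hφ₀).sub (hφ.mul hφ₀')).div (hφ₀.pow 2) fun p =>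
    (pow_pos (jacobiPhi_zero_pos (by linarith) hβα p.2) 2).ne').congr fun p => ?_
  exact (hasDerivAt_jacobiPsi (by linarith) hβα p.1 p.2).deriv.symm

theorem jacobiPsi_ne_zero_or_deriv_ne_zero (l : ℝ) {t : ℝ} (ht : 0 < t) :
    jacobiPsi α β l t ≠ 0 ∨ deriv (jacobiPsi α β l) t ≠ 0 := by
  have hρ : 0 < α + β + 1 := by linarith
  have hφ₀ := (jacobiPhi_zero_pos hρ hβα t).ne'
  rw [(hasDerivAt_jacobiPsi hρ hβα l t).deriv, Ne, jacobiPsi_eq_zero_iff hρ hβα]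
  by_cases hzero : jacobiPhi α β l t = 0
  · have hφ' := (jacobiPhi_ne_zero_or_deriv_ne_zero hβ hα l ht).resolve_left (by simp [hzero])
    exact Or.inr (by simp [hzero, hφ₀, hφ'])
  · exact Or.inl hzero

theorem sturmFamily_jacobiPsi :
    SturmFamily (fun t => weight α β t * jacobiPhi α β 0 t ^ 2) (jacobiPsi α β) :=
  have hρ : 0 < α + β + 1 := by linarith
  have hpos := jacobiPhi_zero_pos hρ hβα
  { continuous_weight := (continuous_weight hα.le hβ).mul ((continuous_jacobiPhi α β 0).pow 2)
    weight_zero := by simp [weight_zero β hα]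
    weight_pos := fun t ht => mul_pos (weight_pos α β ht) (pow_pos (hpos t) 2)
    analyticAt_weight := fun t ht =>
      (analyticAt_weight α β ht).mul ((analyticAt_jacobiPhi α β 0 t).pow 2)
    analyticAt := fun l t =>
      (analyticAt_jacobiPhi α β l t).div (analyticAt_jacobiPhi α β 0 t) (hpos t).ne'
    continuous_uncurry := continuous_uncurry_jacobiPsi hβ hβα hα
    continuous_uncurry_deriv := continuous_uncurry_deriv_jacobiPsi hβ hβα hα
    ode := fun l _ ht => hasDerivAt_weight_mul_deriv_jacobiPsi hρ hβα (by linarith) l ht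
    zero_right := fun l => by simp [jacobiPsi, jacobiPhi_zero_right]
    zero_left := fun t => div_self (hpos t).ne'
    ne_zero_or := fun l _ ht => jacobiPsi_ne_zero_or_deriv_ne_zero hβ hβα hα l ht
    exists_zero_gt := fun l hl T => by
      obtain ⟨t, ht, hzero⟩ := exists_jacobiPhi_eq_zero_gt β (by linarith : -1 < α) hl T
      exact ⟨t, ht, (jacobiPsi_eq_zero_iff hρ hβα l t).2 hzero⟩ }

end Parameters

/-! ### Partial fractions -/

section PartialFractions

variable {z : ℕ → ℝ} {m : ℕ}

theorem prod_sub_eq_neg_one_pow_mul {ι R : Type*} [CommRing R] (s : Finset ι) (v : ι → R) (x : R) :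
    ∏ j ∈ s, (v j - x) = (-1) ^ s.card * ∏ j ∈ s, (x - v j) := by
  rw [← Finset.prod_const, ← Finset.prod_mul_distrib]
  exact Finset.prod_congr rfl fun j _ => by ring

theorem sum_pfCoeff_mul_pow (hz : Set.InjOn (fun i => z i ^ 2) (Finset.Icc 1 m)) {k : ℕ}
    (hk : k < m) : ∑ i ∈ Finset.Icc 1 m, pfCoeff z m i * (z i ^ 2) ^ k =
      (-1) ^ (m - 1) * (∏ j ∈ Finset.Icc 1 m, z j ^ 2) * if k = m - 1 then 1 else 0 := by
  have hcard : (Finset.Icc 1 m).card = m := by simp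
  have hlagrange := Lagrange.coeff_eq_sum hz (P := (Polynomial.X : Polynomial ℝ) ^ k)
    (by rw [Polynomial.degree_X_pow, hcard]; exact_mod_cast hk)
  simp only [hcard, Polynomial.coeff_X_pow, eq_comm (a := m - 1)] at hlagrange
  rw [hlagrange, Finset.mul_sum]
  refine Finset.sum_congr rfl fun i hi => ?_
  rw [pfCoeff, prod_sub_eq_neg_one_pow_mul, Finset.card_erase_of_mem hi, hcard,
    Polynomial.eval_pow, Polynomial.eval_X]
  have hne : ∏ j ∈ (Finset.Icc 1 m).erase i, (z i ^ 2 - z j ^ 2) ≠ 0 :=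
    Finset.prod_ne_zero_iff.2 fun j hj => sub_ne_zero.2 fun heq =>
      Finset.ne_of_mem_erase hj (hz (Finset.mem_of_mem_erase hj) hi heq.symm)
  have hsq : ((-1 : ℝ) ^ (m - 1)) ^ 2 = 1 := by rw [← pow_mul, mul_comm, pow_mul]; norm_num
  have hpow : ((-1 : ℝ) ^ (m - 1)) ≠ 0 := pow_ne_zero _ (by norm_num)
  field_simp
  rw [hsq, mul_one]

theorem sum_pfCoeff_div (hm : 1 ≤ m) (hz0 : ∀ i ∈ Finset.Icc 1 m, z i ≠ 0)
    (hz : Set.InjOn (fun i => z i ^ 2) (Finset.Icc 1 m)) :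
    ∑ i ∈ Finset.Icc 1 m, pfCoeff z m i / z i ^ 2 = 1 := by
  have hbasis := congrArg (Polynomial.eval 0) (Lagrange.sum_basis hz ⟨1, by simpa using hm⟩)
  rw [Polynomial.eval_finsetSum, Polynomial.eval_one] at hbasis
  rw [← hbasis]
  refine Finset.sum_congr rfl fun i hi => ?_
  rw [Lagrange.basis, Polynomial.eval_prod, pfCoeff, ← Finset.mul_prod_erase _ _ hi, div_div,
    mul_comm _ (z i ^ 2), mul_div_mul_left _ _ (pow_ne_zero 2 (hz0 i hi)),
    ← Finset.prod_div_distrib]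
  refine Finset.prod_congr rfl fun j hj => ?_
  have hne : z i ^ 2 - z j ^ 2 ≠ 0 := sub_ne_zero.2 fun heq =>
    Finset.ne_of_mem_erase hj (hz (Finset.mem_of_mem_erase hj) hi heq.symm)
  have hne' : z j ^ 2 - z i ^ 2 ≠ 0 := by rw [← neg_sub]; exact neg_ne_zero.2 hne
  simp only [Lagrange.basisDivisor, Polynomial.eval_mul, Polynomial.eval_C, Polynomial.eval_sub,
    Polynomial.eval_X]
  field_simp
  ring

theorem neg_one_pow_mul_pfCoeff_pos (hz0 : ∀ i ∈ Finset.Icc 1 m, 0 < z i)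
    (hz : StrictMonoOn z (Finset.Icc 1 m)) {i : ℕ} (hi : i ∈ Finset.Icc 1 m) :
    0 < (-1) ^ (i - 1) * pfCoeff z m i := by
  obtain ⟨hi1, him⟩ := Finset.mem_Icc.1 hi
  have hsplit : (Finset.Icc 1 m).erase i = Finset.Ico 1 i ∪ Finset.Ioc i m := by
    ext j
    simp only [Finset.mem_erase, Finset.mem_Icc, Finset.mem_union, Finset.mem_Ico, Finset.mem_Ioc]
    omega
  have hdisj : Disjoint (Finset.Ico 1 i) (Finset.Ioc i m) :=
    Finset.disjoint_left.2 fun j hj hj' =>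
      (Finset.mem_Ico.1 hj).2.asymm (Finset.mem_Ioc.1 hj').1
  have hsq_lt : ∀ j ∈ Finset.Icc 1 m, ∀ k ∈ Finset.Icc 1 m, j < k → 0 < z k ^ 2 - z j ^ 2 :=
    fun j hj k hk hjk => sub_pos.2 (pow_lt_pow_left₀ (hz hj hk hjk) (hz0 j hj).le two_ne_zero)
  have hbelow : 0 < ∏ j ∈ Finset.Ico 1 i, (z i ^ 2 - z j ^ 2) := Finset.prod_pos fun j hj => by
    rw [Finset.mem_Ico] at hj
    exact hsq_lt j (Finset.mem_Icc.2 ⟨hj.1, by omega⟩) i hi hj.2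
  have habove : 0 < ∏ j ∈ Finset.Ioc i m, (z j ^ 2 - z i ^ 2) := Finset.prod_pos fun j hj => by
    rw [Finset.mem_Ioc] at hj
    exact hsq_lt i hi j (Finset.mem_Icc.2 ⟨by omega, hj.2⟩) hj.1
  have hnum : 0 < ∏ j ∈ Finset.Icc 1 m, z j ^ 2 :=
    Finset.prod_pos fun j hj => pow_pos (hz0 j hj) 2
  have hpow : ((-1 : ℝ) ^ (i - 1)) ≠ 0 := pow_ne_zero _ (by norm_num)
  rw [pfCoeff, hsplit, Finset.prod_union hdisj, prod_sub_eq_neg_one_pow_mul (Finset.Ico 1 i),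
    Nat.card_Ico, mul_assoc, ← mul_div_assoc, mul_div_mul_left _ _ hpow]
  positivity

end PartialFractions

/-! ### The radial and angular measures -/

theorem hasDerivAt_setIntegral {X : Type*} [TopologicalSpace X] [MeasurableSpace X]
    [OpensMeasurableSpace X] [T2Space X] {ν : Measure X}
    [IsFiniteMeasure ν] {K : Set X} (hK : IsCompact K) {F F' : ℝ → X → ℝ}
    (hF : Continuous (Function.uncurry F)) (hF' : Continuous (Function.uncurry F'))
    (hd : ∀ x a, HasDerivAt (fun x => F x a) (F' x a) x) (x₀ : ℝ) :
    HasDerivAt (fun x => ∫ a in K, F x a ∂ν) (∫ a in K, F' x₀ a ∂ν) x₀ := by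
  have hFx : ∀ x, Continuous (F x) := fun x =>
    hF.comp (by fun_prop : Continuous fun a : X => (x, a))
  have hFx' : ∀ x, Continuous (F' x) := fun x =>
    hF'.comp (by fun_prop : Continuous fun a : X => (x, a))
  obtain ⟨C, hC⟩ := ((isCompact_closedBall x₀ (1 : ℝ)).prod hK).exists_bound_of_continuousOn
    hF'.continuousOn
  refine (hasDerivAt_integral_of_dominated_loc_of_deriv_le (bound := fun _ => C)
    (Metric.closedBall_mem_nhds x₀ one_pos) (Eventually.of_forall fun x =>
      (hFx x).aestronglyMeasurable) ((hFx x₀).continuousOn.integrableOn_compact hK)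
    (hFx' x₀).aestronglyMeasurable ?_ (integrable_const C) ?_).2
  · refine (ae_restrict_iff' hK.measurableSet).2 (Eventually.of_forall fun a ha x hx => ?_)
    exact hC (x, a) ⟨hx, ha⟩
  · exact Eventually.of_forall fun a x _ => hd x a

theorem exists_measure_of_density {W : ℝ → ℝ} {a b : ℝ} (hab : a ≤ b) (hWm : Measurable W)
    (hW0 : ∀ x ∈ Set.Ioc a b, 0 ≤ W x) (hWi : IntervalIntegrable W volume a b) :
    ∃ ν : Measure ℝ, IsFiniteMeasure ν ∧
      ∀ h : ℝ → ℝ, ∫ x in Set.Icc a b, h x ∂ν = ∫ x in a..b, h x * W x := by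
  have hWi' : Integrable W (volume.restrict (Set.Ioc a b)) :=
    (intervalIntegrable_iff_integrableOn_Ioc_of_le hab).1 hWi
  refine ⟨(volume.restrict (Set.Ioc a b)).withDensity fun x => ENNReal.ofReal (W x), ?_, ?_⟩
  · exact isFiniteMeasure_withDensity_ofReal hWi'.2
  · intro h
    have hrestrict : ((volume.restrict (Set.Ioc a b)).withDensity
        fun x => ENNReal.ofReal (W x)).restrict (Set.Icc a b) =
          (volume.restrict (Set.Ioc a b)).withDensity fun x => ENNReal.ofReal (W x) := by
      rw [restrict_withDensity measurableSet_Icc, Measure.restrict_restrict measurableSet_Icc,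
        Set.inter_eq_self_of_subset_right Set.Ioc_subset_Icc_self]
    rw [hrestrict, integral_withDensity_eq_integral_toReal_smul hWm.ennreal_ofReal
      (Eventually.of_forall fun _ => ENNReal.ofReal_lt_top), intervalIntegral.integral_of_le hab]
    refine setIntegral_congr_fun measurableSet_Ioc fun x hx => ?_
    rw [smul_eq_mul, ENNReal.toReal_ofReal (hW0 x hx), mul_comm]

theorem intervalIntegrable_radial_density {p q : ℝ} (hp : -1 < p) (hq : 0 ≤ q) :
    IntervalIntegrable (fun r : ℝ => (1 - r ^ 2) ^ p * r ^ q) volume 0 1 := by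
  have hsingular : IntervalIntegrable (fun r : ℝ => (1 - r) ^ p) volume 0 1 := by
    simpa using ((intervalIntegral.intervalIntegrable_rpow' (a := 0) (b := 1)
      hp).comp_sub_left 1).symm
  have hregular : ContinuousOn (fun r : ℝ => (1 + r) ^ p * r ^ q) (Set.uIcc 0 1) := by
    rw [Set.uIcc_of_le zero_le_one]
    refine ContinuousOn.mul ?_ (continuousOn_id.rpow_const fun r _ => Or.inr hq)
    exact (continuousOn_const.add continuousOn_id).rpow_const fun r hr =>
      Or.inl (ne_of_gt (show (0 : ℝ) < 1 + r by linarith [hr.1]))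
  refine (hsingular.mul_continuousOn hregular).congr fun r hr => ?_
  rw [Set.uIoc_of_le zero_le_one] at hr
  rw [← mul_assoc, ← Real.mul_rpow (by linarith [hr.2]) (by linarith [hr.1])]
  congr 2
  ring

theorem sin_rpow_le {p χ : ℝ} (hχ : χ ∈ Set.Ioc 0 (Real.pi / 2)) :
    Real.sin χ ^ p ≤ 1 + (2 / Real.pi) ^ p * χ ^ p := by
  have hsin : 0 < Real.sin χ :=
    Real.sin_pos_of_pos_of_lt_pi hχ.1 (by linarith [hχ.2, Real.pi_pos])
  have hlinear : 0 < 2 / Real.pi * χ := mul_pos (by positivity) hχ.1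
  rw [← Real.mul_rpow (by positivity) hχ.1.le]
  rcases le_total 0 p with hp | hp
  · linarith [Real.rpow_le_one hsin.le (Real.sin_le_one χ) hp, Real.rpow_nonneg hlinear.le p]
  · linarith [Real.rpow_le_rpow_of_nonpos hlinear (Real.mul_le_sin hχ.1.le hχ.2) hp]

theorem intervalIntegrable_angular_density {p : ℝ} (hp : -1 < p) :
    IntervalIntegrable (fun χ : ℝ => Real.sin χ ^ p) volume 0 Real.pi := by
  have hleft : IntervalIntegrable (fun χ : ℝ => Real.sin χ ^ p) volume 0 (Real.pi / 2) := by
    have hbound : IntervalIntegrable (fun χ : ℝ => 1 + (2 / Real.pi) ^ p * χ ^ p) volume 0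
        (Real.pi / 2) :=
      intervalIntegrable_const.add ((intervalIntegral.intervalIntegrable_rpow' hp).const_mul _)
    refine hbound.mono_fun' (Real.measurable_sin.pow_const p).aestronglyMeasurable ?_
    refine (ae_restrict_iff' measurableSet_uIoc).2 (Eventually.of_forall fun χ hχ => ?_)
    rw [Set.uIoc_of_le (by positivity)] at hχ
    have hsin : 0 ≤ Real.sin χ :=
      Real.sin_nonneg_of_nonneg_of_le_pi hχ.1.le (by linarith [hχ.2, Real.pi_pos])
    exact (Real.norm_of_nonneg (Real.rpow_nonneg hsin p)).trans_le (sin_rpow_le hχ)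
  have hright : IntervalIntegrable (fun χ : ℝ => Real.sin χ ^ p) volume (Real.pi / 2) Real.pi := by
    simpa only [Real.sin_pi_sub, sub_zero, sub_half] using (hleft.comp_sub_left Real.pi).symm
  exact hleft.trans hright

theorem hasDerivAt_radial_primitive {κ D : ℝ → ℝ} {p q r κ' : ℝ} (hr : r ∈ Set.Ioo (0 : ℝ) 1)
    (hκ : HasDerivAt κ κ' r) (hD : q * κ r = r * D r) :
    HasDerivAt (fun r => (1 - r ^ 2) ^ (p + 1) * r ^ q * κ r)
      (((1 - r ^ 2) * (κ' + D r) - 2 * (p + 1) * r * κ r) * ((1 - r ^ 2) ^ p * r ^ q)) r := by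
  have hr0 : r ≠ 0 := hr.1.ne'
  have hr1 : 0 < 1 - r ^ 2 := by nlinarith [hr.1, hr.2]
  have hquad : HasDerivAt (fun r : ℝ => 1 - r ^ 2) (-(2 * r)) r := by
    simpa using (hasDerivAt_pow 2 r).const_sub 1
  refine (((hquad.rpow_const (p := p + 1) (Or.inl hr1.ne')).mul
    ((hasDerivAt_id r).rpow_const (p := q) (Or.inl hr0))).mul hκ).congr_deriv ?_
  have hDr : D r = q * κ r / r := by rw [hD, mul_div_cancel_left₀ _ hr0]
  simp only [Pi.mul_apply, id, add_sub_cancel_right]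
  rw [hDr, Real.rpow_add_one hr1.ne', Real.rpow_sub_one hr0]
  field_simp
  ring

theorem integral_radial_by_parts {κ κ' D : ℝ → ℝ} {p q : ℝ} (hp : -1 < p) (hq : 0 ≤ q)
    (hκ' : Continuous κ') (hD : Continuous D) (hκ : ∀ r, HasDerivAt κ (κ' r) r) (hκ0 : κ 0 = 0)
    (hκD : ∀ r ∈ Set.Ioo (0 : ℝ) 1, q * κ r = r * D r) :
    ∫ r in (0 : ℝ)..1, ((1 - r ^ 2) * (κ' r + D r) - 2 * (p + 1) * r * κ r) *
      ((1 - r ^ 2) ^ p * r ^ q) = 0 := by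
  have hκc : Continuous κ := continuous_iff_continuousAt.2 fun r => (hκ r).continuousAt
  have hp0 : p + 1 ≠ 0 := by linarith
  have hprimitive : Continuous fun r : ℝ => (1 - r ^ 2) ^ (p + 1) * r ^ q * κ r :=
    (((continuous_const.sub (continuous_pow 2)).rpow_const fun _ => Or.inr (by linarith)).mul
      (continuous_id.rpow_const fun _ => Or.inr hq)).mul hκc
  rw [intervalIntegral.integral_eq_sub_of_hasDerivAt_of_le zero_le_one hprimitive.continuousOn
    fun r hr => hasDerivAt_radial_primitive hr (hκ r) (hκD r hr)]
  · simp [hκ0, Real.zero_rpow hp0]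
  · exact (intervalIntegrable_radial_density hp hq).continuousOn_mul (by fun_prop)

theorem integral_angular_by_parts {k k' : ℝ → ℝ} {p : ℝ} (hp : -1 < p) (hk' : Continuous k')
    (hk : ∀ χ, HasDerivAt k (k' χ) χ) :
    ∫ χ in (0 : ℝ)..Real.pi, (Real.sin χ * k' χ + (p + 1) * Real.cos χ * k χ) *
      Real.sin χ ^ p = 0 := by
  have hkc : Continuous k := continuous_iff_continuousAt.2 fun χ => (hk χ).continuousAt
  have hp0 : p + 1 ≠ 0 := by linarith
  have hprimitive : Continuous fun χ => Real.sin χ ^ (p + 1) * k χ :=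
    (Real.continuous_sin.rpow_const fun _ => Or.inr (by linarith)).mul hkc
  rw [intervalIntegral.integral_eq_sub_of_hasDerivAt_of_le Real.pi_pos.le hprimitive.continuousOn
    fun χ hχ => ?_]
  · simp [Real.zero_rpow hp0]
  · exact (intervalIntegrable_angular_density hp).continuousOn_mul (by fun_prop)
  · have hsin := Real.sin_pos_of_pos_of_lt_pi hχ.1 hχ.2
    refine (((Real.hasDerivAt_sin χ).rpow_const (p := p + 1) (Or.inl hsin.ne')).mul
      (hk χ)).congr_deriv ?_
    rw [add_sub_cancel_right, Real.rpow_add_one hsin.ne']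
    ring

/-- `ν` represents `radialMean α β` and integrates by parts on `[0, 1]` like the density
`(1 - r²)^(α-β-1) r^(2β+1)`, without boundary terms. The function `D` plays the role of
`(2β+1) κ r / r`, so that no division by `r = 0` occurs; for `α = β` the condition still makes sense
and holds for the unit mass at `1`. -/
structure IsRadialMeasure (α β : ℝ) (ν : Measure ℝ) : Prop where
  radialMean_eq (h : ℝ → ℝ) : radialMean α β h = ∫ r in Set.Icc 0 1, h r ∂ν
  by_parts {κ κ' D : ℝ → ℝ} (hκ' : Continuous κ') (hD : Continuous D)
    (hκ : ∀ r, HasDerivAt κ (κ' r) r) (hκ0 : κ 0 = 0)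
    (hκD : ∀ r ∈ Set.Ioo (0 : ℝ) 1, (2 * β + 1) * κ r = r * D r) :
    ∫ r in Set.Icc 0 1, ((1 - r ^ 2) * (κ' r + D r) - 2 * (α - β) * r * κ r) ∂ν = 0

/-- `ν` represents `angularMean β` and integrates by parts on `[0, π]` like the density
`(sin χ)^(2β)`, without boundary terms. For `β = -1/2`, where `integral_cos` does not follow from
`by_parts`, both hold for equal masses at `0` and `π`. -/
structure IsAngularMeasure (β : ℝ) (ν : Measure ℝ) : Prop where
  angularMean_eq (h : ℝ → ℝ) : angularMean β h = ∫ χ in Set.Icc 0 Real.pi, h χ ∂ν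
  by_parts {k k' : ℝ → ℝ} (hk' : Continuous k') (hk : ∀ χ, HasDerivAt k (k' χ) χ) :
    ∫ χ in Set.Icc 0 Real.pi, (Real.sin χ * k' χ + (2 * β + 1) * Real.cos χ * k χ) ∂ν = 0
  integral_cos : ∫ χ in Set.Icc 0 Real.pi, Real.cos χ ∂ν = 0

theorem restrict_dirac_of_mem {X : Type*} [MeasurableSpace X] {x : X} {s : Set X}
    (hs : MeasurableSet s) (hx : x ∈ s) : (Measure.dirac x).restrict s = Measure.dirac x :=
  Measure.restrict_eq_self_of_ae_mem ((ae_dirac_iff hs).2 hx)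

theorem isRadialMeasure_dirac_one (α : ℝ) : IsRadialMeasure α α (Measure.dirac 1) := by
  have hrestrict : (Measure.dirac (1 : ℝ)).restrict (Set.Icc 0 1) = Measure.dirac 1 :=
    restrict_dirac_of_mem measurableSet_Icc (by simp)
  constructor
  · intro h
    rw [radialMean, if_pos rfl, hrestrict, integral_dirac]
  · intros
    rw [hrestrict, integral_dirac]
    ring

theorem exists_isRadialMeasure {α β : ℝ} (hβ : -1 / 2 ≤ β) (hβα : β ≤ α) :
    ∃ ν : Measure ℝ, IsFiniteMeasure ν ∧ IsRadialMeasure α β ν := by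
  rcases hβα.eq_or_lt with rfl | hlt
  · exact ⟨Measure.dirac 1, inferInstance, isRadialMeasure_dirac_one β⟩
  set K := 2 * Real.Gamma (α + 1) / (Real.Gamma (β + 1) * Real.Gamma (α - β))
  have hK : 0 ≤ K := by
    have := Real.Gamma_pos_of_pos (show 0 < α + 1 by linarith)
    have := Real.Gamma_pos_of_pos (show 0 < β + 1 by linarith)
    have := Real.Gamma_pos_of_pos (show 0 < α - β by linarith)
    positivity
  obtain ⟨ν, hν, hνint⟩ := exists_measure_of_density zero_le_one
    (W := fun r => K * ((1 - r ^ 2) ^ (α - β - 1) * r ^ (2 * β + 1))) (by fun_prop)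
    (fun r hr => mul_nonneg hK (mul_nonneg (Real.rpow_nonneg (by nlinarith [hr.1, hr.2]) _)
      (Real.rpow_nonneg hr.1.le _)))
    ((intervalIntegrable_radial_density (by linarith) (by linarith)).const_mul K)
  simp only [mul_left_comm _ K, intervalIntegral.integral_const_mul] at hνint
  refine ⟨ν, hν, fun h => ?_, fun {κ κ' D} hκ' hD hκ hκ0 hκD => ?_⟩
  · rw [radialMean, if_neg hlt.ne', hνint]
  · have hparts := integral_radial_by_parts (p := α - β - 1) (by linarith) (by linarith) hκ' hD hκ
      hκ0 hκD
    rw [sub_add_cancel] at hparts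
    rw [hνint, hparts, mul_zero]

theorem setIntegral_smul_dirac_add_dirac {X : Type*} [MeasurableSpace X]
    [MeasurableSingletonClass X] {x y : X} {s : Set X} (hs : MeasurableSet s) (hx : x ∈ s)
    (hy : y ∈ s) {c : ℝ≥0∞} (f : X → ℝ) :
    ∫ z in s, f z ∂(c • (Measure.dirac x + Measure.dirac y)) = c.toReal * (f x + f y) := by
  rw [Measure.restrict_smul, Measure.restrict_add, restrict_dirac_of_mem hs hx,
    restrict_dirac_of_mem hs hy, integral_smul_measure, smul_eq_mul,
    integral_add_measure (integrable_dirac (by simp)) (integrable_dirac (by simp)),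
    integral_dirac, integral_dirac]

theorem isAngularMeasure_dirac_add_dirac : IsAngularMeasure (-1 / 2)
    ((2 : ℝ≥0∞)⁻¹ • (Measure.dirac 0 + Measure.dirac Real.pi)) := by
  have hint := setIntegral_smul_dirac_add_dirac (c := (2 : ℝ≥0∞)⁻¹) (measurableSet_Icc (α := ℝ))
    (Set.left_mem_Icc.2 Real.pi_pos.le) (Set.right_mem_Icc.2 Real.pi_pos.le)
  constructor
  · intro h
    rw [angularMean, if_pos rfl, hint]
    norm_num
    ring
  · intros
    rw [hint]
    norm_num
  · rw [hint]
    simp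

theorem exists_isAngularMeasure {β : ℝ} (hβ : -1 / 2 ≤ β) :
    ∃ ν : Measure ℝ, IsFiniteMeasure ν ∧ IsAngularMeasure β ν := by
  rcases hβ.eq_or_lt with rfl | hlt
  · exact ⟨_, Measure.smul_finite _ (by simp), isAngularMeasure_dirac_add_dirac⟩
  set K := Real.Gamma (β + 1) / (Real.Gamma (1 / 2) * Real.Gamma (β + 1 / 2))
  have hK : 0 ≤ K := by
    have := Real.Gamma_pos_of_pos (show 0 < β + 1 by linarith)
    have := Real.Gamma_pos_of_pos (show (0 : ℝ) < 1 / 2 by norm_num)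
    have := Real.Gamma_pos_of_pos (show 0 < β + 1 / 2 by linarith)
    positivity
  obtain ⟨ν, hν, hνint⟩ := exists_measure_of_density Real.pi_pos.le
    (W := fun χ => K * Real.sin χ ^ (2 * β)) (by fun_prop)
    (fun χ hχ => mul_nonneg hK
      (Real.rpow_nonneg (Real.sin_nonneg_of_nonneg_of_le_pi hχ.1.le hχ.2) _))
    ((intervalIntegrable_angular_density (by linarith)).const_mul K)
  simp only [mul_left_comm _ K, intervalIntegral.integral_const_mul] at hνint
  have hparts : ∀ {k k' : ℝ → ℝ}, Continuous k' → (∀ χ, HasDerivAt k (k' χ) χ) →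
      ∫ χ in Set.Icc 0 Real.pi, (Real.sin χ * k' χ + (2 * β + 1) * Real.cos χ * k χ) ∂ν = 0 :=
    fun hk' hk => by rw [hνint, integral_angular_by_parts (by linarith) hk' hk, mul_zero]
  refine ⟨ν, hν, fun h => ?_, hparts, ?_⟩
  · rw [angularMean, if_neg hlt.ne', hνint]
  · have hconst := hparts continuous_const fun χ => hasDerivAt_const χ 1
    simp only [mul_zero, zero_add, mul_one] at hconst
    rw [integral_const_mul] at hconst
    exact (mul_eq_zero.1 hconst).resolve_left (by linarith)

/-! ### Flux identities on the parameter rectangle -/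

/-- The range of the parameters `(r, χ)` of the generalized translation. -/
abbrev rectangle : Set (ℝ × ℝ) := Set.Icc 0 1 ×ˢ Set.Icc 0 Real.pi

theorem isCompact_rectangle : IsCompact rectangle := isCompact_Icc.prod isCompact_Icc

/-- The squared modulus of `a + r e^{iχ} b`. -/
noncomputable def modSq (a b r χ : ℝ) : ℝ := a ^ 2 + 2 * a * b * r * Real.cos χ + b ^ 2 * r ^ 2

section Flux

variable {α β : ℝ} {ν ν' : Measure ℝ} {g g' : ℝ → ℝ} (a b : ℝ)

theorem hasDerivAt_modSq_angle (r χ : ℝ) :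
    HasDerivAt (modSq a b r) (-(2 * a * b * r * Real.sin χ)) χ :=
  ((((Real.hasDerivAt_cos χ).const_mul (2 * a * b * r)).const_add (a ^ 2)).add_const
    (b ^ 2 * r ^ 2)).congr_deriv (by ring)

theorem hasDerivAt_modSq_radius (r χ : ℝ) :
    HasDerivAt (fun r => modSq a b r χ) (2 * a * b * Real.cos χ + 2 * b ^ 2 * r) r := by
  refine (((((hasDerivAt_id r).const_mul (2 * a * b)).mul_const (Real.cos χ)).const_add
    (a ^ 2)).add ((hasDerivAt_pow 2 r).const_mul (b ^ 2))).congr_deriv ?_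
  push_cast
  ring

theorem continuous_modSq : Continuous fun p : ℝ × ℝ => modSq a b p.1 p.2 := by
  unfold modSq
  fun_prop

/-- The integrand left by integrating `g (modSq a b r χ)` by parts in `χ`. -/
noncomputable def angularFlux (β a b : ℝ) (g g' : ℝ → ℝ) (p : ℝ × ℝ) : ℝ :=
  p.1 * (Real.sin p.2 * (g' (modSq a b p.1 p.2) * -(2 * a * b * p.1 * Real.sin p.2)) +
    (2 * β + 1) * Real.cos p.2 * g (modSq a b p.1 p.2))

/-- The integrand left by integrating `r * g (modSq a b r χ)` by parts in `r`. -/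
noncomputable def radialFlux (α β a b : ℝ) (g g' : ℝ → ℝ) (p : ℝ × ℝ) : ℝ :=
  (1 - p.1 ^ 2) * p.1 * (g' (modSq a b p.1 p.2) * (2 * a * b * Real.cos p.2 + 2 * b ^ 2 * p.1)) +
    ((2 * β + 2) * (1 - p.1 ^ 2) - 2 * (α - β) * p.1 ^ 2) * g (modSq a b p.1 p.2)

/-- The integrand left by integrating the `χ`-average of `cos χ * g (modSq a b r χ)` by parts in
`r`. -/
noncomputable def horizontalFlux (α β a b : ℝ) (g g' : ℝ → ℝ) (p : ℝ × ℝ) : ℝ :=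
  (1 - p.1 ^ 2) * (g' (modSq a b p.1 p.2) * (2 * a * b + 2 * b ^ 2 * p.1 * Real.cos p.2)) -
    2 * (α - β) * p.1 * Real.cos p.2 * g (modSq a b p.1 p.2)

theorem continuous_angularFlux (β : ℝ) (hg : Continuous g) (hg' : Continuous g') :
    Continuous (angularFlux β a b g g') := by
  have := continuous_modSq a b
  unfold angularFlux
  fun_prop

theorem continuous_radialFlux (α β : ℝ) (hg : Continuous g) (hg' : Continuous g') :
    Continuous (radialFlux α β a b g g') := by
  have := continuous_modSq a b
  unfold radialFlux
  fun_prop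

theorem continuous_horizontalFlux (α β : ℝ) (hg : Continuous g) (hg' : Continuous g') :
    Continuous (horizontalFlux α β a b g g') := by
  have := continuous_modSq a b
  unfold horizontalFlux
  fun_prop

variable (hg' : Continuous g') (hd : ∀ y, HasDerivAt g (g' y) y)
include hg' hd

theorem setIntegral_angular_flux (hν' : IsAngularMeasure β ν') (r : ℝ) :
    ∫ χ in Set.Icc 0 Real.pi, (Real.sin χ * (g' (modSq a b r χ) * -(2 * a * b * r * Real.sin χ)) +
      (2 * β + 1) * Real.cos χ * g (modSq a b r χ)) ∂ν' = 0 := by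
  have hmod : Continuous (modSq a b r) :=
    (continuous_modSq a b).comp (by fun_prop : Continuous fun χ : ℝ => (r, χ))
  exact hν'.by_parts (k := fun χ => g (modSq a b r χ)) (by fun_prop) fun χ =>
    (hd _).comp χ (hasDerivAt_modSq_angle a b r χ)

variable [IsFiniteMeasure ν']

theorem mul_setIntegral_cos_mul_modSq (hν' : IsAngularMeasure β ν') (r : ℝ) :
    (2 * β + 1) * ∫ χ in Set.Icc 0 Real.pi, Real.cos χ * g (modSq a b r χ) ∂ν' =
      r * ∫ χ in Set.Icc 0 Real.pi, 2 * a * b * Real.sin χ ^ 2 * g' (modSq a b r χ) ∂ν' := by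
  have hmod : Continuous (modSq a b r) :=
    (continuous_modSq a b).comp (by fun_prop : Continuous fun χ : ℝ => (r, χ))
  have hg : Continuous g := continuous_iff_continuousAt.2 fun y => (hd y).continuousAt
  have hcos : IntegrableOn (fun χ => Real.cos χ * g (modSq a b r χ)) (Set.Icc 0 Real.pi) ν' :=
    ContinuousOn.integrableOn_compact isCompact_Icc (by fun_prop)
  have hsin : IntegrableOn (fun χ => 2 * a * b * Real.sin χ ^ 2 * g' (modSq a b r χ))
      (Set.Icc 0 Real.pi) ν' := ContinuousOn.integrableOn_compact isCompact_Icc (by fun_prop)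
  rw [← sub_eq_zero, ← integral_const_mul, ← integral_const_mul,
    ← integral_sub (hcos.const_mul _) (hsin.const_mul _)]
  refine Eq.trans (setIntegral_congr_fun measurableSet_Icc fun χ _ => ?_)
    (setIntegral_angular_flux a b hg' hd hν' r)
  ring

theorem hasDerivAt_setIntegral_cos_mul_modSq (r : ℝ) :
    HasDerivAt (fun r => ∫ χ in Set.Icc 0 Real.pi, Real.cos χ * g (modSq a b r χ) ∂ν')
      (∫ χ in Set.Icc 0 Real.pi, Real.cos χ *
        (g' (modSq a b r χ) * (2 * a * b * Real.cos χ + 2 * b ^ 2 * r)) ∂ν') r := by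
  have hmod := continuous_modSq a b
  have hg : Continuous g := continuous_iff_continuousAt.2 fun y => (hd y).continuousAt
  refine hasDerivAt_setIntegral isCompact_Icc (F := fun r χ => Real.cos χ * g (modSq a b r χ))
    (F' := fun r χ => Real.cos χ * (g' (modSq a b r χ) * (2 * a * b * Real.cos χ + 2 * b ^ 2 * r)))
    ?_ ?_ (fun r χ => ((hd _).comp r (hasDerivAt_modSq_radius a b r χ)).const_mul _) r
  all_goals
    simp only [Function.uncurry_def]
    fun_prop

variable [IsFiniteMeasure ν]

theorem integral_angularFlux (hν' : IsAngularMeasure β ν') :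
    ∫ p in rectangle, angularFlux β a b g g' p ∂(ν.prod ν') = 0 := by
  have hg : Continuous g := continuous_iff_continuousAt.2 fun y => (hd y).continuousAt
  rw [setIntegral_prod _ ((continuous_angularFlux a b β hg hg').continuousOn.integrableOn_compact
    isCompact_rectangle)]
  simp only [angularFlux, integral_const_mul, setIntegral_angular_flux a b hg' hd hν', mul_zero,
    integral_zero]

theorem integral_radialFlux (hν : IsRadialMeasure α β ν) :
    ∫ p in rectangle, radialFlux α β a b g g' p ∂(ν.prod ν') = 0 := by
  have hg : Continuous g := continuous_iff_continuousAt.2 fun y => (hd y).continuousAt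
  have hint : IntegrableOn (radialFlux α β a b g g') rectangle (ν.prod ν') :=
    (continuous_radialFlux a b α β hg hg').continuousOn.integrableOn_compact isCompact_rectangle
  rw [IntegrableOn, ← Measure.prod_restrict] at hint
  have hinner : ∀ χ : ℝ, ∫ r in Set.Icc 0 1, radialFlux α β a b g g' (r, χ) ∂ν = 0 := by
    intro χ
    have hmod : Continuous fun r => modSq a b r χ :=
      (continuous_modSq a b).comp (by fun_prop : Continuous fun r : ℝ => (r, χ))
    refine Eq.trans (setIntegral_congr_fun measurableSet_Icc fun r _ => ?_)
      (hν.by_parts (κ := fun r => r * g (modSq a b r χ))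
        (κ' := fun r => g (modSq a b r χ) +
          r * (g' (modSq a b r χ) * (2 * a * b * Real.cos χ + 2 * b ^ 2 * r)))
        (D := fun r => (2 * β + 1) * g (modSq a b r χ)) (by fun_prop) (by fun_prop)
        (fun r => ((hasDerivAt_id r).mul ((hd _).comp r
          (hasDerivAt_modSq_radius a b r χ))).congr_deriv (by simp))
        (zero_mul _) (fun r _ => by ring))
    simp only [radialFlux]
    ring
  rw [← Measure.prod_restrict, integral_prod_symm _ hint]
  simp only [hinner, integral_zero]

theorem setIntegral_horizontalFlux (r : ℝ) :
    ∫ χ in Set.Icc 0 Real.pi, horizontalFlux α β a b g g' (r, χ) ∂ν' =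
      (1 - r ^ 2) * (∫ χ in Set.Icc 0 Real.pi, Real.cos χ *
          (g' (modSq a b r χ) * (2 * a * b * Real.cos χ + 2 * b ^ 2 * r)) ∂ν' +
        ∫ χ in Set.Icc 0 Real.pi, 2 * a * b * Real.sin χ ^ 2 * g' (modSq a b r χ) ∂ν') -
      2 * (α - β) * r * ∫ χ in Set.Icc 0 Real.pi, Real.cos χ * g (modSq a b r χ) ∂ν' := by
  have hmod : Continuous (modSq a b r) :=
    (continuous_modSq a b).comp (by fun_prop : Continuous fun χ : ℝ => (r, χ))
  have hg : Continuous g := continuous_iff_continuousAt.2 fun y => (hd y).continuousAt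
  have hint : ∀ {f : ℝ → ℝ}, Continuous f → IntegrableOn f (Set.Icc 0 Real.pi) ν' :=
    fun hf => hf.continuousOn.integrableOn_compact isCompact_Icc
  rw [← integral_add (hint (by fun_prop)) (hint (by fun_prop)), ← integral_const_mul,
    ← integral_const_mul, ← integral_sub (hint (by fun_prop)) (hint (by fun_prop))]
  refine setIntegral_congr_fun measurableSet_Icc fun χ _ => ?_
  simp only [horizontalFlux]
  linear_combination -((1 - r ^ 2) * g' (modSq a b r χ) * (2 * a * b)) * Real.sin_sq_add_cos_sq χ

theorem integral_horizontalFlux (hν : IsRadialMeasure α β ν) (hν' : IsAngularMeasure β ν') :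
    ∫ p in rectangle, horizontalFlux α β a b g g' p ∂(ν.prod ν') = 0 := by
  have hmod := continuous_modSq a b
  have hg : Continuous g := continuous_iff_continuousAt.2 fun y => (hd y).continuousAt
  rw [setIntegral_prod _ ((continuous_horizontalFlux a b α β hg
    hg').continuousOn.integrableOn_compact isCompact_rectangle)]
  simp only [setIntegral_horizontalFlux a b hg' hd]
  refine hν.by_parts (continuous_parametric_integral_of_continuous ?_ isCompact_Icc)
    (continuous_parametric_integral_of_continuous ?_ isCompact_Icc)
    (hasDerivAt_setIntegral_cos_mul_modSq a b hg' hd) ?_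
    fun r _ => mul_setIntegral_cos_mul_modSq a b hg' hd hν' r
  · simp only [Function.uncurry_def]
    fun_prop
  · simp only [Function.uncurry_def]
    fun_prop
  · simp only [modSq, mul_zero, zero_mul, add_zero, ne_eq, OfNat.ofNat_ne_zero,
      not_false_eq_true, zero_pow]
    rw [integral_mul_const, hν'.integral_cos, zero_mul]

end Flux

/-! ### The product formula -/

section ProductFormula

/-- `|cosh t cosh x + r e^{iχ} sinh t sinh x|²` at `p = (r, χ)`: the value of `cosh² u` at the point
`u` at which `T^t g (x)` evaluates `g`. -/
noncomputable def transArg (t x : ℝ) (p : ℝ × ℝ) : ℝ :=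
  modSq (Real.cosh t * Real.cosh x) (Real.sinh t * Real.sinh x) p.1 p.2

/-- The first derivative of `transArg t x p` in `x`. -/
noncomputable def transArgDeriv (t x : ℝ) (p : ℝ × ℝ) : ℝ :=
  2 * Real.cosh t ^ 2 * (Real.cosh x * Real.sinh x) +
    2 * Real.cosh t * Real.sinh t * (Real.sinh x ^ 2 + Real.cosh x ^ 2) * p.1 * Real.cos p.2 +
    2 * Real.sinh t ^ 2 * (Real.cosh x * Real.sinh x) * p.1 ^ 2

/-- The second derivative of `transArg t x p` in `x`. -/
noncomputable def transArgDerivDeriv (t x : ℝ) (p : ℝ × ℝ) : ℝ :=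
  2 * Real.cosh t ^ 2 * (Real.sinh x ^ 2 + Real.cosh x ^ 2) +
    8 * Real.cosh t * Real.sinh t * (Real.cosh x * Real.sinh x) * p.1 * Real.cos p.2 +
    2 * Real.sinh t ^ 2 * (Real.sinh x ^ 2 + Real.cosh x ^ 2) * p.1 ^ 2

theorem continuous_transArg (t : ℝ) : Continuous fun q : ℝ × ℝ × ℝ => transArg t q.1 q.2 := by
  unfold transArg modSq
  fun_prop

theorem continuous_transArgDeriv (t : ℝ) :
    Continuous fun q : ℝ × ℝ × ℝ => transArgDeriv t q.1 q.2 := by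
  unfold transArgDeriv
  fun_prop

theorem continuous_transArgDerivDeriv (t : ℝ) :
    Continuous fun q : ℝ × ℝ × ℝ => transArgDerivDeriv t q.1 q.2 := by
  unfold transArgDerivDeriv
  fun_prop

theorem hasDerivAt_transArg (t x : ℝ) (p : ℝ × ℝ) :
    HasDerivAt (fun x => transArg t x p) (transArgDeriv t x p) x := by
  have hcosh := (Real.hasDerivAt_cosh x).const_mul (Real.cosh t)
  have hsinh := (Real.hasDerivAt_sinh x).const_mul (Real.sinh t)
  refine (((hcosh.pow 2).add ((((hcosh.const_mul 2).mul hsinh).mul_const p.1).mul_const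
    (Real.cos p.2))).add ((hsinh.pow 2).mul_const (p.1 ^ 2))).congr_deriv ?_
  simp only [transArgDeriv]
  push_cast
  ring

theorem hasDerivAt_transArgDeriv (t x : ℝ) (p : ℝ × ℝ) :
    HasDerivAt (fun x => transArgDeriv t x p) (transArgDerivDeriv t x p) x := by
  have hcosh := Real.hasDerivAt_cosh x
  have hsinh := Real.hasDerivAt_sinh x
  refine ((((hcosh.mul hsinh).const_mul (2 * Real.cosh t ^ 2)).add
    (((((hsinh.pow 2).add (hcosh.pow 2)).const_mul (2 * Real.cosh t * Real.sinh t)).mul_const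
      p.1).mul_const (Real.cos p.2))).add
    (((hcosh.mul hsinh).const_mul (2 * Real.sinh t ^ 2)).mul_const (p.1 ^ 2))).congr_deriv ?_
  simp only [transArgDerivDeriv]
  push_cast
  ring

theorem one_le_transArg (t x : ℝ) {p : ℝ × ℝ} (hp : p.1 ∈ Set.Icc (0 : ℝ) 1) :
    1 ≤ transArg t x p := by
  obtain ⟨r, χ⟩ := p
  have hsub := Real.one_le_cosh (t - x)
  have hadd := Real.one_le_cosh (t + x)
  rw [Real.cosh_sub] at hsub
  rw [Real.cosh_add] at hadd
  have ha : 0 < Real.cosh t * Real.cosh x := mul_pos (Real.cosh_pos t) (Real.cosh_pos x)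
  simp only [transArg, modSq]
  generalize Real.cosh t * Real.cosh x = a at *
  generalize Real.sinh t * Real.sinh x = b at *
  have hab : |b| ≤ a - 1 := abs_le.2 ⟨by linarith, by linarith⟩
  have hcos : -|b| ≤ b * Real.cos χ := by
    refine neg_le_of_abs_le ?_
    rw [abs_mul]
    exact mul_le_of_le_one_right (abs_nonneg b) (Real.abs_cos_le_one χ)
  have hbr : |b| * r ≤ |b| := mul_le_of_le_one_right (abs_nonneg b) hp.2
  have hcross : 0 ≤ a * r * (b * Real.cos χ + |b|) :=
    mul_nonneg (mul_nonneg ha.le hp.1) (by linarith)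
  calc 1 ≤ (a - |b| * r) ^ 2 := by nlinarith
    _ ≤ a ^ 2 + 2 * a * b * r * Real.cos χ + b ^ 2 * r ^ 2 := by nlinarith [sq_abs b]

theorem transArgDeriv_sq_sub (t : ℝ) {x : ℝ} (hx : Real.sinh x ≠ 0) (p : ℝ × ℝ) :
    transArgDeriv t x p ^ 2 - 4 * transArg t x p * (transArg t x p - 1) =
      2 * Real.cosh t * Real.sinh t * (Real.cosh x / Real.sinh x - Real.sinh x / Real.cosh x) *
        (p.1 * (Real.sin p.2 * -(2 * (Real.cosh t * Real.cosh x) * (Real.sinh t * Real.sinh x) *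
          p.1 * Real.sin p.2))) +
      -2 * Real.sinh t ^ 2 * ((1 - p.1 ^ 2) * p.1 * (2 * (Real.cosh t * Real.cosh x) *
        (Real.sinh t * Real.sinh x) * Real.cos p.2 + 2 * (Real.sinh t * Real.sinh x) ^ 2 * p.1)) +
      -(2 * Real.cosh t * Real.sinh t * Real.cosh x / Real.sinh x) * ((1 - p.1 ^ 2) *
        (2 * (Real.cosh t * Real.cosh x) * (Real.sinh t * Real.sinh x) +
          2 * (Real.sinh t * Real.sinh x) ^ 2 * p.1 * Real.cos p.2)) := by
  have hcosh := (Real.cosh_pos x).ne'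
  have ht := Real.cosh_sq t
  have hxx := Real.cosh_sq x
  have hp := Real.sin_sq_add_cos_sq p.2
  simp only [transArgDeriv, transArg, modSq]
  generalize Real.cosh t = c at *
  generalize Real.sinh t = s at *
  generalize Real.cosh x = C at *
  generalize Real.sinh x = S at *
  generalize Real.cos p.2 = k at *
  generalize Real.sin p.2 = z at *
  field_simp
  grind

theorem transArgDerivDeriv_add (α β t : ℝ) {x : ℝ} (hx : Real.sinh x ≠ 0) (p : ℝ × ℝ) :
    transArgDerivDeriv t x p + drift α β x * transArgDeriv t x p -
        4 * ((α + β + 2) * transArg t x p - (β + 1)) =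
      2 * Real.cosh t * Real.sinh t * (Real.cosh x / Real.sinh x - Real.sinh x / Real.cosh x) *
        (p.1 * ((2 * β + 1) * Real.cos p.2)) +
      -2 * Real.sinh t ^ 2 * ((2 * β + 2) * (1 - p.1 ^ 2) - 2 * (α - β) * p.1 ^ 2) +
      -(2 * Real.cosh t * Real.sinh t * Real.cosh x / Real.sinh x) *
        -(2 * (α - β) * p.1 * Real.cos p.2) := by
  have hcosh := (Real.cosh_pos x).ne'
  have ht := Real.cosh_sq t
  have hxx := Real.cosh_sq x
  simp only [transArgDerivDeriv, transArgDeriv, transArg, modSq, drift]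
  generalize Real.cosh t = c at *
  generalize Real.sinh t = s at *
  generalize Real.cosh x = C at *
  generalize Real.sinh x = S at *
  field_simp
  grind

theorem jacobiOperator_transArg_sub (α β t : ℝ) (P₁ P₂ : ℝ → ℝ) {x : ℝ} (hx : Real.sinh x ≠ 0)
    (p : ℝ × ℝ) :
    P₂ (transArg t x p) * transArgDeriv t x p * transArgDeriv t x p +
        P₁ (transArg t x p) * transArgDerivDeriv t x p +
        drift α β x * (P₁ (transArg t x p) * transArgDeriv t x p) -
      4 * (transArg t x p * (transArg t x p - 1) * P₂ (transArg t x p) +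
        ((α + β + 2) * transArg t x p - (β + 1)) * P₁ (transArg t x p)) =
      2 * Real.cosh t * Real.sinh t * (Real.cosh x / Real.sinh x - Real.sinh x / Real.cosh x) *
        angularFlux β (Real.cosh t * Real.cosh x) (Real.sinh t * Real.sinh x) P₁ P₂ p +
      -2 * Real.sinh t ^ 2 *
        radialFlux α β (Real.cosh t * Real.cosh x) (Real.sinh t * Real.sinh x) P₁ P₂ p +
      -(2 * Real.cosh t * Real.sinh t * Real.cosh x / Real.sinh x) *
        horizontalFlux α β (Real.cosh t * Real.cosh x) (Real.sinh t * Real.sinh x) P₁ P₂ p := by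
  have hsecond := transArgDeriv_sq_sub t hx p
  have hfirst := transArgDerivDeriv_add α β t hx p
  simp only [angularFlux, radialFlux, horizontalFlux]
  rw [← transArg]
  linear_combination P₂ (transArg t x p) * hsecond + P₁ (transArg t x p) * hfirst

theorem integral_linear_combination {X : Type*} [MeasurableSpace X] {μ : Measure X}
    {f g h : X → ℝ} (hf : Integrable f μ) (hg : Integrable g μ) (hh : Integrable h μ)
    (a b c : ℝ) :
    ∫ x, (a * f x + b * g x + c * h x) ∂μ =
      a * ∫ x, f x ∂μ + b * ∫ x, g x ∂μ + c * ∫ x, h x ∂μ := by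
  have hfg : Integrable (fun x => a * f x + b * g x) μ := (hf.const_mul a).add (hg.const_mul b)
  rw [integral_add hfg (hh.const_mul c), integral_add (hf.const_mul a) (hg.const_mul b),
    integral_const_mul, integral_const_mul, integral_const_mul]

variable {α β l : ℝ} {P P₁ P₂ : ℝ → ℝ} {ν ν' : Measure ℝ} [IsFiniteMeasure ν] [IsFiniteMeasure ν']

theorem integral_jacobiOperator_transArg (hν : IsRadialMeasure α β ν)
    (hν' : IsAngularMeasure β ν') (t : ℝ) {x : ℝ} (hx : Real.sinh x ≠ 0) (hP₂ : Continuous P₂)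
    (hP₁ : ∀ y, HasDerivAt P₁ (P₂ y) y) :
    ∫ p in rectangle, (P₂ (transArg t x p) * transArgDeriv t x p * transArgDeriv t x p +
        P₁ (transArg t x p) * transArgDerivDeriv t x p +
        drift α β x * (P₁ (transArg t x p) * transArgDeriv t x p) -
      4 * (transArg t x p * (transArg t x p - 1) * P₂ (transArg t x p) +
        ((α + β + 2) * transArg t x p - (β + 1)) * P₁ (transArg t x p))) ∂(ν.prod ν') = 0 := by
  have hc₁ : Continuous P₁ := continuous_iff_continuousAt.2 fun y => (hP₁ y).continuousAt
  have hint : ∀ {f : ℝ × ℝ → ℝ}, Continuous f → IntegrableOn f rectangle (ν.prod ν') :=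
    fun hf => hf.continuousOn.integrableOn_compact isCompact_rectangle
  simp only [jacobiOperator_transArg_sub α β t P₁ P₂ hx]
  rw [integral_linear_combination (hint (continuous_angularFlux _ _ β hc₁ hP₂))
      (hint (continuous_radialFlux _ _ α β hc₁ hP₂))
      (hint (continuous_horizontalFlux _ _ α β hc₁ hP₂)),
    integral_angularFlux _ _ hP₂ hP₁ hν', integral_radialFlux _ _ hP₂ hP₁ hν,
    integral_horizontalFlux _ _ hP₂ hP₁ hν hν']
  ring

/-- `P` is a `C²` function on the whole line, with derivatives `P₁` and `P₂`, that extends the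
radial form of the Jacobi function from `[1, ∞)`. -/
structure IsRadialExtension (α β l : ℝ) (P P₁ P₂ : ℝ → ℝ) : Prop where
  hasDerivAt (y : ℝ) : HasDerivAt P (P₁ y) y
  hasDerivAt_deriv (y : ℝ) : HasDerivAt P₁ (P₂ y) y
  continuous_deriv_deriv : Continuous P₂
  eq_radialPhi {y : ℝ} (hy : 1 ≤ y) : P y = radialPhi α β l y
  ode {y : ℝ} (hy : 1 ≤ y) : y * (y - 1) * P₂ y + ((α + β + 2) * y - (β + 1)) * P₁ y +
    (l ^ 2 + (α + β + 1) ^ 2) / 4 * P y = 0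

theorem IsRadialExtension.continuous (hP : IsRadialExtension α β l P P₁ P₂) : Continuous P :=
  continuous_iff_continuousAt.2 fun y => (hP.hasDerivAt y).continuousAt

theorem IsRadialExtension.continuous_deriv (hP : IsRadialExtension α β l P P₁ P₂) :
    Continuous P₁ :=
  continuous_iff_continuousAt.2 fun y => (hP.hasDerivAt_deriv y).continuousAt

theorem exists_hasDerivAt_eqOn_Ici {f g : ℝ → ℝ} {a : ℝ} (hg : Continuous g)
    (hf : ∀ y, a ≤ y → HasDerivAt f (g y) y) :
    ∃ F : ℝ → ℝ, (∀ y, HasDerivAt F (g y) y) ∧ ∀ y, a ≤ y → F y = f y := by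
  refine ⟨fun y => f a + ∫ u in a..y, g u, fun y =>
    (intervalIntegral.integral_hasDerivAt_right (hg.intervalIntegrable a y)
      (hg.stronglyMeasurableAtFilter _ _) hg.continuousAt).const_add _, fun y hy => ?_⟩
  have hFTC := intervalIntegral.integral_eq_sub_of_hasDerivAt (a := a) (b := y)
    (fun u hu => hf u (by rw [Set.uIcc_of_le hy] at hu; exact hu.1)) (hg.intervalIntegrable a y)
  linarith

theorem exists_isRadialExtension (β : ℝ) (hα : -1 < α) (l : ℝ) :
    ∃ P P₁ P₂, IsRadialExtension α β l P P₁ P₂ := by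
  have han : ∀ y, 1 ≤ y → AnalyticAt ℝ (radialPhi α β l) y := fun y hy =>
    analyticAt_radialPhi α β l (by linarith)
  have hc₂ : Continuous fun y => deriv (deriv (radialPhi α β l)) (max y 1) :=
    continuous_iff_continuousAt.2 fun y => ContinuousAt.comp (f := fun y : ℝ => max y 1)
      (han _ (le_max_right y 1)).deriv.deriv.continuousAt (by fun_prop)
  obtain ⟨P₁, hP₁, heq₁⟩ := exists_hasDerivAt_eqOn_Ici (f := deriv (radialPhi α β l)) (a := 1) hc₂
    fun y hy => by
      rw [max_eq_left hy]
      exact (han y hy).deriv.differentiableAt.hasDerivAt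
  obtain ⟨P, hP, heq⟩ := exists_hasDerivAt_eqOn_Ici (f := radialPhi α β l) (a := 1)
    (continuous_iff_continuousAt.2 fun y => (hP₁ y).continuousAt) fun y hy => by
      rw [heq₁ y hy]
      exact (han y hy).differentiableAt.hasDerivAt
  refine ⟨P, P₁, _, hP, hP₁, hc₂, fun hy => heq _ hy, fun {y} hy => ?_⟩
  rw [heq y hy, heq₁ y hy, max_eq_left hy]
  exact radialPhi_ode β hα l (by linarith)

section

variable {ω : Measure (ℝ × ℝ)} [IsFiniteMeasure ω]

theorem hasDerivAt_integral_comp_transArg (hP₁ : Continuous P₁) (hP : ∀ y, HasDerivAt P (P₁ y) y)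
    (t x : ℝ) :
    HasDerivAt (fun x => ∫ p in rectangle, P (transArg t x p) ∂ω)
      (∫ p in rectangle, P₁ (transArg t x p) * transArgDeriv t x p ∂ω) x := by
  have hc : Continuous P := continuous_iff_continuousAt.2 fun y => (hP y).continuousAt
  exact hasDerivAt_setIntegral (F := fun x p => P (transArg t x p))
    (F' := fun x p => P₁ (transArg t x p) * transArgDeriv t x p) isCompact_rectangle
    (hc.comp (continuous_transArg t))
    ((hP₁.comp (continuous_transArg t)).mul (continuous_transArgDeriv t))
    (fun x p => (hP _).comp x (hasDerivAt_transArg t x p)) x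

theorem hasDerivAt_integral_comp_transArg_mul (hP₂ : Continuous P₂)
    (hP₁ : ∀ y, HasDerivAt P₁ (P₂ y) y) (t x : ℝ) :
    HasDerivAt (fun x => ∫ p in rectangle, P₁ (transArg t x p) * transArgDeriv t x p ∂ω)
      (∫ p in rectangle, (P₂ (transArg t x p) * transArgDeriv t x p * transArgDeriv t x p +
        P₁ (transArg t x p) * transArgDerivDeriv t x p) ∂ω) x := by
  have hc₁ : Continuous P₁ := continuous_iff_continuousAt.2 fun y => (hP₁ y).continuousAt
  have harg := continuous_transArg t
  have harg' := continuous_transArgDeriv t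
  exact hasDerivAt_setIntegral (F := fun x p => P₁ (transArg t x p) * transArgDeriv t x p)
    (F' := fun x p => P₂ (transArg t x p) * transArgDeriv t x p * transArgDeriv t x p +
        P₁ (transArg t x p) * transArgDerivDeriv t x p) isCompact_rectangle
    ((hc₁.comp harg).mul harg')
    ((((hP₂.comp harg).mul harg').mul harg').add
      ((hc₁.comp harg).mul (continuous_transArgDerivDeriv t)))
    (fun x p => ((hP₁ _).comp x (hasDerivAt_transArg t x p)).mul (hasDerivAt_transArgDeriv t x p)) x

end

theorem integral_comp_transArg_ode (hν : IsRadialMeasure α β ν) (hν' : IsAngularMeasure β ν')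
    (hP : IsRadialExtension α β l P P₁ P₂) (t : ℝ) {x : ℝ} (hx : 0 < x) :
    HasDerivAt (fun x => ∫ p in rectangle, P₁ (transArg t x p) * transArgDeriv t x p ∂(ν.prod ν'))
      (-drift α β x * ∫ p in rectangle, P₁ (transArg t x p) * transArgDeriv t x p ∂(ν.prod ν') -
        (l ^ 2 + (α + β + 1) ^ 2) * ∫ p in rectangle, P (transArg t x p) ∂(ν.prod ν')) x := by
  refine (hasDerivAt_integral_comp_transArg_mul hP.continuous_deriv_deriv hP.hasDerivAt_deriv t
    x).congr_deriv ?_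
  have hint : ∀ {f : ℝ × ℝ → ℝ}, Continuous f → IntegrableOn f rectangle (ν.prod ν') :=
    fun hf => hf.continuousOn.integrableOn_compact isCompact_rectangle
  have harg : Continuous (transArg t x) := (continuous_transArg t).uncurry_left x
  have harg' : Continuous (transArgDeriv t x) := (continuous_transArgDeriv t).uncurry_left x
  have harg'' : Continuous (transArgDerivDeriv t x) :=
    (continuous_transArgDerivDeriv t).uncurry_left x
  have hc₀ := hP.continuous
  have hc₁ := hP.continuous_deriv
  have hc₂ := hP.continuous_deriv_deriv
  have hcombination := integral_linear_combination
    (hint (f := fun p => P₂ (transArg t x p) * transArgDeriv t x p * transArgDeriv t x p +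
      P₁ (transArg t x p) * transArgDerivDeriv t x p) (by fun_prop))
    (hint (f := fun p => P₁ (transArg t x p) * transArgDeriv t x p) (by fun_prop))
    (hint (f := fun p => P (transArg t x p)) (by fun_prop))
    1 (drift α β x) (l ^ 2 + (α + β + 1) ^ 2)
  have hvanish := hcombination.symm.trans
    ((setIntegral_congr_fun isCompact_rectangle.measurableSet fun p hp => by
      linear_combination 4 * hP.ode (one_le_transArg t x hp.1)).trans
    (integral_jacobiOperator_transArg hν hν' t (Real.sinh_pos_iff.2 hx).ne' hc₂
      hP.hasDerivAt_deriv))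
  linarith

theorem transArg_zero (t : ℝ) (p : ℝ × ℝ) : transArg t 0 p = Real.cosh t ^ 2 := by
  simp [transArg, modSq]

omit [IsFiniteMeasure ν] [IsFiniteMeasure ν'] in
theorem integral_comp_transArg_zero (hP : IsRadialExtension α β l P P₁ P₂) (t : ℝ) :
    ∫ p in rectangle, P (transArg t 0 p) ∂(ν.prod ν') =
      (ν.prod ν').real rectangle * jacobiPhi α β l t := by
  simp only [transArg_zero, setIntegral_const, smul_eq_mul]
  rw [hP.eq_radialPhi (by nlinarith [Real.one_le_cosh t]), jacobiPhi_eq_radialPhi]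

theorem integral_comp_transArg_mul_zero (hν' : IsAngularMeasure β ν') (P₁ : ℝ → ℝ) (t : ℝ) :
    ∫ p in rectangle, P₁ (transArg t 0 p) * transArgDeriv t 0 p ∂(ν.prod ν') = 0 := by
  have hcos : ∫ p in rectangle, p.1 * Real.cos p.2 ∂(ν.prod ν') = 0 := by
    rw [setIntegral_prod_mul (fun r : ℝ => r) (fun χ : ℝ => Real.cos χ), hν'.integral_cos,
      mul_zero]
  calc ∫ p in rectangle, P₁ (transArg t 0 p) * transArgDeriv t 0 p ∂(ν.prod ν')
      = ∫ p in rectangle, P₁ (Real.cosh t ^ 2) * (2 * Real.cosh t * Real.sinh t) *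
          (p.1 * Real.cos p.2) ∂(ν.prod ν') := by
        simp only [transArg_zero, transArgDeriv, Real.cosh_zero, Real.sinh_zero]
        exact integral_congr_ae (Eventually.of_forall fun p => by ring)
    _ = 0 := by rw [integral_const_mul, hcos, mul_zero]

theorem eq_zero_of_initial_data_eq_zero {q u u' : ℝ → ℝ} {κ T : ℝ} (hκ : 0 < κ) (hT : 0 ≤ T)
    (hq : ∀ t ∈ Set.Ioo 0 T, 0 ≤ q t) (hu : ContinuousOn u (Set.Icc 0 T))
    (hu' : ContinuousOn u' (Set.Icc 0 T)) (hd : ∀ t ∈ Set.Ioo 0 T, HasDerivAt u (u' t) t)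
    (hd' : ∀ t ∈ Set.Ioo 0 T, HasDerivAt u' (-q t * u' t - κ * u t) t)
    (hu0 : u 0 = 0) (hu'0 : u' 0 = 0) : u T = 0 := by
  have henergy := energy_le_mul_exp (f := 0) (δ := 0) hκ.le hq (by simp) hu hu' hd
    (by simpa using hd') (Set.right_mem_Icc.2 hT)
  rw [hu0, hu'0] at henergy
  have hsq : κ * u T ^ 2 ≤ 0 := by nlinarith [sq_nonneg (u' T)]
  exact pow_eq_zero_iff two_ne_zero |>.1
    (le_antisymm (nonpos_of_mul_nonpos_right hsq hκ) (sq_nonneg _))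

/-- Both sides solve the Jacobi equation in `x`, with the same value and slope at `x = 0`. -/
theorem integral_comp_transArg (hβ : -1 / 2 ≤ β) (hα : -1 / 2 < α) (hν : IsRadialMeasure α β ν)
    (hν' : IsAngularMeasure β ν') (hP : IsRadialExtension α β l P P₁ P₂) (t : ℝ) {x : ℝ}
    (hx : 0 ≤ x) :
    ∫ p in rectangle, P (transArg t x p) ∂(ν.prod ν') =
      (ν.prod ν').real rectangle * jacobiPhi α β l t * jacobiPhi α β l x := by
  set M := (ν.prod ν').real rectangle * jacobiPhi α β l t
  set U : ℝ → ℝ := fun x => ∫ p in rectangle, P (transArg t x p) ∂(ν.prod ν')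
  set U' : ℝ → ℝ := fun x =>
    ∫ p in rectangle, P₁ (transArg t x p) * transArgDeriv t x p ∂(ν.prod ν')
  have hU : ∀ x, HasDerivAt U (U' x) x :=
    hasDerivAt_integral_comp_transArg hP.continuous_deriv hP.hasDerivAt t
  have hUc : Continuous U := continuous_iff_continuousAt.2 fun x => (hU x).continuousAt
  have hUc' : Continuous U' := continuous_iff_continuousAt.2 fun x =>
    (hasDerivAt_integral_comp_transArg_mul hP.continuous_deriv_deriv
      hP.hasDerivAt_deriv t x).continuousAt
  have hφ := continuous_jacobiPhi α β l
  have hφ' := continuous_deriv_jacobiPhi α β l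
  refine sub_eq_zero.1 (eq_zero_of_initial_data_eq_zero
    (u := fun x => U x - M * jacobiPhi α β l x)
    (u' := fun x => U' x - M * deriv (jacobiPhi α β l) x)
    (jacobiEigenvalue_pos (by linarith : 0 < α + β + 1) l) hx
    (fun u hu => drift_nonneg hβ hα.le hu.1) (by fun_prop) (by fun_prop)
    (fun u _ => (hU u).sub ((hasDerivAt_jacobiPhi α β l u).const_mul _))
    (fun u hu => ((integral_comp_transArg_ode hν hν' hP t hu.1).sub
      ((jacobiPhi_ode β (by linarith) l hu.1).const_mul _)).congr_deriv (by ring)) ?_ ?_)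
  · simp only [U, M, integral_comp_transArg_zero hP, jacobiPhi_zero_right, mul_one, sub_self]
  · simp only [U', integral_comp_transArg_mul_zero hν', deriv_jacobiPhi_zero_right, mul_zero,
      sub_self]

end ProductFormula

/-! ### Nonnegative combinations of Jacobi functions -/

section PosDef

variable {ι : Type*} {α β : ℝ}

theorem norm_add_mul_exp_sq (a b r χ : ℝ) :
    ‖(a : ℂ) + (r : ℂ) * Complex.exp (Complex.I * χ) * (b : ℂ)‖ ^ 2 = modSq a b r χ := by
  rw [mul_comm Complex.I, Complex.exp_mul_I, ← Complex.normSq_eq_norm_sq, Complex.normSq_apply,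
    ← Complex.ofReal_cos, ← Complex.ofReal_sin]
  simp only [Complex.add_re, Complex.mul_re, Complex.ofReal_re, Complex.ofReal_im, Complex.add_im,
    Complex.mul_im, Complex.I_re, Complex.I_im, modSq]
  linear_combination b ^ 2 * r ^ 2 * Real.sin_sq_add_cos_sq χ

theorem jacobiPhi_arcosh_norm (α β l t x : ℝ) {p : ℝ × ℝ} (hp : p.1 ∈ Set.Icc (0 : ℝ) 1) :
    jacobiPhi α β l (Real.arcosh ‖((Real.cosh t * Real.cosh x : ℝ) : ℂ) +
      (p.1 : ℂ) * Complex.exp (Complex.I * p.2) * ((Real.sinh t * Real.sinh x : ℝ) : ℂ)‖) =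
    radialPhi α β l (transArg t x p) := by
  have hone := one_le_transArg t x hp
  rw [transArg, ← norm_add_mul_exp_sq] at hone ⊢
  rw [jacobiPhi_eq_radialPhi, Real.cosh_arcosh ((one_le_sq_iff₀ (norm_nonneg _)).1 hone)]

section Translation

variable {ν ν' : Measure ℝ} [IsFiniteMeasure ν] [IsFiniteMeasure ν']

theorem translation_eq_setIntegral (hν : IsRadialMeasure α β ν) (hν' : IsAngularMeasure β ν')
    {t x : ℝ} {g : ℝ → ℝ} {F : ℝ × ℝ → ℝ} (hF : Continuous F)
    (hgF : ∀ p : ℝ × ℝ, p.1 ∈ Set.Icc (0 : ℝ) 1 →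
      g (Real.arcosh ‖((Real.cosh t * Real.cosh x : ℝ) : ℂ) +
        (p.1 : ℂ) * Complex.exp (Complex.I * p.2) * ((Real.sinh t * Real.sinh x : ℝ) : ℂ)‖) =
      F p) :
    translation α β t g x = ∫ p in rectangle, F p ∂(ν.prod ν') := by
  rw [translation, hν.radialMean_eq,
    setIntegral_prod _ (hF.continuousOn.integrableOn_compact isCompact_rectangle)]
  refine setIntegral_congr_fun measurableSet_Icc fun r hr => ?_
  simp only [hν'.angularMean_eq]
  exact setIntegral_congr_fun measurableSet_Icc fun χ _ => hgF (r, χ) hr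

theorem translation_sum (hβ : -1 / 2 ≤ β) (hα : -1 / 2 < α) (hν : IsRadialMeasure α β ν)
    (hν' : IsAngularMeasure β ν') (s : Finset ι) (c μ : ι → ℝ) (t : ℝ) {x : ℝ} (hx : 0 ≤ x) :
    translation α β t (fun y => ∑ i ∈ s, c i * jacobiPhi α β (μ i) y) x =
      (ν.prod ν').real rectangle *
        ∑ i ∈ s, c i * (jacobiPhi α β (μ i) t * jacobiPhi α β (μ i) x) := by
  choose P P₁ P₂ hP using exists_isRadialExtension (α := α) β (by linarith)
  have hcont : ∀ i, Continuous fun p => c i * P (μ i) (transArg t x p) := fun i =>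
    ((hP (μ i)).continuous.comp ((continuous_transArg t).uncurry_left x)).const_mul (c i)
  calc translation α β t (fun y => ∑ i ∈ s, c i * jacobiPhi α β (μ i) y) x
      = ∫ p in rectangle, ∑ i ∈ s, c i * P (μ i) (transArg t x p) ∂(ν.prod ν') :=
        translation_eq_setIntegral hν hν' (continuous_finsetSum s fun i _ => hcont i)
          fun p hp => Finset.sum_congr rfl fun i _ => by
            rw [jacobiPhi_arcosh_norm α β (μ i) t x hp,
              (hP (μ i)).eq_radialPhi (one_le_transArg t x hp)]
    _ = ∑ i ∈ s, c i * ∫ p in rectangle, P (μ i) (transArg t x p) ∂(ν.prod ν') := by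
        rw [integral_finsetSum s fun i _ =>
          (hcont i).continuousOn.integrableOn_compact isCompact_rectangle]
        simp only [integral_const_mul]
    _ = _ := by
        rw [Finset.mul_sum]
        refine Finset.sum_congr rfl fun i _ => ?_
        rw [integral_comp_transArg hβ hα hν hν' (hP (μ i)) t hx]
        ring

end Translation

theorem sum_sum_mul_conj_mul_sum {n : Type*} [Fintype n] (s : Finset ι) (c : ι → ℝ)
    (f : ι → n → ℝ) (b : n → ℂ) :
    ∑ i, ∑ j, b i * (starRingEnd ℂ) (b j) * ((∑ k ∈ s, c k * (f k i * f k j) : ℝ) : ℂ) =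
      ((∑ k ∈ s, c k * ‖∑ i, b i * (f k i : ℂ)‖ ^ 2 : ℝ) : ℂ) := by
  push_cast
  simp only [← Complex.mul_conj', map_sum, map_mul, Complex.conj_ofReal, Finset.sum_mul_sum]
  simp only [Finset.mul_sum]
  rw [Finset.sum_congr rfl fun i _ => Finset.sum_comm, Finset.sum_comm]
  exact Finset.sum_congr rfl fun k _ => Finset.sum_congr rfl fun i _ =>
    Finset.sum_congr rfl fun j _ => by ring

open scoped ComplexOrder in
theorem isPosDef_sum (hβ : -1 / 2 ≤ β) (hβα : β ≤ α) (hα : -1 / 2 < α) (s : Finset ι)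
    {c : ι → ℝ} (hc : ∀ i ∈ s, 0 ≤ c i) (μ : ι → ℝ) :
    IsPosDef α β fun t => ∑ i ∈ s, c i * jacobiPhi α β (μ i) t := by
  refine ⟨continuous_finsetSum _ fun i _ => (continuous_jacobiPhi α β (μ i)).const_mul _,
    fun t => by simp only [jacobiPhi_neg], fun N b x hx => ?_⟩
  obtain ⟨ν, _, hν⟩ := exists_isRadialMeasure hβ hβα
  obtain ⟨ν', _, hν'⟩ := exists_isAngularMeasure hβ
  simp only [translation_sum hβ hα hν hν' s c μ _ (hx _), Complex.ofReal_mul, mul_left_comm _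
    (((ν.prod ν').real rectangle : ℝ) : ℂ), ← Finset.mul_sum]
  rw [sum_sum_mul_conj_mul_sum s c fun k i => jacobiPhi α β (μ k) (x i)]
  exact_mod_cast mul_nonneg measureReal_nonneg
    (Finset.sum_nonneg fun k hk => mul_nonneg (hc k hk) (by positivity))

theorem setIntegral_sum_dirac {s : Finset ι} {c μ : ι → ℝ} {I : Set ℝ} (hI : MeasurableSet I)
    (hc : ∀ i ∈ s, 0 ≤ c i) (hμ : ∀ i ∈ s, μ i ∈ I) (f : ℝ → ℝ) :
    ∫ l in I, f l ∂(∑ i ∈ s, ENNReal.ofReal (c i) • Measure.dirac (μ i)) =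
      ∑ i ∈ s, c i * f (μ i) := by
  have hrestrict : (∑ i ∈ s, ENNReal.ofReal (c i) • Measure.dirac (μ i)).restrict I =
      ∑ i ∈ s, ENNReal.ofReal (c i) • Measure.dirac (μ i) := by
    rw [← Measure.restrictₗ_apply, map_sum]
    exact Finset.sum_congr rfl fun i hi => by
      rw [Measure.restrictₗ_apply, Measure.restrict_smul, restrict_dirac_of_mem hI (hμ i hi)]
  rw [hrestrict, integral_finsetSum_measure fun i _ =>
    (integrable_dirac (by simp)).smul_measure ENNReal.ofReal_ne_top]
  refine Finset.sum_congr rfl fun i hi => ?_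
  rw [integral_smul_measure, integral_dirac, ENNReal.toReal_ofReal (hc i hi), smul_eq_mul]

theorem sum_mem_classL (α β : ℝ) {γ : ℝ} {s : Finset ι} {c μ : ι → ℝ} (hc : ∀ i ∈ s, 0 < c i)
    (hs : s.Nonempty) (hμ : ∀ i ∈ s, μ i ∈ Set.Icc 0 γ) :
    (fun t => ∑ i ∈ s, c i * jacobiPhi α β (μ i) t) ∈ classL α β γ := by
  refine ⟨⟨∑ i ∈ s, ENNReal.ofReal (c i) • Measure.dirac (μ i), ⟨?_⟩, fun t => ?_⟩, ?_⟩
  · rw [Measure.finsetSum_apply]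
    exact ENNReal.sum_lt_top.2 fun i _ => by simp
  · exact (setIntegral_sum_dirac measurableSet_Icc (fun i hi => (hc i hi).le) hμ
      fun l => jacobiPhi α β l t).symm
  · simp only [jacobiPhi_zero_right, mul_one]
    exact Finset.sum_pos hc hs

end PosDef

/-! ### Shortest intervals -/

theorem numZeros_eq_zero {g : ℝ → ℝ} {I : Set ℝ} (hg : ∀ t ∈ I, g t ≠ 0) : numZeros g I = 0 :=
  le_antisymm (iSup₂_le fun _ hs => (Finset.sum_eq_zero fun t ht =>
    by_contra fun hne => hg t (hs ht) (analyticOrderAt_ne_zero.1 hne).2).le) bot_le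

theorem analyticOrderAt_le_numZeros (g : ℝ → ℝ) {I : Set ℝ} {t : ℝ} (ht : t ∈ I) :
    analyticOrderAt g t ≤ numZeros g I :=
  le_iSup₂_of_le {t} (by simpa using ht) (by simp)

theorem shortestLength_eq {g : ℝ → ℝ} {θ : ℝ} {n : ℕ} (hn : 1 ≤ n) (hθ : 0 < θ)
    (hg : ∀ t ∈ Set.Icc 0 θ, g t = 0 ↔ t = θ) (hord : analyticOrderAt g θ = n) :
    shortestLength g n = ENNReal.ofReal θ := by
  refine le_antisymm ?_ (le_iInf₂ fun L hL => ENNReal.ofReal_le_ofReal ?_)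
  · exact iInf₂_le θ
      ⟨hθ, hord.ge.trans (analyticOrderAt_le_numZeros g (Set.right_mem_Icc.2 hθ.le))⟩
  · by_contra! hlt
    have hnone : numZeros g (Set.Icc 0 L) = 0 := numZeros_eq_zero fun t ht hzero =>
      (ht.2.trans_lt hlt).ne ((hg t ⟨ht.1, ht.2.trans hlt.le⟩).1 hzero)
    have hcount := hL.2
    rw [hnone] at hcount
    exact absurd (Nat.cast_le.1 (hcount.trans_eq Nat.cast_zero.symm)) (by omega)

/-! ### Eigenvalues on an interval -/

theorem isNthPosZero_congr {f g : ℝ → ℝ} (h : ∀ x, f x = 0 ↔ g x = 0) (k : ℕ) (x : ℝ) :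
    IsNthPosZero f k x ↔ IsNthPosZero g k x := by
  simp only [IsNthPosZero, h]

theorem neg_div_pos_of_sign {k : ℕ} {A X : ℝ} (hA : 0 < (-1) ^ k * A) (hX : (-1) ^ k * X < 0) :
    0 < -A / X := by
  rcases neg_one_pow_eq_or ℝ k with hk | hk <;> rw [hk] at hA hX
  · exact div_pos_of_neg_of_neg (by linarith) (by linarith)
  · exact div_pos (by linarith) (by linarith)

/-- The Prüfer angles at `τ` of the parameters `z 1, …, z m ∈ (0, γ]` are `(i - a) π`. For
`a = 1 / 2` these are the first `m` parameters satisfying the Dirichlet condition at `τ`, for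
`a = 0` the first `m` positive ones satisfying the Neumann condition. -/
structure IsPruferSpectrum (w : ℝ → ℝ) (ψ : ℝ → ℝ → ℝ) (a γ τ : ℝ) (m : ℕ) (z : ℕ → ℝ) :
    Prop where
  pos {i : ℕ} (hi : i ∈ Finset.Icc 1 m) : 0 < z i
  le {i : ℕ} (hi : i ∈ Finset.Icc 1 m) : z i ≤ γ
  prufer_eq {i : ℕ} (hi : i ∈ Finset.Icc 1 m) : prufer w ψ (z i) τ = (i - a) * Real.pi

/-- The coefficients `-A_i / (D ψ'_{z_i}(τ))` of the odd extremal function. -/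
noncomputable def dirichletCoeff (ψ : ℝ → ℝ → ℝ) (D τ : ℝ) (m : ℕ) (z : ℕ → ℝ) (i : ℕ) : ℝ :=
  -pfCoeff z m i / (D * deriv (ψ (z i)) τ)

/-- The coefficients `-A_i / (z_i² ψ_{z_i}(τ))` of the even extremal function. -/
noncomputable def neumannCoeff (ψ : ℝ → ℝ → ℝ) (τ : ℝ) (m : ℕ) (z : ℕ → ℝ) (i : ℕ) : ℝ :=
  -pfCoeff z m i / (z i ^ 2 * ψ (z i) τ)

namespace SturmFamily

variable {w : ℝ → ℝ} {ψ : ℝ → ℝ → ℝ} {a γ τ : ℝ} {m : ℕ} {z : ℕ → ℝ} (S : SturmFamily w ψ)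

include S

theorem exists_forall_prufer_eq_iff {l x : ℝ} (hl : 0 < l) (hx : 0 < x) :
    ∃ θ > 0, ∀ t, 0 < t ∧ prufer w ψ l t = x ↔ t = θ := by
  obtain ⟨θ, hθ, hθx⟩ := S.exists_prufer_eq hl hx
  refine ⟨θ, hθ, fun t => ⟨fun ht => ?_, ?_⟩⟩
  · exact (S.strictMonoOn_prufer_right hl).injOn (Set.mem_Ici.2 ht.1.le) (Set.mem_Ici.2 hθ.le)
      (ht.2.trans hθx.symm)
  · rintro rfl
    exact ⟨hθ, hθx⟩

theorem nthPosZero_spec {f : ℝ → ℝ} {k : ℕ} {l t x : ℝ} (hl : 0 ≤ l) (ht : 0 < t) (hx : 0 < x)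
    (hxl : x ≤ prufer w ψ l t) (hf : ∀ μ, IsNthPosZero f k μ ↔ 0 < μ ∧ prufer w ψ μ t = x) :
    0 < nthPosZero f k ∧ nthPosZero f k ≤ l ∧ prufer w ψ (nthPosZero f k) t = x := by
  obtain ⟨μ, hμ, hμl, hμx⟩ := S.exists_prufer_left_eq hl hx hxl
  have heq : nthPosZero f k = μ := by
    refine nthPosZero_eq fun y => (hf y).trans ⟨fun hy => ?_, ?_⟩
    · exact (S.strictMonoOn_prufer_left ht).injOn (Set.mem_Ici.2 hy.1.le) (Set.mem_Ici.2 hμ.le)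
        (hy.2.trans hμx.symm)
    · rintro rfl
      exact ⟨hμ, hμx⟩
  rw [heq]
  exact ⟨hμ, hμl, hμx⟩

theorem isPruferSpectrum_nthPosZero {f : ℝ → ℝ} (hγ : 0 ≤ γ) (hτ : 0 < τ) (ha : a < 1)
    (hf : ∀ k, 1 ≤ k → ∀ μ, IsNthPosZero f k μ ↔ 0 < μ ∧ prufer w ψ μ τ = (k - a) * Real.pi)
    (hγτ : (m - a) * Real.pi ≤ prufer w ψ γ τ) :
    IsPruferSpectrum w ψ a γ τ m (nthPosZero f) := by
  have hspec : ∀ i ∈ Finset.Icc 1 m, 0 < nthPosZero f i ∧ nthPosZero f i ≤ γ ∧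
      prufer w ψ (nthPosZero f i) τ = (i - a) * Real.pi := fun i hi => by
    obtain ⟨hi1, him⟩ := Finset.mem_Icc.1 hi
    have hi1' : (1 : ℝ) ≤ i := by exact_mod_cast hi1
    have him' : (i : ℝ) ≤ m := by exact_mod_cast him
    refine S.nthPosZero_spec hγ hτ (mul_pos (by linarith) Real.pi_pos) (le_trans ?_ hγτ) (hf i hi1)
    gcongr
  exact ⟨fun hi => (hspec _ hi).1, fun hi => (hspec _ hi).2.1, fun hi => (hspec _ hi).2.2⟩

section Spectrum

variable (hτ : 0 < τ)

include hτ

theorem strictMonoOn_spectrum (hz : IsPruferSpectrum w ψ a γ τ m z) :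
    StrictMonoOn z (Finset.Icc 1 m) := fun i hi j hj hij => by
  refine ((S.strictMonoOn_prufer_left hτ).lt_iff_lt (Set.mem_Ici.2 (hz.pos hi).le)
    (Set.mem_Ici.2 (hz.pos hj).le)).1 ?_
  simp only [hz.prufer_eq hi, hz.prufer_eq hj]
  exact mul_lt_mul_of_pos_right (sub_lt_sub_right (Nat.cast_lt.2 hij) a) Real.pi_pos

theorem strictMonoOn_spectrum_sq (hz : IsPruferSpectrum w ψ a γ τ m z) :
    StrictMonoOn (fun i => z i ^ 2) (Finset.Icc 1 m) := fun _ hi _ hj hij =>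
  pow_lt_pow_left₀ (S.strictMonoOn_spectrum hτ hz hi hj hij) (hz.pos hi).le two_ne_zero

theorem neg_one_pow_mul_pfCoeff_spectrum_pos (hz : IsPruferSpectrum w ψ a γ τ m z) {i : ℕ}
    (hi : i ∈ Finset.Icc 1 m) : 0 < (-1) ^ (i - 1) * pfCoeff z m i :=
  neg_one_pow_mul_pfCoeff_pos (fun _ hj => hz.pos hj) (S.strictMonoOn_spectrum hτ hz) hi

end Spectrum

/-! ### The Dirichlet combination -/

section Dirichlet

variable (hτ : 0 < τ) (hz : IsPruferSpectrum w ψ (1 / 2) γ τ m z)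

include hτ hz

theorem dirichlet_eq_zero_and_sign {i : ℕ} (hi : i ∈ Finset.Icc 1 m) :
    ψ (z i) τ = 0 ∧ (-1) ^ (i - 1) * deriv (ψ (z i)) τ < 0 := by
  obtain ⟨k, rfl⟩ := Nat.exists_eq_add_of_le' (Finset.mem_Icc.1 hi).1
  have hangle : prufer w ψ (z (k + 1)) τ = k * Real.pi + Real.pi / 2 := by
    rw [hz.prufer_eq hi]
    push_cast
    ring
  obtain ⟨R, hR, hcos, hsin⟩ := S.exists_polar (z (k + 1)) hτ.le
  rw [hangle, Real.cos_add_pi_div_two, Real.sin_nat_mul_pi] at hcos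
  rw [hangle, Real.sin_add_pi_div_two, Real.cos_nat_mul_pi] at hsin
  refine ⟨by simpa using hcos, ?_⟩
  have hsq : ((-1 : ℝ) ^ k) * (-1) ^ k = 1 := by rw [← mul_pow]; simp
  have hflux : w τ * ((-1) ^ k * deriv (ψ (z (k + 1))) τ) = -R := by
    linear_combination (-1) ^ k * hsin - R * hsq
  rw [Nat.add_sub_cancel]
  exact (pos_iff_neg_of_mul_neg (hflux.trans_lt (neg_lt_zero.2 hR))).1 (S.weight_pos τ hτ)

theorem dirichletCoeff_pos {D : ℝ} (hD : 0 < D) {i : ℕ} (hi : i ∈ Finset.Icc 1 m) :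
    0 < dirichletCoeff ψ D τ m z i :=
  neg_div_pos_of_sign (S.neg_one_pow_mul_pfCoeff_spectrum_pos hτ hz hi) (by
    rw [mul_left_comm]
    exact mul_neg_of_pos_of_neg hD (S.dirichlet_eq_zero_and_sign hτ hz hi).2)

theorem combination_dirichlet_eq_zero (c : ℕ → ℝ) (k : ℕ) :
    combination ψ (Finset.Icc 1 m) c z k τ = 0 :=
  Finset.sum_eq_zero fun _ hi => by rw [(S.dirichlet_eq_zero_and_sign hτ hz hi).1, mul_zero]

theorem deriv_combination_dirichlet {D : ℝ} (hD : D ≠ 0) {k : ℕ} (hk : k < m) :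
    deriv (combination ψ (Finset.Icc 1 m) (dirichletCoeff ψ D τ m z) z k) τ =
      -((-1) ^ (m - 1) * (∏ j ∈ Finset.Icc 1 m, z j ^ 2) * if k = m - 1 then 1 else 0) / D := by
  rw [S.deriv_combination, ← sum_pfCoeff_mul_pow (S.strictMonoOn_spectrum_sq hτ hz).injOn hk,
    neg_div, Finset.sum_div, ← Finset.sum_neg_distrib]
  refine Finset.sum_congr rfl fun i hi => ?_
  have hderiv := right_ne_zero_of_mul (S.dirichlet_eq_zero_and_sign hτ hz hi).2.ne
  rw [dirichletCoeff]
  field_simp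

theorem deriv_combination_dirichlet_eq_zero {D : ℝ} (hD : D ≠ 0) {k : ℕ} (hk : k < m - 1) :
    deriv (combination ψ (Finset.Icc 1 m) (dirichletCoeff ψ D τ m z) z k) τ = 0 := by
  rw [S.deriv_combination_dirichlet hτ hz hD (by omega), if_neg hk.ne, mul_zero, neg_zero,
    zero_div]

theorem combination_dirichlet_ne_zero {D : ℝ} (hD : 0 < D) (hm : 1 ≤ m) {t : ℝ} (ht : 0 < t)
    (htτ : t < τ) : combination ψ (Finset.Icc 1 m) (dirichletCoeff ψ D τ m z) z 0 t ≠ 0 := by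
  have hmem : m ∈ Finset.Icc 1 m := Finset.right_mem_Icc.2 hm
  refine S.combination_ne_zero_of_dirichlet (n := m - 1) hmem
    (S.dirichletCoeff_pos hτ hz hD hmem).ne' (hz.pos hmem)
    (fun i hi him => S.strictMonoOn_spectrum_sq hτ hz hi hmem
      (lt_of_le_of_ne (Finset.mem_Icc.1 hi).2 him)) ?_
    (S.combination_dirichlet_eq_zero hτ hz _)
    (fun k hk => S.deriv_combination_dirichlet_eq_zero hτ hz hD.ne' hk) ht htτ
  rw [hz.prufer_eq hmem, Nat.cast_sub hm]
  push_cast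
  nlinarith [Real.pi_pos]

theorem analyticOrderAt_combination_dirichlet {D : ℝ} (hD : D ≠ 0) (hm : 1 ≤ m) :
    analyticOrderAt (combination ψ (Finset.Icc 1 m) (dirichletCoeff ψ D τ m z) z 0) τ =
      (2 * m - 1 : ℕ) := by
  have hzero := S.combination_dirichlet_eq_zero hτ hz (dirichletCoeff ψ D τ m z)
  have hsimple : deriv (combination ψ (Finset.Icc 1 m) (dirichletCoeff ψ D τ m z) z (m - 1)) τ ≠
      0 := by
    rw [S.deriv_combination_dirichlet hτ hz hD (by omega), if_pos rfl, mul_one]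
    exact div_ne_zero (neg_ne_zero.2 (mul_ne_zero (by simp) (Finset.prod_ne_zero_iff.2
      fun j hj => (pow_pos (hz.pos hj) 2).ne'))) hD
  rw [S.analyticOrderAt_combination_eq_add _ _ _ hτ (fun k _ => hzero k)
      (fun k hk => S.deriv_combination_dirichlet_eq_zero hτ hz hD hk),
    (S.analyticAt_combination _ _ _ _ τ).analyticOrderAt_eq_one_of_zero_deriv_ne_zero
      (hzero _) hsimple,
    show 2 * m - 1 = 1 + 2 * (m - 1) by omega, Nat.cast_add, Nat.cast_one]

end Dirichlet

end SturmFamily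

/-! ### The Neumann combination -/

section Insert

variable {ι : Type*} [DecidableEq ι] {s : Finset ι} {a : ι}

theorem forall_mem_insert_update (ha : a ∉ s) {f : ι → ℝ} {x : ℝ} {p : ι → ℝ → Prop} :
    (∀ i ∈ insert a s, p i (Function.update f a x i)) ↔ p a x ∧ ∀ i ∈ s, p i (f i) := by
  rw [Finset.forall_mem_insert, Function.update_self]
  refine and_congr_right fun _ => forall₂_congr fun i hi => ?_
  rw [Function.update_of_ne (ne_of_mem_of_not_mem hi ha)]

theorem sum_insert_update (ha : a ∉ s) (c μ : ι → ℝ) (x y : ℝ) (F : ℝ → ℝ → ℝ) :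
    ∑ i ∈ insert a s, F (Function.update c a x i) (Function.update μ a y i) =
      F x y + ∑ i ∈ s, F (c i) (μ i) := by
  rw [Finset.sum_insert ha, Function.update_self, Function.update_self]
  refine congrArg (F x y + ·) (Finset.sum_congr rfl fun i hi => ?_)
  have hia := ne_of_mem_of_not_mem hi ha
  rw [Function.update_of_ne hia, Function.update_of_ne hia]

end Insert

namespace SturmFamily

variable {w : ℝ → ℝ} {ψ : ℝ → ℝ → ℝ} {γ τ : ℝ} {m : ℕ} {z : ℕ → ℝ} (S : SturmFamily w ψ)
  (hτ : 0 < τ) (hz : IsPruferSpectrum w ψ 0 γ τ m z)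

include S hτ hz

theorem neumann_sign_and_deriv_eq_zero {i : ℕ} (hi : i ∈ Finset.Icc 1 m) :
    (-1) ^ (i - 1) * ψ (z i) τ < 0 ∧ deriv (ψ (z i)) τ = 0 := by
  obtain ⟨k, rfl⟩ := Nat.exists_eq_add_of_le' (Finset.mem_Icc.1 hi).1
  obtain ⟨R, hR, hcos, hsin⟩ := S.exists_polar (z (k + 1)) hτ.le
  rw [hz.prufer_eq hi, sub_zero, Real.cos_nat_mul_pi] at hcos
  rw [hz.prufer_eq hi, sub_zero, Real.sin_nat_mul_pi] at hsin
  constructor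
  · have hsq : ((-1 : ℝ) ^ k) * (-1) ^ k = 1 := by rw [← mul_pow]; simp
    rw [hcos, Nat.add_sub_cancel, pow_succ]
    linear_combination hR - R * hsq
  · exact (mul_eq_zero.1 (hsin.trans (by simp))).resolve_left (S.weight_pos τ hτ).ne'

theorem neumannCoeff_pos {i : ℕ} (hi : i ∈ Finset.Icc 1 m) : 0 < neumannCoeff ψ τ m z i :=
  neg_div_pos_of_sign (S.neg_one_pow_mul_pfCoeff_spectrum_pos hτ hz hi) (by
    rw [mul_left_comm]
    exact mul_neg_of_pos_of_neg (pow_pos (hz.pos hi) 2)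
      (S.neumann_sign_and_deriv_eq_zero hτ hz hi).1)

theorem deriv_combination_neumann (c : ℕ → ℝ) (k : ℕ) :
    deriv (combination ψ (insert 0 (Finset.Icc 1 m)) c (Function.update z 0 0) k) τ = 0 := by
  have hderiv : ∀ i ∈ insert 0 (Finset.Icc 1 m), deriv (ψ (Function.update z 0 0 i)) τ = 0 :=
    (forall_mem_insert_update (p := fun _ l => deriv (ψ l) τ = 0) (by simp)).2
      ⟨by simp [funext S.zero_left], fun i hi => (S.neumann_sign_and_deriv_eq_zero hτ hz hi).2⟩
  rw [S.deriv_combination]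
  exact Finset.sum_eq_zero fun i hi => by rw [hderiv i hi, mul_zero]

theorem combination_neumannCoeff (k : ℕ) :
    combination ψ (Finset.Icc 1 m) (neumannCoeff ψ τ m z) z k τ =
      -∑ i ∈ Finset.Icc 1 m, pfCoeff z m i / z i ^ 2 * (z i ^ 2) ^ k := by
  rw [combination, ← Finset.sum_neg_distrib]
  refine Finset.sum_congr rfl fun i hi => ?_
  have hψ := right_ne_zero_of_mul (S.neumann_sign_and_deriv_eq_zero hτ hz hi).1.ne
  have hzi := (hz.pos hi).ne'
  rw [neumannCoeff]
  field_simp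

theorem combination_neumann_zero (hm : 1 ≤ m) :
    combination ψ (insert 0 (Finset.Icc 1 m)) (Function.update (neumannCoeff ψ τ m z) 0 1)
      (Function.update z 0 0) 0 τ = 0 := by
  have hsum := S.combination_neumannCoeff hτ hz 0
  simp only [pow_zero, mul_one] at hsum
  rw [sum_pfCoeff_div hm (fun i hi => (hz.pos hi).ne')
    (S.strictMonoOn_spectrum_sq hτ hz).injOn] at hsum
  rw [combination, sum_insert_update (by simp) _ _ 1 0 fun c l => c * (l ^ 2) ^ 0 * ψ l τ,
    S.zero_left, ← combination, hsum]
  norm_num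

theorem combination_neumann_succ {k : ℕ} (hk : k < m) :
    combination ψ (insert 0 (Finset.Icc 1 m)) (Function.update (neumannCoeff ψ τ m z) 0 1)
      (Function.update z 0 0) (k + 1) τ =
      -((-1) ^ (m - 1) * (∏ j ∈ Finset.Icc 1 m, z j ^ 2) * if k = m - 1 then 1 else 0) := by
  rw [combination, sum_insert_update (by simp) _ _ 1 0 fun c l => c * (l ^ 2) ^ (k + 1) * ψ l τ,
    ← combination, S.combination_neumannCoeff hτ hz,
    ← sum_pfCoeff_mul_pow (S.strictMonoOn_spectrum_sq hτ hz).injOn hk]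
  have hterm : ∀ i ∈ Finset.Icc 1 m, pfCoeff z m i / z i ^ 2 * (z i ^ 2) ^ (k + 1) =
      pfCoeff z m i * (z i ^ 2) ^ k := fun i hi => by
    have hzi := (hz.pos hi).ne'
    field_simp
    ring
  rw [Finset.sum_congr rfl hterm]
  simp

theorem combination_neumann_eq_zero {k : ℕ} (hk : k < m) :
    combination ψ (insert 0 (Finset.Icc 1 m)) (Function.update (neumannCoeff ψ τ m z) 0 1)
      (Function.update z 0 0) k τ = 0 := by
  rcases k with _ | k
  · exact S.combination_neumann_zero hτ hz hk
  · rw [S.combination_neumann_succ hτ hz (by omega), if_neg (by omega), mul_zero, neg_zero]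

theorem combination_neumann_ne_zero (hm : 1 ≤ m) {t : ℝ} (ht : 0 < t) (htτ : t < τ) :
    combination ψ (insert 0 (Finset.Icc 1 m)) (Function.update (neumannCoeff ψ τ m z) 0 1)
      (Function.update z 0 0) 0 t ≠ 0 := by
  have hmem : m ∈ Finset.Icc 1 m := Finset.right_mem_Icc.2 hm
  have hm0 : m ≠ 0 := by omega
  have hlast : Function.update z 0 0 m = z m := Function.update_of_ne hm0 _ _
  refine S.combination_ne_zero_of_neumann (n := m) (M := m) (Finset.mem_insert_of_mem hmem) ?_ ?_
    ?_ ?_ (fun k hk => S.combination_neumann_eq_zero hτ hz hk)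
    (S.deriv_combination_neumann hτ hz _) ht htτ
  · rw [Function.update_of_ne hm0]
    exact (S.neumannCoeff_pos hτ hz hmem).ne'
  · rw [hlast]
    exact hz.pos hmem
  · rw [hlast]
    exact (forall_mem_insert_update (p := fun i l => i ≠ m → l ^ 2 < z m ^ 2) (by simp)).2
      ⟨fun _ => by simpa using pow_pos (hz.pos hmem) 2, fun i hi him =>
        S.strictMonoOn_spectrum_sq hτ hz hi hmem (lt_of_le_of_ne (Finset.mem_Icc.1 hi).2 him)⟩
  · rw [hlast, hz.prufer_eq hmem]
    nlinarith [Real.pi_pos]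

theorem analyticOrderAt_combination_neumann (hm : 1 ≤ m) :
    analyticOrderAt (combination ψ (insert 0 (Finset.Icc 1 m))
      (Function.update (neumannCoeff ψ τ m z) 0 1) (Function.update z 0 0) 0) τ =
      (2 * m : ℕ) := by
  have hne : combination ψ (insert 0 (Finset.Icc 1 m))
      (Function.update (neumannCoeff ψ τ m z) 0 1) (Function.update z 0 0) m τ ≠ 0 := by
    obtain ⟨k, rfl⟩ := Nat.exists_eq_add_of_le' hm
    rw [S.combination_neumann_succ hτ hz (by omega), if_pos (by omega), mul_one]
    exact neg_ne_zero.2 (mul_ne_zero (by simp) (Finset.prod_ne_zero_iff.2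
      fun j hj => (pow_pos (hz.pos hj) 2).ne'))
  rw [S.analyticOrderAt_combination_eq_add _ _ _ hτ
      (fun k hk => S.combination_neumann_eq_zero hτ hz hk)
      (fun k _ => S.deriv_combination_neumann hτ hz _ k),
    (S.analyticAt_combination _ _ _ m τ).analyticOrderAt_eq_zero.2 hne, zero_add]

end SturmFamily

/-! ### The extremal functions -/

section Extremal

variable {α β γ θ : ℝ}

section Order

variable {ι : Type*} (hρ : 0 < α + β + 1) (hβα : β < α + 1) (s : Finset ι) (c μ : ι → ℝ)

include hρ hβα

theorem sum_mul_jacobiPhi_eq_mul_combination :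
    (fun t => ∑ i ∈ s, c i * jacobiPhi α β (μ i) t) =
      jacobiPhi α β 0 * combination (jacobiPsi α β) s c μ 0 := by
  funext t
  rw [Pi.mul_apply, combination, Finset.mul_sum]
  refine Finset.sum_congr rfl fun i _ => ?_
  rw [← jacobiPhi_zero_mul_jacobiPsi hρ hβα, pow_zero, mul_one, mul_left_comm]

theorem sum_mul_jacobiPhi_eq_zero_iff (t : ℝ) :
    ∑ i ∈ s, c i * jacobiPhi α β (μ i) t = 0 ↔ combination (jacobiPsi α β) s c μ 0 t = 0 := by
  rw [congrFun (sum_mul_jacobiPhi_eq_mul_combination hρ hβα s c μ) t, Pi.mul_apply, mul_eq_zero,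
    or_iff_right (jacobiPhi_zero_pos hρ hβα t).ne']

theorem analyticOrderAt_sum_mul_jacobiPhi {t : ℝ}
    (ha : AnalyticAt ℝ (combination (jacobiPsi α β) s c μ 0) t) :
    analyticOrderAt (fun t => ∑ i ∈ s, c i * jacobiPhi α β (μ i) t) t =
      analyticOrderAt (combination (jacobiPsi α β) s c μ 0) t := by
  have hφ := analyticAt_jacobiPhi α β 0 t
  rw [sum_mul_jacobiPhi_eq_mul_combination hρ hβα, analyticOrderAt_mul hφ ha,
    hφ.analyticOrderAt_eq_zero.2 (jacobiPhi_zero_pos hρ hβα t).ne', zero_add]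

theorem coeffB_eq_dirichletCoeff {m i : ℕ} (hzero : jacobiPsi α β (lam α β i θ) θ = 0) :
    coeffB α β m θ i =
      dirichletCoeff (jacobiPsi α β) (weight α β θ * jacobiPhi α β 0 θ) θ m
        (fun j => lam α β j θ) i := by
  have hpos := (jacobiPhi_zero_pos hρ hβα θ).ne'
  have hderiv : jacobiPhi α β 0 θ * deriv (jacobiPsi α β (lam α β i θ)) θ =
      deriv (jacobiPhi α β (lam α β i θ)) θ := by
    rw [(hasDerivAt_jacobiPsi hρ hβα _ θ).deriv, (jacobiPsi_eq_zero_iff hρ hβα _ θ).1 hzero]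
    field_simp
    ring
  rw [coeffB, dirichletCoeff, mul_assoc, hderiv]

end Order

variable (hβ : -1 / 2 ≤ β) (hβα : β ≤ α) (hα : -1 / 2 < α)

include hβ hβα hα

theorem isExtremal_sum {ι : Type*} {n : ℕ} {s : Finset ι} {c μ : ι → ℝ} (hn : 1 ≤ n) (hθ : 0 < θ)
    (hc : ∀ i ∈ s, 0 < c i) (hs : s.Nonempty) (hμ : ∀ i ∈ s, μ i ∈ Set.Icc 0 γ)
    (hne : ∀ t, 0 < t → t < θ → combination (jacobiPsi α β) s c μ 0 t ≠ 0)
    (hord : analyticOrderAt (combination (jacobiPsi α β) s c μ 0) θ = n) :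
    IsExtremal α β γ n θ fun t => ∑ i ∈ s, c i * jacobiPhi α β (μ i) t := by
  have hρ : 0 < α + β + 1 := by linarith
  have hβα' : β < α + 1 := by linarith
  have hmem := sum_mem_classL α β hc hs hμ
  have hord' := (analyticOrderAt_sum_mul_jacobiPhi hρ hβα' s c μ
    ((sturmFamily_jacobiPsi hβ hβα' hα).analyticAt_combination s c μ 0 θ)).trans hord
  have hzero : ∀ t ∈ Set.Icc 0 θ, ∑ i ∈ s, c i * jacobiPhi α β (μ i) t = 0 ↔ t = θ := by
    refine fun t ht => ⟨fun hGt => ?_, ?_⟩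
    · by_contra htθ
      rcases ht.1.eq_or_lt with rfl | ht0
      · exact hmem.2.ne' hGt
      · exact hne t ht0 (lt_of_le_of_ne ht.2 htθ)
          ((sum_mul_jacobiPhi_eq_zero_iff hρ hβα' s c μ t).1 hGt)
    · rintro rfl
      exact (analyticOrderAt_ne_zero.1 (hord'.trans_ne (Nat.cast_ne_zero.2 (by omega)))).2
  exact ⟨hmem, isPosDef_sum hβ hβα hα s (fun i hi => (hc i hi).le) μ,
    shortestLength_eq hn hθ hzero hord', hzero, hord'⟩

theorem isNthPosZero_jacobiPhi {t : ℝ} (ht : 0 < t) {k : ℕ} (hk : 1 ≤ k) (l : ℝ) :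
    IsNthPosZero (fun μ => jacobiPhi α β μ t) k l ↔ 0 < l ∧
      prufer (fun t => weight α β t * jacobiPhi α β 0 t ^ 2) (jacobiPsi α β) l t =
        (k - 1 / 2) * Real.pi := by
  obtain ⟨k, rfl⟩ := Nat.exists_eq_add_of_le' hk
  rw [show ((k + 1 : ℕ) : ℝ) - 1 / 2 = k + 1 / 2 by push_cast; ring,
    ← (sturmFamily_jacobiPsi hβ (by linarith) hα).isNthPosZero_left ht]
  exact isNthPosZero_congr
    (fun μ => (jacobiPsi_eq_zero_iff (by linarith) (by linarith) μ t).symm) _ _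

theorem isNthPosZero_jacobiPsiDeriv {t : ℝ} (ht : 0 < t) {k : ℕ} (hk : 1 ≤ k) (l : ℝ) :
    IsNthPosZero (fun μ => jacobiPsiDeriv α β μ t) k l ↔ 0 < l ∧
      prufer (fun t => weight α β t * jacobiPhi α β 0 t ^ 2) (jacobiPsi α β) l t =
        (k - 0) * Real.pi := by
  obtain ⟨k, rfl⟩ := Nat.exists_eq_add_of_le' hk
  rw [sub_zero, Nat.cast_succ]
  exact (sturmFamily_jacobiPsi hβ (by linarith) hα).isNthPosZero_deriv_left ht k l

theorem exists_isExtremal_odd (hγ : 0 < γ) {m : ℕ} (hm : 1 ≤ m) :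
    ∃ θ : ℝ, (∀ t, IsT α β m γ t ↔ t = θ) ∧ (∀ i ∈ Finset.Icc 1 m, 0 < coeffB α β m θ i) ∧
      IsExtremal α β γ (2 * m - 1) θ (extremalOdd α β m θ) := by
  have hρ : 0 < α + β + 1 := by linarith
  have hβα' : β < α + 1 := by linarith
  have S := sturmFamily_jacobiPsi hβ hβα' hα
  have hm' : (1 : ℝ) ≤ m := by exact_mod_cast hm
  obtain ⟨θ, hθ, hθ_iff⟩ := S.exists_forall_prufer_eq_iff hγ
    (mul_pos (by linarith : (0 : ℝ) < m - 1 / 2) Real.pi_pos)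
  have hz : IsPruferSpectrum _ _ (1 / 2) γ θ m fun j => lam α β j θ :=
    S.isPruferSpectrum_nthPosZero hγ.le hθ (by norm_num)
      (fun k hk => isNthPosZero_jacobiPhi hβ hβα hα hθ hk) ((hθ_iff θ).2 rfl).2.ge
  have hD := mul_pos (weight_pos α β hθ) (jacobiPhi_zero_pos hρ hβα' θ)
  have hcoeff : ∀ i ∈ Finset.Icc 1 m, coeffB α β m θ i = _ := fun i hi =>
    coeffB_eq_dirichletCoeff hρ hβα' (S.dirichlet_eq_zero_and_sign hθ hz hi).1
  have hodd : extremalOdd α β m θ = _ :=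
    funext fun t => Finset.sum_congr rfl fun i hi => by rw [hcoeff i hi]
  refine ⟨θ, fun t => ?_, fun i hi => ?_, ?_⟩
  · rw [← hθ_iff]
    exact and_congr_right fun ht =>
      (isNthPosZero_jacobiPhi hβ hβα hα ht hm γ).trans (and_iff_right hγ)
  · rw [hcoeff i hi]
    exact S.dirichletCoeff_pos hθ hz hD hi
  · rw [hodd]
    exact isExtremal_sum hβ hβα hα (by omega) hθ (fun i hi => S.dirichletCoeff_pos hθ hz hD hi)
      ⟨m, Finset.right_mem_Icc.2 hm⟩ (fun i hi => ⟨(hz.pos hi).le, hz.le hi⟩)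
      (fun t => S.combination_dirichlet_ne_zero hθ hz hD hm)
      (S.analyticOrderAt_combination_dirichlet hθ hz hD.ne' hm)

theorem exists_isExtremal_even (hγ : 0 < γ) {m : ℕ} (hm : 1 ≤ m) :
    ∃ θ : ℝ, (∀ t, IsTStar α β m γ t ↔ t = θ) ∧
      (∀ i ∈ Finset.Icc 1 m, 0 < coeffBStar α β m θ i) ∧
      IsExtremal α β γ (2 * m) θ (extremalEven α β m θ) := by
  have S := sturmFamily_jacobiPsi hβ (by linarith) hα
  have hm' : (1 : ℝ) ≤ m := by exact_mod_cast hm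
  obtain ⟨θ, hθ, hθ_iff⟩ := S.exists_forall_prufer_eq_iff hγ
    (mul_pos (by linarith : (0 : ℝ) < m - 0) Real.pi_pos)
  have hz : IsPruferSpectrum _ _ 0 γ θ m fun j => lamStar α β j θ :=
    S.isPruferSpectrum_nthPosZero hγ.le hθ one_pos
      (fun k hk => isNthPosZero_jacobiPsiDeriv hβ hβα hα hθ hk) ((hθ_iff θ).2 rfl).2.ge
  have hB : ∀ i ∈ Finset.Icc 1 m, 0 < coeffBStar α β m θ i := fun i hi =>
    S.neumannCoeff_pos hθ hz hi
  have heven : extremalEven α β m θ = fun t => ∑ i ∈ insert 0 (Finset.Icc 1 m),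
      Function.update (coeffBStar α β m θ) 0 1 i *
        jacobiPhi α β (Function.update (fun j => lamStar α β j θ) 0 0 i) t := funext fun t => by
    rw [sum_insert_update (by simp) _ _ 1 0 fun c l => c * jacobiPhi α β l t, one_mul, extremalEven]
  refine ⟨θ, fun t => ?_, hB, ?_⟩
  · rw [← hθ_iff]
    exact and_congr_right fun ht =>
      (isNthPosZero_jacobiPsiDeriv hβ hβα hα ht hm γ).trans (and_iff_right hγ)
  · rw [heven]
    exact isExtremal_sum hβ hβα hα (by omega) hθ
      ((forall_mem_insert_update (p := fun _ x => 0 < x) (by simp)).2 ⟨one_pos, hB⟩)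
      (Finset.insert_nonempty _ _)
      ((forall_mem_insert_update (p := fun _ x => x ∈ Set.Icc 0 γ) (by simp)).2
        ⟨⟨le_rfl, hγ.le⟩, fun i hi => ⟨(hz.pos hi).le, hz.le hi⟩⟩)
      (fun t => S.combination_neumann_ne_zero hθ hz hm)
      (S.analyticOrderAt_combination_neumann hθ hz hm)

end Extremal

end JacobiZeros

open JacobiZeros in
theorem theorem2 (α β γ : ℝ) (hβ : -1 / 2 ≤ β) (hβα : β ≤ α) (hα : -1 / 2 < α) (hγ : 0 < γ)
    (m : ℕ) (hm : 1 ≤ m) :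
    (∃ θ : ℝ, (∀ t, IsT α β m γ t ↔ t = θ) ∧
      (⨅ g ∈ classL α β γ, shortestLength g (2 * m - 1)) ≤ ENNReal.ofReal θ ∧
      (∀ i ∈ Finset.Icc 1 m, 0 < coeffB α β m θ i) ∧
      IsExtremal α β γ (2 * m - 1) θ (extremalOdd α β m θ)) ∧
    (∃ θ : ℝ, (∀ t, IsTStar α β m γ t ↔ t = θ) ∧
      (⨅ g ∈ classL α β γ, shortestLength g (2 * m)) ≤ ENNReal.ofReal θ ∧
      (∀ i ∈ Finset.Icc 1 m, 0 < coeffBStar α β m θ i) ∧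
      IsExtremal α β γ (2 * m) θ (extremalEven α β m θ)) := by
  obtain ⟨θ, hθ, hB, hG⟩ := exists_isExtremal_odd hβ hβα hα hγ hm
  obtain ⟨θ', hθ', hB', hG'⟩ := exists_isExtremal_even hβ hβα hα hγ hm
  exact ⟨⟨θ, hθ, (iInf₂_le _ hG.1).trans hG.2.2.1.le, hB, hG⟩,
    ⟨θ', hθ', (iInf₂_le _ hG'.1).trans hG'.2.2.1.le, hB', hG'⟩⟩
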